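/- Let $\Sigma$ be an alphabet of constant size $\sigma$, and let $t_0$, $t_1$ be strings, each consisting of a (possibly empty) string over $\Sigma$ followed by an end marker $\$_0$, respectively $\$_1$, where $\$_0<\$_1$ are not in $\Sigma$ and are smaller than all symbols of $\Sigma$. For a string $t$ of length $m$, its suffix array $\mathrm{sa}$ lists the starting positions of the suffixes of $t$ in lexicographic order; $\mathrm{lcp}[1..m+1]$ is given by $\mathrm{lcp}[1]=\mathrm{lcp}[m+1]=-1$ and, for $1<i\le m$, $\mathrm{lcp}[i]=$ the length of the longest common prefix of the $(i-1)$-th and the $i$-th suffix; $\mathrm{bwt}[i]$ is the symbol preceding the $i$-th suffix (the last symbol of $t$ if this suffix is $t$ itself). Write $\mathrm{bwt}_b,\mathrm{lcp}_b$ for the arrays of $t_b$, let $n=|\mathrm{bwt}_0|+|\mathrm{bwt}_1|$, and let $\mathrm{lcp}_{01}$ be the LCP array of the concatenation $t_0t_1$. The multi-string BWT $\mathrm{bwt}_{01}$ lists the symbols preceding the suffixes of $t_0t_1$ in lexicographic order, except that $t_0t_1$ itself contributes $\$_0$ and the suffix $t_1$ contributes $\$_1$. Let $\mathrm{aveLcp}_{01}=\frac1n\sum_{1<i\le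 n}\mathrm{lcp}_{01}[i]$. The Gap algorithm computes bit vectors $Z^{(0)}=0^{n_0}1^{n_1},Z^{(1)},Z^{(2)},\dots$ ($n_b=|\mathrm{bwt}_b|$), where $Z^{(h)}$ merges $\mathrm{bwt}_0$ and $\mathrm{bwt}_1$ according to the first $h$ symbols following each BWT symbol, together with an integer array $B$ marking the boundaries of the blocks of entries that agree on these $h$ symbols. Iteration $h$ scans $Z^{(h-1)}$ and moves each bit to the next free position for its BWT symbol. A block that contains only $0$'s or only $1$'s (monochrome) becomes irrelevant once it has been processed, and is skipped from then on; adjacent irrelevant blocks are merged, and each is stored with its numbers of $0$'s, of $1$'s and of occurrences of each symbol. When no active block is left, $\mathrm{bwt}_{01}$ is read off the bit vector, and $\mathrm{lcp}_{01}$ off $B$ (at block boundaries) and off $\mathrm{lcp}_0,\mathrm{lcp}_1$ (inside blocks). Then, on a word RAM with words of $\log_2 n+O(1)$ bits, given $\mathrm{bwt}_0,\mathrm{lcp}_0,\mathrm{bwt}_1,\mathrm{lcp}_1$, the Gap algorithm computes $\mathrm{bwt}_{01}$ and $\mathrm{lcp}_{01}$ in time $O(\max(1,\,n\cdot\mathrm{aveLcp}_{01}))$.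 Its working space (in addition to input and output; $B$ uses the space of the output LCP array) is $2n+O(\log n)$ bits, plus the space used for handling the irrelevant blocks, which is $O(1)$ words for each irrelevant block, that is, at most a constant times the largest number of irrelevant blocks present after any iteration. The constants depend only on $\sigma$. -/

import Mathlib

open scoped BigOperators

namespace Gap

/-! ## Strings, suffix arrays, BWT and LCP arrays

All arrays are indexed from `0`. Symbols are natural numbers: `0` is `$₀`, `1` is `$₁`, and the
letters of the alphabet `Σ = Fin σ` are `2, …, σ + 1`. -/

/-- The string `u` over the alphabet `Fin σ`, terminated by the end marker `$_b`. -/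
def text {σ : ℕ} (b : Fin 2) (u : List (Fin σ)) : List ℕ :=
  u.map (fun a => a.val + 2) ++ [b.val]

/-- Length of the longest common prefix of two strings. -/
def lcpLen : List ℕ → List ℕ → ℕ
  | a :: s, b :: t => if a = b then lcpLen s t + 1 else 0
  | _, _ => 0

/-- The suffix array: the starting positions of the suffixes of `t`, sorted by the lexicographic
order of the suffixes (a proper prefix is smaller). -/
def suffixArray (t : List ℕ) : List ℕ :=
  (List.range t.length).insertionSort (fun i j => t.drop i ≤ t.drop j)

/-- The LCP array of `t`, with entries `0, …, |t|`; the first and the last entry are `-1`. -/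
def lcpArray (t : List ℕ) (i : ℕ) : ℤ :=
  if 1 ≤ i ∧ i < t.length then
    (lcpLen (t.drop ((suffixArray t).getD (i - 1) 0)) (t.drop ((suffixArray t).getD i 0)) : ℤ)
  else -1

/-- The average of the LCP array, `(∑ lcp[i]) / |t|`, without the two conventional entries `-1`. -/
noncomputable def aveLcp (t : List ℕ) : ℝ :=
  (∑ i ∈ Finset.Ico 1 t.length, (lcpArray t i : ℝ)) / (t.length : ℝ)

/-- The Burrows–Wheeler transform of a single string. -/
def bwt (t : List ℕ) : List ℕ :=
  (suffixArray t).map fun p => if p = 0 then t.getD (t.length - 1) 0 else t.getD (p - 1) 0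

/-- The multi-string BWT of `t₀` and `t₁`, through the suffix array of the concatenation. -/
def bwt₂ (t₀ t₁ : List ℕ) : List ℕ :=
  (suffixArray (t₀ ++ t₁)).map fun p =>
    if p = 0 then t₀.getD (t₀.length - 1) 0
    else if p < t₀.length then t₀.getD (p - 1) 0
    else if p = t₀.length then t₁.getD (t₁.length - 1) 0
    else t₁.getD (p - t₀.length - 1) 0

/-! ## Blocks and irrelevant blocks -/

/-- The `i`-th suffix of `t₀t₁` in lexicographic order starts in `t₀`. -/
def FromFirst (t₀ t₁ : List ℕ) (i : ℕ) : Prop :=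
  (suffixArray (t₀ ++ t₁)).getD i 0 < t₀.length

/-- Positions `i` and `j` lie in the same block of depth `h`: the suffixes ranked between them
share their first `h` symbols. -/
def SameBlock (t₀ t₁ : List ℕ) (h i j : ℕ) : Prop :=
  ∀ m, min i j < m → m ≤ max i j → (h : ℤ) ≤ lcpArray (t₀ ++ t₁) m

/-- Position `i` lies in a monochrome block of depth `h`. -/
def Irrelevant (t₀ t₁ : List ℕ) (h i : ℕ) : Prop :=
  ∀ j < t₀.length + t₁.length, SameBlock t₀ t₁ h i j →
    (FromFirst t₀ t₁ j ↔ FromFirst t₀ t₁ i)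

open Classical in
/-- The number of irrelevant blocks at depth `h`, adjacent monochrome blocks being merged into one
irrelevant block. -/
noncomputable def numIrrelevant (t₀ t₁ : List ℕ) (h : ℕ) : ℕ :=
  ((Finset.range (t₀.length + t₁.length)).filter fun i =>
    Irrelevant t₀ t₁ h i ∧ (i = 0 ∨ ¬ Irrelevant t₀ t₁ h (i - 1))).card

/-- The largest number of irrelevant blocks at any depth. All blocks of depth at least `|t₀t₁|` are
singletons, so that greater depths add nothing. -/
noncomputable def maxIrrelevant (t₀ t₁ : List ℕ) : ℕ :=
  (Finset.range (t₀.length + t₁.length + 1)).sup (numIrrelevant t₀ t₁)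

/-! ## The machine: a word RAM with `w`-bit words

It has finitely many registers, read-only input arrays, and read-write arrays. Arithmetic is
two's complement arithmetic on `w`-bit words. The cells of the array `Z` hold one bit, those of
all other arrays hold one word. -/

/-- Read-only input arrays. -/
inductive In
  | bwt0 | bwt1 | lcp0 | lcp1
  deriving DecidableEq

/-- Read-write arrays: the outputs `bwt01` and `lcp01`, and the working arrays. -/
inductive Arr
  | bwt01
  /-- Doubles as the array `B` of block boundaries until the final phase. -/
  | lcp01
  /-- The two bit vectors `Z⁽ʰ⁻¹⁾`, `Z⁽ʰ⁾`, at offsets `cur` and `nxt`. -/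
  | Z
  /-- `C[c]`: number of symbols smaller than `c` in the two input BWTs. -/
  | C
  | F
  | blockId
  /-- Number of occurrences of each symbol in the block at hand. -/
  | occ
  /-- The two lists of irrelevant blocks (the list being read and the one being written). -/
  | irr
  deriving DecidableEq

/-- Registers. -/
inductive Reg
  | n0 | n1 | n | h | cur | nxt | k | k0 | k1 | id | b | c | j | x | z0 | z1
  | act | mono | last | p | q | rd | len | newLen
  deriving DecidableEq

instance : Fintype Reg where
  elems := {.n0, .n1, .n, .h, .cur, .nxt, .k, .k0, .k1, .id, .b, .c, .j, .x, .z0, .z1,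
    .act, .mono, .last, .p, .q, .rd, .len, .newLen}
  complete r := by cases r <;> decide

inductive Expr
  | lit (z : ℤ)
  | reg (r : Reg)
  | add (e f : Expr)
  | sub (e f : Expr)
  | input (a : In) (i : Expr)
  | load (a : Arr) (i : Expr)

inductive Cond
  | eq (e f : Expr)
  | lt (e f : Expr)
  | not (c : Cond)
  | and (c d : Cond)
  | or (c d : Cond)

inductive Cmd
  | assign (r : Reg) (e : Expr)
  | store (a : Arr) (i e : Expr)
  | seq (c d : Cmd)
  | ite (t : Cond) (c d : Cmd)
  | loop (t : Cond) (c : Cmd)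
  | skip

/-- A state: registers, arrays, and, for every array, the number of its cells used so far, that is,
one more than the largest index written. -/
structure State where
  reg : Reg → ℤ
  arr : Arr → ℕ → ℤ
  used : Arr → ℕ

/-- The `w`-bit two's complement word of an integer. -/
def word (w : ℕ) (z : ℤ) : ℤ := Int.bmod z (2 ^ w)

/-- What a cell of array `a` keeps of the value written to it. -/
def cell (w : ℕ) : Arr → ℤ → ℤ
  | .Z, z => z % 2
  | _, z => word w z

/-- Number of bits of a cell. -/
def cellBits (w : ℕ) : Arr → ℕ
  | .Z => 1
  | _ => w

def State.setReg (s : State) (r : Reg) (z : ℤ) : State :=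
  { s with reg := Function.update s.reg r z }

def State.setArr (w : ℕ) (s : State) (a : Arr) (i : ℕ) (z : ℤ) : State :=
  { s with
    arr := Function.update s.arr a (Function.update (s.arr a) i (cell w a z))
    used := Function.update s.used a (max (s.used a) (i + 1)) }

def Expr.eval (w : ℕ) (inp : In → ℕ → ℤ) (s : State) : Expr → ℤ
  | lit z => word w z
  | reg r => s.reg r
  | add e f => word w (e.eval w inp s + f.eval w inp s)
  | sub e f => word w (e.eval w inp s - f.eval w inp s)
  | input a i => inp a (i.eval w inp s).toNat
  | load a i => s.arr a (i.eval w inp s).toNat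

def Cond.Holds (w : ℕ) (inp : In → ℕ → ℤ) (s : State) : Cond → Prop
  | eq e f => e.eval w inp s = f.eval w inp s
  | lt e f => e.eval w inp s < f.eval w inp s
  | not c => ¬ c.Holds w inp s
  | and c d => c.Holds w inp s ∧ d.Holds w inp s
  | or c d => c.Holds w inp s ∨ d.Holds w inp s

/-- Time to evaluate an expression: one step for every constant, register access, arithmetic
operation and memory access. -/
def Expr.cost : Expr → ℕ
  | lit _ => 1
  | reg _ => 1
  | add e f => e.cost + f.cost + 1
  | sub e f => e.cost + f.cost + 1
  | input _ i => i.cost + 1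
  | load _ i => i.cost + 1

def Cond.cost : Cond → ℕ
  | eq e f => e.cost + f.cost + 1
  | lt e f => e.cost + f.cost + 1
  | not c => c.cost + 1
  | and c d => c.cost + d.cost + 1
  | or c d => c.cost + d.cost + 1

/-- `Exec w inp c s s' T`: on the machine with `w`-bit words and input arrays `inp`, the command `c`
started in state `s` halts in state `s'` after `T` steps. -/
inductive Exec (w : ℕ) (inp : In → ℕ → ℤ) : Cmd → State → State → ℕ → Prop
  | assign (r : Reg) (e : Expr) (s : State) :
      Exec w inp (.assign r e) s (s.setReg r (e.eval w inp s)) (e.cost + 1)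
  | store (a : Arr) (i e : Expr) (s : State) :
      Exec w inp (.store a i e) s
        (s.setArr w a (i.eval w inp s).toNat (e.eval w inp s)) (i.cost + e.cost + 1)
  | seq {c d : Cmd} {s s' s'' : State} {T T' : ℕ} :
      Exec w inp c s s' T → Exec w inp d s' s'' T' → Exec w inp (.seq c d) s s'' (T + T')
  | iteTrue {t : Cond} {c d : Cmd} {s s' : State} {T : ℕ} :
      t.Holds w inp s → Exec w inp c s s' T → Exec w inp (.ite t c d) s s' (t.cost + 1 + T)
  | iteFalse {t : Cond} {c d : Cmd} {s s' : State} {T : ℕ} :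
      ¬ t.Holds w inp s → Exec w inp d s s' T → Exec w inp (.ite t c d) s s' (t.cost + 1 + T)
  | loopTrue {t : Cond} {c : Cmd} {s s' s'' : State} {T T' : ℕ} :
      t.Holds w inp s → Exec w inp c s s' T → Exec w inp (.loop t c) s' s'' T' →
      Exec w inp (.loop t c) s s'' (t.cost + 1 + T + T')
  | loopFalse {t : Cond} {c : Cmd} {s : State} :
      ¬ t.Holds w inp s → Exec w inp (.loop t c) s s (t.cost + 1)
  | skip (s : State) : Exec w inp .skip s s 1

/-- The working space in bits, apart from the lists of irrelevant blocks: all registers and all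
arrays that are neither input nor output. Since `used` never decreases, its value in the final
state is the peak value. -/
def workBits (w : ℕ) (s : State) : ℕ :=
  w * Fintype.card Reg +
    ∑ a ∈ ({.Z, .C, .F, .blockId, .occ} : Finset Arr), cellBits w a * s.used a

/-- The space in bits of the lists of irrelevant blocks. -/
def irrBits (w : ℕ) (s : State) : ℕ := cellBits w .irr * s.used .irr

/-- The input arrays for the strings `t₀` and `t₁`. -/
def inputs (t₀ t₁ : List ℕ) : In → ℕ → ℤ
  | .bwt0, i => ((bwt t₀).getD i 0 : ℕ)
  | .bwt1, i => ((bwt t₁).getD i 0 : ℕ)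
  | .lcp0, i => lcpArray t₀ i
  | .lcp1, i => lcpArray t₁ i

/-- The initial state: the lengths of the two input BWTs are in `n0` and `n1`, all else is `0`. -/
def initial (n₀ n₁ : ℕ) : State where
  reg
    | .n0 => n₀
    | .n1 => n₁
    | _ => 0
  arr _ _ := 0
  used _ := 0

/-! ## The Gap algorithm -/

instance : Add Expr := ⟨Expr.add⟩
instance : Sub Expr := ⟨Expr.sub⟩
instance (k : ℕ) : OfNat Expr k := ⟨Expr.lit k⟩

/-- The value of a register. -/
abbrev v (r : Reg) : Expr := Expr.reg r

/-- The value of an array cell. -/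
abbrev get (a : Arr) (i : Expr) : Expr := Expr.load a i

/-- The array `B` of block boundaries, which lives in the space of the output LCP array. -/
abbrev B : Arr := Arr.lcp01

local infixr:30 " ;; " => Cmd.seq
local infix:35 " ::= " => Cmd.assign
local infix:50 " ≐ " => Cond.eq
local infix:50 " ≺ " => Cond.lt

/-- Increment a register. -/
def incr (r : Reg) : Cmd := r ::= v r + 1

/-- Increment an array cell. -/
def incrAt (a : Arr) (i : Expr) : Cmd := .store a i (get a i + 1)

/-- `for r = 0, …, e - 1 do body`. -/
def forUpto (r : Reg) (e : Expr) (body : Cmd) : Cmd :=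
  r ::= 0 ;; .loop (v r ≺ e) (body ;; incr r)

/-- `for every symbol x do body`. -/
def forSymbols (σ : ℕ) (body : Cmd) : Cmd := forUpto .x (.lit (σ + 2)) body

/-- Number of words of the record of an irrelevant block: its first position, the numbers of `0`s
and of `1`s in it, and the number of occurrences of every symbol. -/
def recLen (σ : ℕ) : Expr := .lit (σ + 5)

/-- The address of word `e` of the list `r`, where the register `r` (`p` for the list being read and
`q` for the list being written) is `0` or `1`; the two lists are interleaved. -/
def addr (r : Reg) (e : Expr) : Expr := e + e + v r

/-- Initialization: `Z⁽⁰⁾ = 0ⁿ⁰1ⁿ¹`, `B = 1 0ⁿ⁻¹ 1`, and the array `C`. -/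
def setup (σ : ℕ) : Cmd :=
  .n ::= v .n0 + v .n1 ;;
  .cur ::= 0 ;;
  .nxt ::= v .n ;;
  .p ::= 0 ;;
  .q ::= 1 ;;
  .len ::= 0 ;;
  .h ::= 0 ;;
  .act ::= 1 ;;
  forUpto .k (v .n)
    (.ite (v .k ≺ v .n0) (.store .Z (v .k) 0) (.store .Z (v .k) 1) ;;
     .store B (v .k) 0) ;;
  .store B 0 1 ;;
  .store B (v .n) 1 ;;
  forSymbols σ (.store .occ (v .x) 0) ;;
  forUpto .k (v .n0) (incrAt .occ (.input .bwt0 (v .k))) ;;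
  forUpto .k (v .n1) (incrAt .occ (.input .bwt1 (v .k))) ;;
  .j ::= 0 ;;
  forSymbols σ
    (.store .C (v .x) (v .j) ;;
     .j ::= v .j + get .occ (v .x))

/-- Process position `k` of the active block that starts at position `id`. -/
def processPosition : Cmd :=
  .b ::= get .Z (v .cur + v .k) ;;
  .ite (v .b ≐ 0)
    (.c ::= .input .bwt0 (v .k0) ;; incr .k0 ;; incr .z0)
    (.c ::= .input .bwt1 (v .k1) ;; incr .k1 ;; incr .z1) ;;
  incrAt .occ (v .c) ;;
  .ite (.not (v .c ≺ 2))
    (.j ::= get .F (v .c) ;; incrAt .F (v .c))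
    (.j ::= v .b) ;;
  .store .Z (v .nxt + v .j) (v .b) ;;
  .ite (.not (get .blockId (v .c) ≐ v .id))
    (.store .blockId (v .c) (v .id) ;;
     .ite (get B (v .j) ≐ 0) (.store B (v .j) (v .h)) .skip)
    .skip ;;
  incr .k

/-- Process the active block that starts at position `k`. If it turns out to be monochrome, it
becomes irrelevant, and its content, which is final, is copied to the other bit vector. -/
def processBlock (σ : ℕ) : Cmd :=
  .id ::= v .k ;;
  .z0 ::= 0 ;;
  .z1 ::= 0 ;;
  forSymbols σ (.store .occ (v .x) 0) ;;
  .loop (.and (v .k ≺ v .n)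
      (.or (v .k ≐ v .id) (.or (get B (v .k) ≐ 0) (get B (v .k) ≐ v .h))))
    processPosition ;;
  .ite (.or (v .z0 ≐ 0) (v .z1 ≐ 0))
    (.mono ::= 1 ;;
     .j ::= v .id ;;
     .loop (v .j ≺ v .k)
       (.store .Z (v .nxt + v .j) (get .Z (v .cur + v .j)) ;; incr .j))
    (.mono ::= 0 ;;
     .act ::= 1)

/-- Skip the irrelevant block that starts at position `k`, whose record is at `rd`, updating the
counters `k`, `k0`, `k1` and the array `F`. -/
def skipBlock (σ : ℕ) : Cmd :=
  .id ::= v .k ;;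
  .z0 ::= get .irr (addr .p (v .rd + 1)) ;;
  .z1 ::= get .irr (addr .p (v .rd + 2)) ;;
  forSymbols σ
    (.store .occ (v .x) (get .irr (addr .p (v .rd + 3 + v .x))) ;;
     .store .F (v .x) (get .F (v .x) + get .occ (v .x))) ;;
  .k0 ::= v .k0 + v .z0 ;;
  .k1 ::= v .k1 + v .z1 ;;
  .k ::= v .k + v .z0 + v .z1 ;;
  .rd ::= v .rd + recLen σ ;;
  .mono ::= 1

/-- Add `e` to word `e'` of the list being written. -/
def addToIrr (e' e : Expr) : Cmd :=
  .store .irr (addr .q e') (get .irr (addr .q e') + e)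

/-- Record the irrelevant block just seen. If the preceding block is irrelevant too, the two are
merged. -/
def recordBlock (σ : ℕ) : Cmd :=
  .ite (v .last ≐ 1)
    (addToIrr (v .newLen - recLen σ + 1) (v .z0) ;;
     addToIrr (v .newLen - recLen σ + 2) (v .z1) ;;
     forSymbols σ (addToIrr (v .newLen - recLen σ + 3 + v .x) (get .occ (v .x))))
    (.store .irr (addr .q (v .newLen)) (v .id) ;;
     .store .irr (addr .q (v .newLen + 1)) (v .z0) ;;
     .store .irr (addr .q (v .newLen + 2)) (v .z1) ;;
     forSymbols σ
       (.store .irr (addr .q (v .newLen + 3 + v .x)) (get .occ (v .x))) ;;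
     .newLen ::= v .newLen + recLen σ)

/-- Exchange the contents of two registers. -/
def swap (r r' : Reg) : Cmd := .x ::= v r ;; r ::= v r' ;; r' ::= v .x

/-- Iteration `h`, which computes `Z⁽ʰ⁾` from `Z⁽ʰ⁻¹⁾`. At its end, `act` tells whether an active
block is left. -/
def iteration (σ : ℕ) : Cmd :=
  incr .h ;;
  .act ::= 0 ;;
  .last ::= 0 ;;
  .newLen ::= 0 ;;
  .rd ::= 0 ;;
  .k ::= 0 ;;
  .k0 ::= 0 ;;
  .k1 ::= 0 ;;
  forSymbols σ
    (.store .F (v .x) (get .C (v .x)) ;;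
     .store .blockId (v .x) (.lit (-1))) ;;
  .loop (v .k ≺ v .n)
    (.ite (.and (v .rd ≺ v .len) (get .irr (addr .p (v .rd)) ≐ v .k))
       (skipBlock σ)
       (processBlock σ) ;;
     .ite (v .mono ≐ 1)
       (recordBlock σ ;; .last ::= 1)
       (.last ::= 0)) ;;
  swap .cur .nxt ;;
  swap .p .q ;;
  .len ::= v .newLen

/-- The final phase: merge the BWTs as told by the bit vector, and get the LCP values from `B` at
block boundaries and from the input LCP arrays inside blocks. -/
def finish : Cmd :=
  .k0 ::= 0 ;;
  .k1 ::= 0 ;;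
  forUpto .k (v .n)
    (.ite (get .Z (v .cur + v .k) ≐ 0)
      (.store .bwt01 (v .k) (.input .bwt0 (v .k0)) ;;
       .x ::= .input .lcp0 (v .k0) ;;
       incr .k0)
      (.store .bwt01 (v .k) (.input .bwt1 (v .k1)) ;;
       .x ::= .input .lcp1 (v .k1) ;;
       incr .k1) ;;
     .ite (get B (v .k) ≐ 0)
      (.store .lcp01 (v .k) (v .x))
      (.store .lcp01 (v .k) (get B (v .k) - 1))) ;;
  .store .lcp01 0 (.lit (-1)) ;;
  .store .lcp01 (v .n) (.lit (-1))

/-- The Gap algorithm: iterate until no active block is left. -/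
def gap (σ : ℕ) : Cmd :=
  setup σ ;;
  .loop (v .act ≐ 1) (iteration σ) ;;
  finish

end Gap

/-! Let LF send the rank of a suffix to the rank of the suffix that starts one position earlier,
cyclically within its own string. LF orders its values by symbol and, for equal symbols, by rank; it
keeps every suffix in its string (its colour); and the occurrences of a symbol `c` in a block of
depth `d` are mapped onto a block of depth `d + 1` (`blk_image`). The structure `Merge.Valid`
collects the facts that the analysis needs, and `merged_valid` proves them for two strings.

Bits. The vector of depth `d` is described without the algorithm: `zbit d` sorts the colours inside
each block of depth `d`, zeros first. A scan of a block consumes its symbols of the first BWT and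
then those of the second one. A single symbol need not land at its LF position, but in each image
block the zeros arrive before the ones, so the scan produces the vector of depth `d + 1`
(`scan_step`). In a monochrome block the bits equal the colours and never change again
(`zbit_of_mono`), and LF maps monochrome blocks to monochrome ones (`mono_LF`). Skipping an
irrelevant block therefore leaves unwritten only positions that are irrelevant after the iteration,
and their bits have been copied to both halves of `Z`. When every block is irrelevant, the bit
vector is the sequence of colours.

Boundaries. A boundary with LCP value `d` is marked in iteration `d + 1`, unless its LF preimage was
irrelevant after iteration `d` (`Dyn.B_old`). In that case the boundary lies inside a monochrome
block of depth `d`. Hence a missing mark never hides the end of an active block (`block_test`), and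
in the final phase the two neighbours come from the same string, where they are adjacent too, so
that its LCP array holds the right value (`Outer.col_eq`).

Time. A position that is active after `m + 1` iterations lies in a block of depth `m` with at least
two elements, hence next to an LCP value of at least `m`. Summed over all `m`, there are at most `3n
+ 2S` active positions, where `S` is the sum of the LCP values (`sum_active_le`). Irrelevant runs
are separated by active positions, so they cost no more than those, up to a constant. Finally the
LCP value `0` occurs only at bucket starts, so `n ≤ S + σ + 3` (`n_le`), and the linear terms are
absorbed.

Space. Besides two bit vectors and `O(σ)` words there are two interleaved lists with one record of
`σ + 5` words per irrelevant run. The program logic `Runs` carries capacities of the arrays, so that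
the space bounds come out of the correctness proof. -/

namespace Gap

/-- The data of a merge of two sorted families of suffixes: for every rank `i` the colour `col i`
(`true` for the second string), the symbol `sym i` preceding the suffix and the LCP value `lcp i`;
`bw b` and `lc b` are the BWT and the LCP array of either string. -/
structure Merge where
  n0 : ℕ
  n1 : ℕ
  bw : Bool → ℕ → ℕ
  lc : Bool → ℕ → ℤ
  col : ℕ → Bool
  sym : ℕ → ℕ
  lcp : ℕ → ℤ

namespace Merge

variable (D : Merge)

def n : ℕ := D.n0 + D.n1

/-- Number of ranks below `x` of colour `b`. -/
def K (b : Bool) (x : ℕ) : ℕ := Nat.count (fun i => D.col i = b) x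

/-- Number of ranks below `x` with symbol `c`. -/
def cnt (c x : ℕ) : ℕ := Nat.count (fun i => D.sym i = c) x

/-- Number of ranks below `x` of colour `b` with symbol `c`. -/
def acc (b : Bool) (c x : ℕ) : ℕ := Nat.count (fun i => D.col i = b ∧ D.sym i = c) x

/-- Number of symbols smaller than `c`. -/
def cum (c : ℕ) : ℕ := Nat.count (fun i => D.sym i < c) D.n

/-- Number of symbols smaller than `c` at ranks of colour `b`. -/
def cumCol (b : Bool) (c : ℕ) : ℕ := Nat.count (fun i => D.col i = b ∧ D.sym i < c) D.n

/-- The LF mapping. -/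
def LF (x : ℕ) : ℕ := D.cum (D.sym x) + D.cnt (D.sym x) x

/-- Number of occurrences of `c` among the first `m` symbols of the BWT of colour `b`. -/
def rank (b : Bool) (c m : ℕ) : ℕ := Nat.count (fun i => D.bw b i = c) m

/-- The properties of the data that come from strings with end markers. -/
structure Valid (σ : ℕ) : Prop where
  n0_pos : 0 < D.n0
  n1_pos : 0 < D.n1
  K_false : D.K false D.n = D.n0
  K_true : D.K true D.n = D.n1
  sym_lt : ∀ i < D.n, D.sym i < σ + 2
  bw_K : ∀ i < D.n, D.bw (D.col i) (D.K (D.col i) i) = D.sym i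
  lc_K : ∀ i, i + 1 < D.n → D.col i = D.col (i + 1) →
    D.lc (D.col (i + 1)) (D.K (D.col (i + 1)) (i + 1)) = D.lcp (i + 1)
  marker : ∀ i < D.n, D.sym i < 2 → D.sym i = (D.col i).toNat
  cnt_marker : ∀ c < 2, D.cnt c D.n = 1
  lcp_zero : D.lcp 0 = -1
  lcp_end : D.lcp D.n = -1
  lcp_nonneg : ∀ i, 0 < i → i < D.n → 0 ≤ D.lcp i
  lcp_lt : ∀ i, i ≤ D.n → D.lcp i < D.n
  -- LF preserves colours, in counted form.
  K_LF : ∀ b c x, x ≤ D.n → D.K b (D.cum c + D.cnt c x) = D.cumCol b c + D.acc b c x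
  -- A boundary of depth `h` separates `x` from the preceding occurrence of its symbol. If there is
  -- none, `s = 0` serves, because `lcp 0 = -1`.
  lcp_LF : ∀ x < D.n, ∀ h : ℕ, D.lcp (D.LF x) < (h : ℤ) + 1 ↔
    ∃ s ≤ x, D.lcp s < h ∧ D.cnt (D.sym x) s = D.cnt (D.sym x) x

/-! ### Counting -/

lemma K_mono (b : Bool) : Monotone (D.K b) := Nat.count_monotone _
lemma cnt_mono (c : ℕ) : Monotone (D.cnt c) := Nat.count_monotone _
lemma acc_mono (b : Bool) (c : ℕ) : Monotone (D.acc b c) := Nat.count_monotone _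

@[simp] lemma K_zero (b : Bool) : D.K b 0 = 0 := Nat.count_zero _
@[simp] lemma cnt_zero (c : ℕ) : D.cnt c 0 = 0 := Nat.count_zero _
@[simp] lemma acc_zero (b : Bool) (c : ℕ) : D.acc b c 0 = 0 := Nat.count_zero _
@[simp] lemma rank_zero (b : Bool) (c : ℕ) : D.rank b c 0 = 0 := Nat.count_zero _

lemma K_succ (b : Bool) (x : ℕ) : D.K b (x + 1) = D.K b x + if D.col x = b then 1 else 0 :=
  Nat.count_succ ..
lemma cnt_succ (c x : ℕ) : D.cnt c (x + 1) = D.cnt c x + if D.sym x = c then 1 else 0 :=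
  Nat.count_succ ..
lemma acc_succ (b : Bool) (c x : ℕ) :
    D.acc b c (x + 1) = D.acc b c x + if D.col x = b ∧ D.sym x = c then 1 else 0 :=
  Nat.count_succ ..
lemma rank_succ (b : Bool) (c m : ℕ) :
    D.rank b c (m + 1) = D.rank b c m + if D.bw b m = c then 1 else 0 :=
  Nat.count_succ ..

lemma K_add (x : ℕ) : D.K false x + D.K true x = x := by
  induction x with
  | zero => simp
  | succ x ih => simp only [K_succ]; cases D.col x <;> simp <;> omega

lemma acc_add (c x : ℕ) : D.acc false c x + D.acc true c x = D.cnt c x := by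
  induction x with
  | zero => simp
  | succ x ih =>
    simp only [acc_succ, cnt_succ]
    cases D.col x <;> by_cases h : D.sym x = c <;> simp [h] <;> omega

lemma cumCol_add (c : ℕ) : D.cumCol false c + D.cumCol true c = D.cum c := by
  unfold cumCol cum
  generalize D.n = x
  induction x with
  | zero => simp
  | succ x ih =>
    simp only [Nat.count_succ]
    cases D.col x <;> by_cases h : D.sym x < c <;> simp [h] <;> omega

lemma cum_succ (c : ℕ) : D.cum (c + 1) = D.cum c + D.cnt c D.n := by
  unfold cum cnt
  generalize D.n = x
  induction x with
  | zero => simp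
  | succ x ih =>
    simp only [Nat.count_succ]
    rcases lt_trichotomy (D.sym x) c with h | h | h
    · rw [if_pos (by omega), if_pos h, if_neg (by omega)]; omega
    · rw [if_pos (by omega), if_neg (by omega), if_pos h]; omega
    · rw [if_neg (by omega), if_neg (by omega), if_neg (by omega)]; omega

lemma cum_le (c : ℕ) : D.cum c ≤ D.n := Nat.count_le _

lemma cum_mono : Monotone D.cum := fun _ _ h =>
  Nat.count_mono_left fun _ _ hk => lt_of_lt_of_le hk h

@[simp] lemma cum_zero : D.cum 0 = 0 := by
  simp [cum]

lemma cum_add_cnt_le (c : ℕ) {x : ℕ} (hx : x ≤ D.n) : D.cum c + D.cnt c x ≤ D.n :=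
  (Nat.add_le_add_left (D.cnt_mono c hx) _).trans (D.cum_succ c ▸ D.cum_le _)

lemma cnt_lt {x y : ℕ} (h : x < y) : D.cnt (D.sym x) x < D.cnt (D.sym x) y :=
  Nat.count_strict_mono rfl h

lemma K_lt {x y : ℕ} (h : x < y) : D.K (D.col x) x < D.K (D.col x) y :=
  Nat.count_strict_mono rfl h

lemma acc_lt {x y : ℕ} (h : x < y) : D.acc (D.col x) (D.sym x) x < D.acc (D.col x) (D.sym x) y :=
  Nat.count_strict_mono ⟨rfl, rfl⟩ h

lemma LF_lt_cum {x : ℕ} (hx : x < D.n) : D.LF x < D.cum (D.sym x + 1) := by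
  rw [cum_succ]
  exact Nat.add_lt_add_left (D.cnt_lt hx) _

lemma LF_lt {x : ℕ} (hx : x < D.n) : D.LF x < D.n :=
  lt_of_lt_of_le (D.LF_lt_cum hx) (D.cum_le _)

lemma LF_inj {x y : ℕ} (hx : x < D.n) (hy : y < D.n) (h : D.LF x = D.LF y) : x = y := by
  have aux : ∀ x y, x < D.n → D.sym x < D.sym y → D.LF x < D.LF y := fun x y hx h =>
    (D.LF_lt_cum hx).trans_le ((D.cum_mono h).trans (Nat.le_add_right _ _))
  rcases lt_trichotomy (D.sym x) (D.sym y) with h' | h' | h'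
  · exact absurd h (aux x y hx h').ne
  · unfold LF at h
    rw [h'] at h
    exact Nat.count_injective (p := fun i => D.sym i = D.sym y) h' rfl (Nat.add_left_cancel h)
  · exact absurd h (aux y x hy h').ne'

lemma LF_surj {p : ℕ} (hp : p < D.n) : ∃ x < D.n, D.LF x = p := by
  have := Finset.surj_on_of_inj_on_of_card_le (s := Finset.range D.n) (t := Finset.range D.n)
    (fun x _ => D.LF x) (fun x hx => by simpa using D.LF_lt (by simpa using hx))
    (fun x y hx hy h => D.LF_inj (by simpa using hx) (by simpa using hy) h) le_rfl p (by simpa)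
  obtain ⟨x, hx, h⟩ := this
  exact ⟨x, by simpa using hx, h.symm⟩

/-- Every position of the bucket section `[cum c + cnt c s, cum c + cnt c e)` is the image of a rank
in `[s, e)`. -/
lemma exists_LF_eq {c s e p : ℕ} (he : e ≤ D.n) (h1 : D.cum c + D.cnt c s ≤ p)
    (h2 : p < D.cum c + D.cnt c e) : ∃ x, s ≤ x ∧ x < e ∧ D.sym x = c ∧ D.LF x = p := by
  obtain ⟨x, hx, hp⟩ := D.LF_surj (lt_of_lt_of_le h2 (D.cum_add_cnt_le c he))
  have hc : D.sym x = c := by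
    have h3 := D.LF_lt_cum hx
    rcases lt_trichotomy (D.sym x) c with h | h | h
    · have := D.cum_mono h
      simp only [Nat.succ_eq_add_one] at this; omega
    · exact h
    · have := D.cum_mono h
      have := D.cnt_mono c he
      rw [Nat.succ_eq_add_one, cum_succ] at *
      unfold LF at hp; omega
  subst hc
  unfold LF at hp
  refine ⟨x, ?_, ?_, rfl, hp⟩
  · by_contra hlt
    have := D.cnt_lt (lt_of_not_ge hlt); omega
  · by_contra hlt
    have := D.cnt_mono (D.sym x) (le_of_not_gt hlt); omega

/-- Counts increase by steps of at most one. -/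
lemma exists_K_eq {b : Bool} {s e m : ℕ} (h1 : D.K b s ≤ m) (h2 : m < D.K b e) :
    ∃ x, s ≤ x ∧ x < e ∧ D.col x = b ∧ D.K b x = m := by
  induction e with
  | zero => simp at h2
  | succ e ih =>
    by_cases h : m < D.K b e
    · obtain ⟨x, h3, h4, h5⟩ := ih h
      exact ⟨x, h3, by omega, h5⟩
    · rw [K_succ] at h2
      have hb : D.col e = b := by
        by_contra hb; rw [if_neg hb] at h2; omega
      rw [if_pos hb] at h2
      refine ⟨e, ?_, by omega, hb, by omega⟩
      by_contra hlt
      have := D.K_mono b (show e + 1 ≤ s by omega)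
      rw [K_succ, if_pos hb] at this; omega

/-! ### Blocks -/

/-- `[s, e)` is a block of depth `d`. -/
structure Blk (d s e : ℕ) : Prop where
  lt : s < e
  le : e ≤ D.n
  left : D.lcp s < d
  right : D.lcp e < d
  inner : ∀ m, s < m → m < e → (d : ℤ) ≤ D.lcp m

/-- The ranks `i` and `j` lie in the same block of depth `d`. -/
def Same (d i j : ℕ) : Prop := ∀ m, min i j < m → m ≤ max i j → (d : ℤ) ≤ D.lcp m

/-- The block of depth `d` of rank `i` is monochrome. -/
def Mono (d i : ℕ) : Prop := ∀ j < D.n, D.Same d i j → (D.col j = false ↔ D.col i = false)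

/-- Rank `i` is irrelevant after iteration `m`. -/
def Irr : ℕ → ℕ → Prop
  | 0, _ => False
  -- Iteration `m + 1` scans the vector of depth `m`, so it is blocks of depth `m` that it finds to
  -- be monochrome.
  | m + 1, i => D.Mono m i

/-- The bit at position `p` once the blocks of depth `d` have been formed: every block holds its
`false` bits first. -/
def zbit (d p : ℕ) : Prop :=
  -- Since `s = K false s + K true s`, the zeros of the block, starting at `s`, end at `K false e +
  -- K true s`.
  ∃ s e, D.Blk d s e ∧ s ≤ p ∧ p < e ∧ D.K false e + D.K true s ≤ p

variable {D}

lemma Blk.same {d s e i j : ℕ} (hB : D.Blk d s e) (hi : s ≤ i) (hi' : i < e) (hj : s ≤ j)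
    (hj' : j < e) : D.Same d i j := fun m h1 h2 => hB.inner m (by omega) (by omega)

lemma Blk.of_same {d s e i j : ℕ} (hB : D.Blk d s e) (hi : s ≤ i) (hi' : i < e)
    (hs : D.Same d i j) : s ≤ j ∧ j < e := by
  constructor
  · by_contra h
    have := hs s (by omega) (by omega)
    have := hB.left
    omega
  · by_contra h
    have := hs e (by omega) (by omega)
    have := hB.right
    omega

lemma Blk.unique {d s e s' e' p : ℕ} (hB : D.Blk d s e) (hB' : D.Blk d s' e') (h1 : s ≤ p)
    (h2 : p < e) (h1' : s' ≤ p) (h2' : p < e') : s = s' ∧ e = e' := by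
  have := hB.left; have := hB.right; have := hB'.left; have := hB'.right
  constructor
  · rcases lt_trichotomy s s' with h | h | h
    · have := hB.inner s' h (by omega); omega
    · exact h
    · have := hB'.inner s h (by omega); omega
  · rcases lt_trichotomy e e' with h | h | h
    · have := hB'.inner e (by omega) h; omega
    · exact h
    · have := hB.inner e' (by omega) h; omega

lemma Blk.mono_iff {d s e i : ℕ} (hB : D.Blk d s e) (hi : s ≤ i) (hi' : i < e) :
    D.Mono d i ↔ ∀ j, s ≤ j → j < e → D.col j = D.col i := by
  have aux : ∀ a b : Bool, (a = false ↔ b = false) ↔ a = b := by decide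
  constructor
  · intro h j hj hj'
    exact (aux _ _).1 (h j (by have := hB.le; omega) (hB.same hi hi' hj hj'))
  · intro h j _ hs
    obtain ⟨h1, h2⟩ := hB.of_same hi hi' hs
    exact (aux _ _).2 (h j h1 h2)

lemma K_eq_of_col {b : Bool} {s e : ℕ} (hse : s ≤ e) (h : ∀ j, s ≤ j → j < e → D.col j ≠ b) :
    D.K b e = D.K b s := by
  induction e, hse using Nat.le_induction with
  | base => rfl
  | succ e he ih =>
    rw [K_succ, if_neg (h e he (by omega)), ih (fun j h1 h2 => h j h1 (by omega)), add_zero]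

lemma Blk.mono_iff_K {d s e i : ℕ} (hB : D.Blk d s e) (hi : s ≤ i) (hi' : i < e) :
    D.Mono d i ↔ D.K false e = D.K false s ∨ D.K true e = D.K true s := by
  rw [hB.mono_iff hi hi']
  constructor
  · intro h
    cases hc : D.col i
    · right; exact K_eq_of_col hB.lt.le fun j h1 h2 => by rw [h j h1 h2, hc]; decide
    · left; exact K_eq_of_col hB.lt.le fun j h1 h2 => by rw [h j h1 h2, hc]; decide
  · have key : ∀ b, D.K b e = D.K b s → ∀ j, s ≤ j → j < e → D.col j = !b := by
      intro b hb j h1 h2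
      have : D.col j ≠ b := by
        intro hc; subst hc
        have := D.K_lt h2
        have := D.K_mono (D.col j) h1
        omega
      revert this; cases D.col j <;> cases b <;> simp
    rintro (h | h) j h1 h2 <;> rw [key _ h j h1 h2, key _ h i hi hi']

lemma Blk.zbit_iff {d s e p : ℕ} (hB : D.Blk d s e) (h1 : s ≤ p) (h2 : p < e) :
    D.zbit d p ↔ D.K false e + D.K true s ≤ p := by
  constructor
  · rintro ⟨s', e', hB', h1', h2', h⟩
    obtain ⟨rfl, rfl⟩ := hB.unique hB' h1 h2 h1' h2'
    exact h
  · exact fun h => ⟨s, e, hB, h1, h2, h⟩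

lemma Same.mono {d d' i j : ℕ} (h : D.Same d' i j) (hd : d ≤ d') : D.Same d i j :=
  fun m h1 h2 => le_trans (by exact_mod_cast hd) (h m h1 h2)

lemma Mono.mono {d d' i : ℕ} (h : D.Mono d i) (hd : d ≤ d') : D.Mono d' i :=
  fun j hj hs => h j hj (hs.mono hd)

lemma Irr.mono {m m' i : ℕ} (h : D.Irr m i) (hm : m ≤ m') : D.Irr m' i := by
  cases m with
  | zero => exact h.elim
  | succ m =>
    cases m' with
    | zero => omega
    | succ m' => exact Mono.mono h (by omega)

lemma Same.symm {d i j : ℕ} (h : D.Same d i j) : D.Same d j i :=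
  fun m h1 h2 => h m (by rwa [min_comm]) (by rwa [max_comm])

lemma Same.trans {d i j k : ℕ} (h : D.Same d i j) (h' : D.Same d j k) : D.Same d i k := by
  intro m h1 h2
  by_cases hm : min i j < m ∧ m ≤ max i j
  · exact h m hm.1 hm.2
  · exact h' m (by omega) (by omega)

lemma Mono.of_same {d i j : ℕ} (h : D.Mono d i) (hj : j < D.n) (hs : D.Same d i j) :
    D.Mono d j :=
  fun k hk hs' => (h k hk (hs.trans hs')).trans (h j hj hs).symm

/-- Irrelevance is constant across a position that is not a block boundary. -/
lemma irr_succ_iff {m i : ℕ} (hi : i + 1 < D.n) (h : (m : ℤ) ≤ D.lcp (i + 1)) :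
    D.Irr (m + 1) (i + 1) ↔ D.Irr (m + 1) i := by
  have hs : D.Same m i (i + 1) := fun k h1 h2 => by
    rwa [show k = i + 1 by omega]
  exact ⟨fun h => Mono.of_same h (by omega) hs.symm, fun h => Mono.of_same h hi hs⟩

namespace Valid

variable {σ : ℕ} (V : D.Valid σ)
include V

lemma exists_blk (d : ℕ) {p : ℕ} (hp : p < D.n) : ∃ s e, D.Blk d s e ∧ s ≤ p ∧ p < e := by
  have he : ∃ e, p < e ∧ D.lcp e < d := ⟨D.n, hp, by rw [V.lcp_end]; omega⟩
  have hs : D.lcp 0 < d := by rw [V.lcp_zero]; omega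
  classical
  refine ⟨Nat.findGreatest (fun s => D.lcp s < d) p, Nat.find he, ⟨?_, ?_, ?_, ?_, ?_⟩,
    Nat.findGreatest_le p, (Nat.find_spec he).1⟩
  · exact (Nat.findGreatest_le p).trans_lt (Nat.find_spec he).1
  · exact Nat.find_min' he ⟨hp, by rw [V.lcp_end]; omega⟩
  · exact Nat.findGreatest_spec (P := fun s => D.lcp s < d) (Nat.zero_le p) hs
  · exact (Nat.find_spec he).2
  · intro m h1 h2
    by_contra hlt
    by_cases hm : m ≤ p
    · exact Nat.findGreatest_is_greatest (P := fun s => D.lcp s < d) h1 hm (by omega)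
    · exact Nat.find_min he h2 ⟨by omega, by omega⟩

/-- By `bw_K`, the ranks of colour `b`, taken in order, read the BWT of string `b` from left to
right. -/
lemma rank_K (b : Bool) (c : ℕ) {x : ℕ} (hx : x ≤ D.n) : D.rank b c (D.K b x) = D.acc b c x := by
  induction x with
  | zero => simp
  | succ x ih =>
    rw [K_succ, acc_succ]
    by_cases h : D.col x = b
    · subst h
      rw [if_pos rfl, rank_succ, ih (by omega), V.bw_K x (by omega)]
      simp
    · simp [h, ih (by omega)]

/-- Compare `K_LF` at `x` and at `x + 1`: the right-hand side grows by one, so position `LF x` must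
have the colour of `x`. -/
lemma col_LF {x : ℕ} (hx : x < D.n) : D.col (D.LF x) = D.col x := by
  have h1 := V.K_LF (D.col x) (D.sym x) x hx.le
  have h2 := V.K_LF (D.col x) (D.sym x) (x + 1) hx
  rw [cnt_succ, if_pos rfl, acc_succ, if_pos ⟨rfl, rfl⟩, ← add_assoc, K_succ] at h2
  by_contra h
  rw [show D.cum (D.sym x) + D.cnt (D.sym x) x = D.LF x from rfl] at *
  rw [if_neg h] at h2
  omega

/-- The image of a block of depth `d` under the LF mapping, for one symbol, is a block of depth
`d + 1`. -/
lemma blk_image {d s e c : ℕ} (hB : D.Blk d s e) (h : D.cnt c s < D.cnt c e) :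
    D.Blk (d + 1) (D.cum c + D.cnt c s) (D.cum c + D.cnt c e) := by
  have hle := D.cum_add_cnt_le c hB.le
  refine ⟨by omega, hle, ?_, ?_, ?_⟩
  -- The start of the image comes from the first `c` in the block. No `c` lies between `s` and it,
  -- so `s` witnesses the boundary.
  · obtain ⟨x, h1, h2, rfl, h4⟩ := D.exists_LF_eq hB.le le_rfl (Nat.add_lt_add_left h _)
    rw [← h4]
    push_cast
    exact (V.lcp_LF x (by have := hB.le; omega) d).2 ⟨s, h1, hB.left, by unfold LF at h4; omega⟩
  · rcases hle.eq_or_lt with h' | h'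
    · rw [h', V.lcp_end]; omega
    · obtain ⟨x, hx, hp⟩ := D.LF_surj h'
      rw [← hp]
      push_cast
      refine (V.lcp_LF x hx d).2 ?_
      -- What follows the image is either the image of the next `c` behind the block, with witness
      -- `e`, or the start of the bucket of a larger symbol, with witness `0`.
      by_cases hc : D.sym x = c
      · subst hc
        refine ⟨e, ?_, hB.right, by unfold LF at hp; omega⟩
        by_contra hlt
        have := D.cnt_lt (lt_of_not_ge hlt)
        unfold LF at hp; omega
      · refine ⟨0, Nat.zero_le _, by rw [V.lcp_zero]; omega, ?_⟩
        have h5 := D.LF_lt_cum hx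
        have : c < D.sym x := by
          by_contra hlt
          have := D.cum_mono (show D.sym x + 1 ≤ c by omega)
          omega
        have := D.cum_mono (Nat.succ_le_of_lt this)
        have := D.cnt_mono c hB.le
        rw [Nat.succ_eq_add_one, cum_succ] at *
        unfold LF at hp
        simp only [cnt_zero]; omega
  · intro m h1 h2
    obtain ⟨x, h3, h4, rfl, h5⟩ := D.exists_LF_eq hB.le h1.le h2
    by_contra hlt
    rw [← h5] at hlt
    push_cast at hlt
    -- A witness `t ≤ s` would leave no `c` before `x` in the block, so that `LF x` would not lie
    -- beyond the start of the image; a witness inside the block contradicts `inner`.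
    obtain ⟨t, ht, ht', hc⟩ := (V.lcp_LF x (by have := hB.le; omega) d).1 (by omega)
    by_cases hts : t ≤ s
    · have := D.cnt_mono (D.sym x) hts
      unfold LF at h5; omega
    · have := hB.inner t (by omega) (by omega); omega

lemma K_image {b : Bool} {c x : ℕ} (hx : x ≤ D.n) :
    D.K b (D.cum c + D.cnt c x) = D.cumCol b c + D.acc b c x := V.K_LF b c x hx

/-- The image block consists of images of ranks of the given block, and LF preserves colours. -/
lemma mono_LF {d x : ℕ} (hx : x < D.n) (h : D.Mono d x) : D.Mono (d + 1) (D.LF x) := by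
  obtain ⟨s, e, hB, h1, h2⟩ := V.exists_blk d hx
  have hle := hB.le
  have hs : D.cnt (D.sym x) s ≤ D.cnt (D.sym x) x := D.cnt_mono _ h1
  have he := D.cnt_lt h2
  have hB' := V.blk_image hB (lt_of_le_of_lt hs he)
  rw [hB.mono_iff h1 h2] at h
  rw [hB'.mono_iff (by unfold LF; omega) (by unfold LF; omega)]
  intro j h3 h4
  obtain ⟨y, h5, h6, -, rfl⟩ := D.exists_LF_eq hB.le h3 h4
  rw [V.col_LF (by omega), V.col_LF hx, h y h5 h6]

lemma irr_LF {m x : ℕ} (hx : x < D.n) (h : D.Irr m x) : D.Irr (m + 1) (D.LF x) := by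
  cases m with
  | zero => exact h.elim
  | succ m => exact V.mono_LF hx h

/-- In a monochrome block the border between zeros and ones is one of the two ends of the block, so
sorting the colours changes nothing. -/
lemma zbit_of_mono {d p : ℕ} (hp : p < D.n) (h : D.Mono d p) : D.zbit d p ↔ D.col p = true := by
  obtain ⟨s, e, hB, h1, h2⟩ := V.exists_blk d hp
  rw [hB.zbit_iff h1 h2]
  have h3 := D.K_add s
  have h4 := D.K_add e
  have hm := (hB.mono_iff h1 h2).1 h
  cases hc : D.col p
  · have := K_eq_of_col (b := true) hB.lt.le fun j h1 h2 => by rw [hm j h1 h2, hc]; decide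
    simp only [Bool.false_eq_true, iff_false]
    omega
  · have := K_eq_of_col (b := false) hB.lt.le fun j h1 h2 => by rw [hm j h1 h2, hc]; decide
    simp only [iff_true]
    omega

lemma zbit_congr {d d' p : ℕ} (hp : p < D.n) (h : D.Mono d p) (hd : d ≤ d') :
    D.zbit d' p ↔ D.zbit d p := by
  rw [V.zbit_of_mono hp h, V.zbit_of_mono hp (h.mono hd)]

lemma cum_one : D.cum 1 = 1 := by
  rw [show (1 : ℕ) = 0 + 1 from rfl, cum_succ, cum_zero, V.cnt_marker 0 (by omega)]

lemma n_ge : 2 ≤ D.n := by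
  have := V.n0_pos; have := V.n1_pos; unfold n; omega

end Valid
end Merge
end Gap

/-! ### Scanning a block, irrelevant runs, and the amortised cost -/

namespace Gap
namespace Merge

variable {D : Merge}

/-- While the block `[s, e)` is scanned, `k0` symbols of the first BWT and `k1` symbols of the second
one have been consumed, those of the first one before those of the second one. -/
structure Scan (D : Merge) (s e k0 k1 : ℕ) : Prop where
  left0 : D.K false s ≤ k0
  right0 : k0 ≤ D.K false e
  left1 : D.K true s ≤ k1
  right1 : k1 ≤ D.K true e
  order : k1 = D.K true s ∨ k0 = D.K false e

/-- The next free position for symbol `c` after `k0` and `k1` symbols of the two BWTs. -/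
def free (D : Merge) (c k0 k1 : ℕ) : ℕ := D.cum c + D.rank false c k0 + D.rank true c k1

lemma scan_start {d s e : ℕ} (hB : D.Blk d s e) : D.Scan s e (D.K false s) (D.K true s) :=
  ⟨le_rfl, D.K_mono _ hB.lt.le, le_rfl, D.K_mono _ hB.lt.le, .inl rfl⟩

lemma Scan.end_eq {s e k0 k1 : ℕ} (h : D.Scan s e k0 k1) (he : k0 + k1 = e) :
    k0 = D.K false e ∧ k1 = D.K true e := by
  have := D.K_add e; have := h.right0; have := h.right1; omega

/-- Position `m` starts a maximal run of irrelevant positions. -/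
def RunStart (D : Merge) (m i : ℕ) : Prop := D.Irr m i ∧ (i = 0 ∨ ¬ D.Irr m (i - 1))

open Classical in
/-- Number of irrelevant runs that start below `x`. -/
noncomputable def idx (D : Merge) (m x : ℕ) : ℕ := Nat.count (D.RunStart m) x

open Classical in
/-- Number of positions below `x` that are not irrelevant. -/
noncomputable def active (D : Merge) (m x : ℕ) : ℕ := Nat.count (fun i => ¬ D.Irr m i) x

open Classical in
lemma idx_mono (m : ℕ) : Monotone (D.idx m) := Nat.count_monotone _
open Classical in
lemma active_mono (m : ℕ) : Monotone (D.active m) := Nat.count_monotone _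
open Classical in
@[simp] lemma idx_zero (m : ℕ) : D.idx m 0 = 0 := Nat.count_zero _
open Classical in
@[simp] lemma active_zero (m : ℕ) : D.active m 0 = 0 := Nat.count_zero _

open Classical in
lemma active_le (m x : ℕ) : D.active m x ≤ x := Nat.count_le _

open Classical in
lemma idx_lt {m x y : ℕ} (h : D.RunStart m x) (hxy : x < y) : D.idx m x < D.idx m y :=
  Nat.count_strict_mono h hxy

open Classical in
lemma idx_succ (m x : ℕ) : D.idx m (x + 1) = D.idx m x + if D.RunStart m x then 1 else 0 :=
  Nat.count_succ ..

open Classical in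
lemma active_succ (m x : ℕ) : D.active m (x + 1) = D.active m x + if D.Irr m x then 0 else 1 := by
  unfold active; rw [Nat.count_succ]; by_cases h : D.Irr m x <;> simp [h]

lemma idx_eq {m x y : ℕ} (hxy : x ≤ y) (h : ∀ i, x ≤ i → i < y → ¬ D.RunStart m i) :
    D.idx m y = D.idx m x := by
  induction y, hxy using Nat.le_induction with
  | base => rfl
  | succ y hy ih =>
    rw [idx_succ, if_neg (h y hy (by omega)), ih (fun i h1 h2 => h i h1 (by omega)), add_zero]

/-- A run that ends at `y` contributes one to the number of runs. -/
lemma idx_run {m x y : ℕ} (hx : D.RunStart m x) (hxy : x < y)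
    (h : ∀ i, x ≤ i → i < y → D.Irr m i) : D.idx m y = D.idx m x + 1 := by
  rw [idx_eq (x := x + 1) hxy, idx_succ, if_pos hx]
  rintro i h1 h2 ⟨-, h3 | h3⟩
  · omega
  · exact h3 (h _ (by omega) (by omega))

lemma active_eq {m x y : ℕ} (hxy : x ≤ y) (h : ∀ i, x ≤ i → i < y → D.Irr m i) :
    D.active m y = D.active m x := by
  induction y, hxy using Nat.le_induction with
  | base => rfl
  | succ y hy ih =>
    rw [active_succ, if_pos (h y hy (by omega)), ih (fun i h1 h2 => h i h1 (by omega)), add_zero]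

lemma active_add {m x y : ℕ} (hxy : x ≤ y) (h : ∀ i, x ≤ i → i < y → ¬ D.Irr m i) :
    D.active m y = D.active m x + (y - x) := by
  induction y, hxy using Nat.le_induction with
  | base => simp
  | succ y hy ih =>
    rw [active_succ, if_neg (h y hy (by omega)), ih (fun i h1 h2 => h i h1 (by omega))]; omega

open Classical in
-- Consecutive runs are separated by an active position. The correction term strengthens the
-- induction: after an active position a new run may start without any further active position.
lemma idx_le_active (m x : ℕ) :
    D.idx m x + (if x = 0 ∨ D.Irr m (x - 1) then 0 else 1) ≤ D.active m x + 1 := by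
  induction x with
  | zero => simp
  | succ x ih =>
    rw [idx_succ, active_succ]
    simp only [Nat.succ_ne_zero, false_or, Nat.add_sub_cancel]
    by_cases h : D.Irr m x <;> by_cases h' : x = 0 ∨ D.Irr m (x - 1)
    · simp only [h, h', if_true] at ih ⊢
      by_cases hx : x = 0
      · subst hx; simp; split_ifs <;> omega
      · rw [if_neg]; · omega
        rintro ⟨-, h1 | h1⟩
        · exact hx h1
        · exact h1 (h'.resolve_left hx)
    · simp only [h, h', if_true, if_false] at ih ⊢
      split_ifs <;> omega
    · rw [if_neg (fun h1 => h h1.1)]; simp only [h, h', if_true, if_false] at ih ⊢; omega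
    · rw [if_neg (fun h1 => h h1.1)]; simp only [h, h', if_false] at ih ⊢; omega

/-- Sum of the LCP values. -/
def lcpSum (D : Merge) : ℕ := ∑ i ∈ Finset.Ico 1 D.n, (D.lcp i).toNat

namespace Valid

variable {σ : ℕ} (V : D.Valid σ)
include V

lemma free_K {c x : ℕ} (hx : x ≤ D.n) :
    D.free c (D.K false x) (D.K true x) = D.cum c + D.cnt c x := by
  rw [free, V.rank_K _ _ hx, V.rank_K _ _ hx, add_assoc, D.acc_add]

/-- The witness `x` is the rank whose symbol is read next: zeros in order of rank, then ones in
order of rank. The free position for its symbol may differ from `LF x`, but it lies in the same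
image block and in the part of that block reserved for the colour of `x`. This is why scanning sorts
the image blocks by colour. -/
lemma scan_step {d s e k0 k1 : ℕ} (hB : D.Blk d s e) (hS : D.Scan s e k0 k1)
    (hk : k0 + k1 < e) : ∃ x, s ≤ x ∧ x < e ∧ (D.zbit d (k0 + k1) ↔ D.col x = true) ∧
      D.bw (D.col x) (if D.col x then k1 else k0) = D.sym x ∧
      (D.zbit (d + 1) (D.free (D.sym x) k0 k1) ↔ D.col x = true) ∧
      D.cum (D.sym x) + D.cnt (D.sym x) s ≤ D.free (D.sym x) k0 k1 ∧
      D.free (D.sym x) k0 k1 < D.cum (D.sym x) + D.cnt (D.sym x) e ∧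
      (D.sym x < 2 → D.free (D.sym x) k0 k1 = (D.col x).toNat) ∧
      D.Scan s e (if D.col x then k0 else k0 + 1) (if D.col x then k1 + 1 else k1) := by
  have hle := hB.le
  have hs := D.K_add s
  have he := D.K_add e
  have hse := hB.lt
  obtain ⟨l0, r0, l1, r1, ho⟩ := hS
  have hz : D.zbit d (k0 + k1) ↔ k0 = D.K false e := by
    rw [hB.zbit_iff (by omega) hk]; omega
  have main : ∀ x, s ≤ x → x < e → D.K (D.col x) x = (if D.col x then k1 else k0) →
      (D.col x = false → k1 = D.K true s) → (D.col x = true → k0 = D.K false e) →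
      ((D.zbit (d + 1) (D.free (D.sym x) k0 k1) ↔ D.col x = true) ∧
      D.cum (D.sym x) + D.cnt (D.sym x) s ≤ D.free (D.sym x) k0 k1 ∧
      D.free (D.sym x) k0 k1 < D.cum (D.sym x) + D.cnt (D.sym x) e ∧
      (D.sym x < 2 → D.free (D.sym x) k0 k1 = (D.col x).toNat)) := by
    intro x h1 h2 hx hf ht
    have a0 := D.acc_add (D.sym x) s
    have a1 := D.acc_add (D.sym x) e
    have a2 := D.acc_mono (D.col x) (D.sym x) h1
    have a3 := D.acc_lt h2
    have a4 := D.acc_mono (!D.col x) (D.sym x) hB.lt.le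
    have hB' := V.blk_image (c := D.sym x) hB (by
      cases hc : D.col x <;> simp only [hc, Bool.not_true, Bool.not_false] at * <;> omega)
    have b1 := V.K_image (b := false) (c := D.sym x) hle
    have b2 := V.K_image (b := true) (c := D.sym x) (show s ≤ D.n by omega)
    have b3 := D.cumCol_add (D.sym x)
    -- When a zero is read, no one of the block has been consumed, and when a one is read, all zeros
    -- of the block have been. This fixes the count of the other colour at `s` and at `e`,
    -- respectively.
    have hfree : D.free (D.sym x) k0 k1 = D.cum (D.sym x) +
        if D.col x then D.acc false (D.sym x) e + D.acc true (D.sym x) x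
        else D.acc false (D.sym x) x + D.acc true (D.sym x) s := by
      unfold free
      cases hc : D.col x <;> simp only [hc, if_true, if_false, Bool.false_eq_true] at hx ⊢
      · rw [hf hc, ← hx, V.rank_K _ _ (by omega), V.rank_K _ _ (by omega)]; omega
      · rw [ht hc, ← hx, V.rank_K _ _ (by omega), V.rank_K _ _ (by omega)]; omega
    have hlo : D.cum (D.sym x) + D.cnt (D.sym x) s ≤ D.free (D.sym x) k0 k1 := by
      rw [hfree]
      cases hc : D.col x <;>
        simp only [hc, if_true, if_false, Bool.false_eq_true, Bool.not_true, Bool.not_false] at * <;>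
        omega
    have hhi : D.free (D.sym x) k0 k1 < D.cum (D.sym x) + D.cnt (D.sym x) e := by
      rw [hfree]
      cases hc : D.col x <;>
        simp only [hc, if_true, if_false, Bool.false_eq_true, Bool.not_true, Bool.not_false] at * <;>
        omega
    refine ⟨?_, hlo, hhi, ?_⟩
    · rw [hB'.zbit_iff hlo hhi, b1, b2, hfree]
      cases hc : D.col x <;>
        simp only [hc, if_true, if_false, Bool.false_eq_true, iff_false, iff_true] at * <;> omega
    · intro h
      have h3 := V.marker x (by omega) h
      have h4 := V.cnt_marker _ h
      have h5 := D.cnt_mono (D.sym x) hle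
      -- Each marker occurs once, so the bucket of marker `c` is the single position `c`, which is
      -- also the colour of its rank.
      have h6 : D.cum (D.sym x) = D.sym x := by
        have : D.sym x = 0 ∨ D.sym x = 1 := by omega
        rcases this with h | h <;> rw [h]
        · simp
        · exact V.cum_one
      omega
  rcases ho with ho | ho
  · by_cases h : k0 = D.K false e
    · obtain ⟨x, h1, h2, h3, h4⟩ := D.exists_K_eq (b := true) (s := s) (e := e) (m := k1)
        (by omega) (by omega)
      refine ⟨x, h1, h2, by rw [hz]; simp [h, h3], ?_, ?_⟩
      · rw [h3, if_pos rfl, ← h4, ← h3, V.bw_K x (by omega)]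
      · obtain ⟨m1, m2, m3, m4⟩ := main x h1 h2 (by simp [h3, h4]) (by simp [h3]) (fun _ => h)
        refine ⟨m1, m2, m3, m4, ?_⟩
        simp only [h3, if_true]
        exact ⟨l0, r0, by omega, by omega, .inr h⟩
    · obtain ⟨x, h1, h2, h3, h4⟩ := D.exists_K_eq (b := false) (s := s) (e := e) (m := k0)
        (by omega) (by omega)
      refine ⟨x, h1, h2, by rw [hz]; simp [h, h3], ?_, ?_⟩
      · rw [h3, if_neg (by simp), ← h4, ← h3, V.bw_K x (by omega)]
      · obtain ⟨m1, m2, m3, m4⟩ := main x h1 h2 (by simp [h3, h4]) (fun _ => ho) (by simp [h3])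
        refine ⟨m1, m2, m3, m4, ?_⟩
        simp only [h3, if_false, Bool.false_eq_true]
        exact ⟨by omega, by omega, l1, r1, .inl ho⟩
  · obtain ⟨x, h1, h2, h3, h4⟩ := D.exists_K_eq (b := true) (s := s) (e := e) (m := k1)
      (by omega) (by omega)
    refine ⟨x, h1, h2, by rw [hz]; simp [ho, h3], ?_, ?_⟩
    · rw [h3, if_pos rfl, ← h4, ← h3, V.bw_K x (by omega)]
    · obtain ⟨m1, m2, m3, m4⟩ := main x h1 h2 (by simp [h3, h4]) (by simp [h3]) (fun _ => ho)
      refine ⟨m1, m2, m3, m4, ?_⟩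
      simp only [h3, if_true]
      exact ⟨l0, r0, by omega, by omega, .inr ho⟩

/-- A position outside the monochrome blocks of depth `m` is next to a large LCP value. -/
lemma lcp_ge_of_not_mono {m i : ℕ} (hi : i < D.n) (h : ¬ D.Mono m i) :
    (1 ≤ i ∧ (m : ℤ) ≤ D.lcp i) ∨ (i + 1 < D.n ∧ (m : ℤ) ≤ D.lcp (i + 1)) := by
  obtain ⟨s, e, hB, h1, h2⟩ := V.exists_blk m hi
  have hle := hB.le
  by_cases hs : s < i
  · exact .inl ⟨by omega, hB.inner i hs h2⟩
  · by_cases he : i + 1 < e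
    · exact .inr ⟨by omega, hB.inner _ (by omega) he⟩
    -- What remains is a block with a single element, which is monochrome.
    · refine absurd ((hB.mono_iff h1 h2).2 fun j h3 h4 => ?_) h
      rw [show j = i by omega]

/-- By `lcp_ge_of_not_mono`, a large value at `i` is charged by at most two active positions, namely
`i` and `i - 1`. -/
lemma active_succ_le (m : ℕ) :
    D.active (m + 1) D.n ≤ 2 * ((Finset.Ico 1 D.n).filter fun i => (m : ℤ) ≤ D.lcp i).card := by
  classical
  unfold active
  rw [Nat.count_eq_card_filter_range, two_mul]
  set A := (Finset.Ico 1 D.n).filter fun i => (m : ℤ) ≤ D.lcp i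
  have : (Finset.range D.n).filter (fun i => ¬ D.Irr (m + 1) i) ⊆ A ∪ A.image (· - 1) := by
    intro i hi
    simp only [Finset.mem_filter, Finset.mem_range, A, Finset.mem_union, Finset.mem_Ico,
      Finset.mem_image] at hi ⊢
    rcases V.lcp_ge_of_not_mono hi.1 hi.2 with h | h
    · exact .inl ⟨⟨h.1, hi.1⟩, h.2⟩
    · exact .inr ⟨i + 1, ⟨⟨by omega, h.1⟩, h.2⟩, by omega⟩
  exact (Finset.card_le_card this).trans
    ((Finset.card_union_le _ _).trans (Nat.add_le_add_left Finset.card_image_le _))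

/-- Being next to an LCP value of at least `m`, an active position bounds `m`. This is what bounds
the number of iterations. -/
lemma lt_of_active_pos {m i : ℕ} (hi : i < D.n) (h : ¬ D.Irr (m + 1) i) : m < D.n := by
  rcases V.lcp_ge_of_not_mono hi h with h | h
  · have := V.lcp_lt i hi.le; omega
  · have := V.lcp_lt (i + 1) h.1.le; omega

/-- Double counting: `lcp i` is at least `m` for `lcp i + 1` values of `m`, and each such pair is
charged twice. The remaining `n` is for `m = 0`, when every position is active. -/
lemma sum_active_le (H : ℕ) :
    ∑ m ∈ Finset.range H, D.active m D.n ≤ 3 * D.n + 2 * D.lcpSum := by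
  have key : ∀ H : ℕ, ∑ m ∈ Finset.range H,
      ((Finset.Ico 1 D.n).filter fun i => (m : ℤ) ≤ D.lcp i).card ≤ D.n + D.lcpSum := by
    intro H
    simp only [Finset.card_filter]
    rw [Finset.sum_comm]
    calc _ ≤ ∑ i ∈ Finset.Ico 1 D.n, ((D.lcp i).toNat + 1) := by
          refine Finset.sum_le_sum fun i hi => ?_
          rw [← Finset.card_filter, ← Finset.card_range ((D.lcp i).toNat + 1)]
          refine Finset.card_le_card fun m hm => ?_
          simp only [Finset.mem_filter, Finset.mem_range] at hm ⊢
          omega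
      _ ≤ _ := by
          rw [Finset.sum_add_distrib, lcpSum]
          simp; omega
  cases H with
  | zero => simp
  | succ H =>
    rw [Finset.sum_range_succ']
    have h1 : D.active 0 D.n ≤ D.n := active_le 0 D.n
    have h2 := Finset.sum_le_sum fun m (_ : m ∈ Finset.range H) => V.active_succ_le m
    rw [← Finset.mul_sum] at h2
    have := key H
    omega

/-- Every LCP value strictly inside the array contributes at least one to the sum, except the zeros,
and these sit at starts of the `σ + 2` buckets. -/
lemma n_le : D.n ≤ D.lcpSum + σ + 3 := by
  classical
  have h1 : ((Finset.Ico 1 D.n).filter fun i => D.lcp i = 0) ⊆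
      (Finset.range (σ + 2)).image D.cum := by
    intro p hp
    simp only [Finset.mem_filter, Finset.mem_Ico, Finset.mem_image, Finset.mem_range] at hp ⊢
    obtain ⟨x, hx, rfl⟩ := D.LF_surj hp.1.2
    refine ⟨D.sym x, V.sym_lt x hx, ?_⟩
    -- At depth `0` the witness has a negative LCP value, which leaves only `s = 0`; thus `x` is the
    -- first occurrence of its symbol and `LF x` opens its bucket.
    obtain ⟨s, hs, hs', hc⟩ := (V.lcp_LF x hx 0).1 (by rw [hp.2]; simp)
    have : s = 0 := by
      by_contra h0
      have := V.lcp_nonneg s (by omega) (by omega)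
      simp at hs'; omega
    subst this
    simp only [cnt_zero] at hc
    rw [LF, ← hc, add_zero]
  have h2 := (Finset.card_le_card h1).trans Finset.card_image_le
  rw [Finset.card_range] at h2
  have h3 : (Finset.Ico 1 D.n).card ≤
      ∑ i ∈ Finset.Ico 1 D.n, ((D.lcp i).toNat + if D.lcp i = 0 then 1 else 0) := by
    rw [Finset.card_eq_sum_ones]
    refine Finset.sum_le_sum fun i hi => ?_
    rw [Finset.mem_Ico] at hi
    have := V.lcp_nonneg i (by omega) hi.2
    split_ifs <;> omega
  rw [Finset.sum_add_distrib, ← Finset.card_filter, Nat.card_Ico] at h3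
  unfold lcpSum
  omega

end Valid
end Merge
end Gap

namespace Gap

/-! ### Longest common prefixes and the lexicographic order -/

lemma le_lcpLen_iff (h : ℕ) (a b : List ℕ) :
    h ≤ lcpLen a b ↔ a.take h = b.take h ∧ h ≤ a.length ∧ h ≤ b.length := by
  induction h generalizing a b with
  | zero => simp
  | succ h ih =>
    cases a with
    | nil => simp [lcpLen]
    | cons x a =>
      cases b with
      | nil => simp [lcpLen]
      | cons y b =>
        by_cases hxy : x = y <;> simp [lcpLen, hxy, ih]

lemma lcpLen_le_left (a b : List ℕ) : lcpLen a b ≤ a.length :=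
  ((le_lcpLen_iff _ a b).1 le_rfl).2.1

lemma lcpLen_le_right (a b : List ℕ) : lcpLen a b ≤ b.length :=
  ((le_lcpLen_iff _ a b).1 le_rfl).2.2

lemma le_lcpLen_trans {h : ℕ} {a b c : List ℕ} (h1 : h ≤ lcpLen a b) (h2 : h ≤ lcpLen b c) :
    h ≤ lcpLen a c := by
  rw [le_lcpLen_iff] at *
  exact ⟨h1.1.trans h2.1, h1.2.1, h2.2.2⟩

/-- A common first letter of `a` and `c` forces the same first letter on `b`, which is sorted
between them; remove it and repeat. -/
lemma le_lcpLen_between {h : ℕ} {a b c : List ℕ} (hab : ¬ b < a) (hbc : ¬ c < b)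
    (h1 : h ≤ lcpLen a c) : h ≤ lcpLen a b ∧ h ≤ lcpLen b c := by
  induction h generalizing a b c with
  | zero => simp
  | succ h ih =>
    rcases a with _ | ⟨x, a⟩
    · simp [lcpLen] at h1
    rcases c with _ | ⟨z, c⟩
    · simp [lcpLen] at h1
    rcases b with _ | ⟨y, b⟩
    · simp at hab
    rw [List.cons_lt_cons_iff] at hab hbc
    by_cases hxz : x = z
    · subst hxz
      obtain rfl : y = x := by omega
      simp only [lcpLen, if_true, lt_irrefl, false_or, true_and] at *
      have := ih hab hbc (by omega)
      omega
    · simp [lcpLen, hxz] at h1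

@[simp] lemma text_length {σ : ℕ} (b : Fin 2) (u : List (Fin σ)) :
    (text b u).length = u.length + 1 := by simp [text]

lemma drop_text {σ : ℕ} (b : Fin 2) (u : List (Fin σ)) {p : ℕ} (hp : p ≤ u.length) :
    (text b u).drop p = text b (u.drop p) := by
  simp [text, List.drop_append_of_le_length, hp, ← List.map_drop]

/-- Texts of different lengths differ at the latest at the end marker of the shorter one, as no
letter equals the marker. What is appended is never reached by the comparison. -/
lemma text_append_compare {σ : ℕ} (b : Fin 2) (u u' : List (Fin σ)) (z z' : List ℕ)
    (h : u.length ≠ u'.length) :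
    (text b u ++ z < text b u' ++ z' ↔ text b u < text b u') ∧
      lcpLen (text b u ++ z) (text b u' ++ z') = lcpLen (text b u) (text b u') := by
  induction u generalizing u' with
  | nil =>
    cases u' with
    | nil => simp at h
    | cons y u' =>
      have : b.val ≠ y.val + 2 := by omega
      simp [text, List.cons_lt_cons_iff, lcpLen, this]
  | cons x u ih =>
    cases u' with
    | nil =>
      have : x.val + 2 ≠ b.val := by omega
      simp [text, List.cons_lt_cons_iff, lcpLen, this]
    | cons y u' =>
      obtain ⟨h1, h2⟩ := ih u' (by simpa using h)
      simp only [text, List.append_assoc, List.map_cons, List.cons_append, List.nil_append,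
        List.cons_lt_cons_iff, lcpLen] at h1 h2 ⊢
      simp [h1, h2]

/-! ### Suffix arrays -/

/-- The starting position of the suffix of rank `i`. -/
def sa (t : List ℕ) (i : ℕ) : ℕ := (suffixArray t).getD i 0

lemma suffixArray_perm (t : List ℕ) : (suffixArray t).Perm (List.range t.length) :=
  List.perm_insertionSort _ _

@[simp] lemma suffixArray_length (t : List ℕ) : (suffixArray t).length = t.length := by
  simpa using (suffixArray_perm t).length_eq

lemma suffixArray_nodup (t : List ℕ) : (suffixArray t).Nodup :=
  (suffixArray_perm t).nodup_iff.2 List.nodup_range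

lemma sa_eq {t : List ℕ} {i : ℕ} (hi : i < t.length) :
    sa t i = (suffixArray t)[i]'(by simpa) := by
  simp [sa, hi]

lemma sa_lt {t : List ℕ} {i : ℕ} (hi : i < t.length) : sa t i < t.length := by
  have : sa t i ∈ suffixArray t := by rw [sa_eq hi]; exact List.getElem_mem _
  simpa using (suffixArray_perm t).mem_iff.1 this

lemma sa_inj {t : List ℕ} {i j : ℕ} (hi : i < t.length) (hj : j < t.length)
    (h : sa t i = sa t j) : i = j := by
  rw [sa_eq hi, sa_eq hj] at h
  exact (suffixArray_nodup t).getElem_inj_iff.1 h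

lemma sa_surj {t : List ℕ} {p : ℕ} (hp : p < t.length) : ∃ i < t.length, sa t i = p := by
  have : p ∈ suffixArray t := (suffixArray_perm t).mem_iff.2 (by simpa)
  obtain ⟨i, hi, h⟩ := List.getElem_of_mem this
  rw [suffixArray_length] at hi
  exact ⟨i, hi, by rw [sa_eq hi, h]⟩

lemma drop_inj {t : List ℕ} {p q : ℕ} (hp : p < t.length) (hq : q < t.length)
    (h : t.drop p = t.drop q) : p = q := by
  have := congrArg List.length h
  simp only [List.length_drop] at this; omega

lemma sa_lt_of_lt {t : List ℕ} {i j : ℕ} (hij : i < j) (hj : j < t.length) :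
    t.drop (sa t i) < t.drop (sa t j) := by
  have h : (suffixArray t).Pairwise (fun i j => t.drop i ≤ t.drop j) := by
    have h1 : Std.Total (fun i j => t.drop i ≤ t.drop j) := ⟨fun i j => le_total _ _⟩
    have h2 : IsTrans ℕ (fun i j => t.drop i ≤ t.drop j) := ⟨fun i j k h h' => le_trans h h'⟩
    exact List.pairwise_insertionSort _ _
  have h3 := List.pairwise_iff_getElem.1 h i j (by simp; omega) (by simpa) hij
  rw [← sa_eq (by omega), ← sa_eq hj] at h3
  refine lt_of_le_of_ne h3 fun h4 => ?_
  have := sa_inj (by omega) hj (drop_inj (sa_lt (by omega)) (sa_lt hj) h4)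
  omega

lemma sa_lt_iff {t : List ℕ} {i j : ℕ} (hi : i < t.length) (hj : j < t.length) :
    t.drop (sa t i) < t.drop (sa t j) ↔ i < j := by
  refine ⟨fun h => ?_, fun h => sa_lt_of_lt h hj⟩
  rcases lt_trichotomy i j with h' | rfl | h'
  · exact h'
  · exact absurd h (lt_irrefl _)
  · exact absurd h (lt_asymm (sa_lt_of_lt h' hi))

lemma lcpArray_eq {t : List ℕ} {i : ℕ} (hi : 1 ≤ i) (hi' : i < t.length) :
    lcpArray t i = (lcpLen (t.drop (sa t (i - 1))) (t.drop (sa t i)) : ℤ) := by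
  rw [lcpArray, if_pos ⟨hi, hi'⟩]; rfl

/-- A prefix shared by two ranks is shared by everything sorted between them (`le_lcpLen_between`);
conversely, prefixes shared by neighbours are passed on by transitivity. -/
lemma le_lcpLen_sa {t : List ℕ} {i j : ℕ} (h : ℕ) (hij : i < j) (hj : j < t.length) :
    h ≤ lcpLen (t.drop (sa t i)) (t.drop (sa t j)) ↔
      ∀ m, i < m → m ≤ j → (h : ℤ) ≤ lcpArray t m := by
  induction j, hij using Nat.le_induction with
  | base =>
    have := lcpArray_eq (t := t) (i := i.succ) (by omega) hj
    rw [Nat.succ_sub_one] at this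
    constructor
    · intro h1 m h2 h3
      obtain rfl : m = i.succ := by omega
      rw [this]; exact_mod_cast h1
    · intro h1
      have h2 := h1 i.succ (by omega) le_rfl
      rw [this] at h2; exact_mod_cast h2
  | succ j hj' ih =>
    have ih := ih (by omega)
    have h0 := lcpArray_eq (t := t) (i := j + 1) (by omega) hj
    rw [Nat.add_sub_cancel] at h0
    constructor
    · intro h1 m h2 h3
      have h4 := le_lcpLen_between (b := t.drop (sa t j))
        (lt_asymm (sa_lt_of_lt (by omega) (by omega)))
        (lt_asymm (sa_lt_of_lt (by omega) hj)) h1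
      rcases Nat.lt_or_ge m (j + 1) with h5 | h5
      · exact ih.1 h4.1 m h2 (by omega)
      · obtain rfl : m = j + 1 := by omega
        rw [h0]; exact_mod_cast h4.2
    · intro h1
      refine le_lcpLen_trans (ih.2 fun m h2 h3 => h1 m h2 (by omega)) ?_
      have h2 := h1 (j + 1) (by omega) le_rfl
      rw [h0] at h2; exact_mod_cast h2

open Finset in
/-- The rank of a suffix is the number of smaller suffixes. -/
lemma rank_eq_card {t : List ℕ} {r : ℕ} (hr : r < t.length) :
    r = #{p ∈ range t.length | t.drop p < t.drop (sa t r)} := by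
  conv_lhs => rw [← card_range r]
  refine card_bij (fun i _ => sa t i) ?_ ?_ ?_
  · intro i hi
    simp only [Finset.mem_range, mem_filter] at hi ⊢
    exact ⟨sa_lt (by omega), sa_lt_of_lt hi hr⟩
  · intro i hi j hj h
    simp only [Finset.mem_range] at hi hj
    exact sa_inj (by omega) (by omega) h
  · intro p hp
    simp only [Finset.mem_range, mem_filter] at hp ⊢
    obtain ⟨i, hi, rfl⟩ := sa_surj hp.1
    exact ⟨i, (sa_lt_iff hi hr).1 hp.2, rfl⟩

end Gap

/-! ### The merge of two strings, read off their concatenation -/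

namespace Gap

section Strings

variable {σ : ℕ} (u₀ u₁ : List (Fin σ))

/-- The concatenation of the two strings. -/
abbrev cat : List ℕ := text 0 u₀ ++ text 1 u₁

/-- Either of the two strings. -/
def part : Bool → List ℕ
  | false => text 0 u₀
  | true => text 1 u₁

/-- What follows either of the two strings in the concatenation. -/
def rest : Bool → List ℕ
  | false => text 1 u₁
  | true => []

/-- Positions of either string as positions of the concatenation. -/
def pos : Bool → ℕ → ℕ
  | false, p => p
  | true, p => u₀.length + 1 + p

/-- The cyclic predecessor of a position within its string. -/
def prev (p : ℕ) : ℕ :=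
  if p = 0 then u₀.length
  else if p = u₀.length + 1 then u₀.length + 1 + u₁.length else p - 1

/-- The data of the merge of two strings. -/
def merged : Merge where
  n0 := u₀.length + 1
  n1 := u₁.length + 1
  bw b i := (bwt (part u₀ u₁ b)).getD i 0
  lc b i := lcpArray (part u₀ u₁ b) i
  col i := decide (u₀.length + 1 ≤ sa (cat u₀ u₁) i)
  sym i := (cat u₀ u₁).getD (prev u₀ u₁ (sa (cat u₀ u₁) i)) 0
  lcp i := lcpArray (cat u₀ u₁) i

lemma cat_length : (cat u₀ u₁).length = (merged u₀ u₁).n := by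
  simp [cat, merged, Merge.n]

lemma merged_n : (merged u₀ u₁).n = u₀.length + 1 + (u₁.length + 1) := rfl

variable {u₀ u₁}

lemma pos_lt {b : Bool} {p : ℕ} (hp : p < (part u₀ u₁ b).length) :
    pos u₀ b p < (merged u₀ u₁).n := by
  rw [merged_n]
  cases b <;> simp [part, pos] at * <;> omega

lemma exists_pos {q : ℕ} (hq : q < (merged u₀ u₁).n) :
    ∃ p, p < (part u₀ u₁ (decide (u₀.length + 1 ≤ q))).length ∧
      q = pos u₀ (decide (u₀.length + 1 ≤ q)) p := by
  rw [merged_n] at hq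
  by_cases h : u₀.length + 1 ≤ q
  · exact ⟨q - (u₀.length + 1), by simp [h, part]; omega, by simp [h, pos]⟩
  · exact ⟨q, by simp [h, part]; omega, by simp [h, pos]⟩

lemma decide_pos {b : Bool} {p : ℕ} (hp : p < (part u₀ u₁ b).length) :
    decide (u₀.length + 1 ≤ pos u₀ b p) = b := by
  cases b
  · simpa [part, pos] using hp
  · simp [pos]

lemma drop_pos {b : Bool} {p : ℕ} (hp : p < (part u₀ u₁ b).length) :
    (cat u₀ u₁).drop (pos u₀ b p) = (part u₀ u₁ b).drop p ++ rest u₁ b := by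
  cases b
  · exact List.drop_append_of_le_length hp.le
  · simp [cat, pos, part, rest, List.drop_append]

lemma getD_pos {b : Bool} {p : ℕ} (hp : p < (part u₀ u₁ b).length) :
    (cat u₀ u₁).getD (pos u₀ b p) 0 = (part u₀ u₁ b).getD p 0 := by
  cases b
  · exact List.getD_append _ _ _ _ hp
  · simp only [cat, pos, part] at *
    rw [List.getD_append_right _ _ _ _ (by simp)]
    simp

lemma compare_pos {b : Bool} {p q : ℕ} (hp : p < (part u₀ u₁ b).length)
    (hq : q < (part u₀ u₁ b).length) (hpq : p ≠ q) :
    ((cat u₀ u₁).drop (pos u₀ b p) < (cat u₀ u₁).drop (pos u₀ b q) ↔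
      (part u₀ u₁ b).drop p < (part u₀ u₁ b).drop q) ∧
    lcpLen ((cat u₀ u₁).drop (pos u₀ b p)) ((cat u₀ u₁).drop (pos u₀ b q)) =
      lcpLen ((part u₀ u₁ b).drop p) ((part u₀ u₁ b).drop q) := by
  rw [drop_pos hp, drop_pos hq]
  cases b <;> simp only [part, text_length] at * <;>
    rw [drop_text _ _ (by omega), drop_text _ _ (by omega)] <;>
    exact text_append_compare _ _ _ _ _ (by simp; omega)

lemma prev_pos {b : Bool} {p : ℕ} (hp : p < (part u₀ u₁ b).length) :
    prev u₀ u₁ (pos u₀ b p) =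
      pos u₀ b (if p = 0 then (part u₀ u₁ b).length - 1 else p - 1) := by
  cases b <;> simp only [part, text_length, pos] at * <;> unfold prev <;> by_cases h : p = 0
  · simp [h]
  · rw [if_neg h, if_neg h, if_neg (by omega)]
  · simp [h]
  · rw [if_neg (by omega), if_neg h, if_neg (by omega)]; omega

lemma prev_lt {q : ℕ} (hq : q < (merged u₀ u₁).n) : prev u₀ u₁ q < (merged u₀ u₁).n := by
  rw [merged_n] at *
  unfold prev; split_ifs <;> omega

lemma prev_inj {p q : ℕ} (hp : p < (merged u₀ u₁).n) (hq : q < (merged u₀ u₁).n)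
    (h : prev u₀ u₁ p = prev u₀ u₁ q) : p = q := by
  rw [merged_n] at *
  unfold prev at h; split_ifs at h <;> omega

lemma prev_color (q : ℕ) :
    (u₀.length + 1 ≤ prev u₀ u₁ q) ↔ (u₀.length + 1 ≤ q) := by
  unfold prev; split_ifs <;> omega

lemma prev_surj {q : ℕ} (hq : q < (merged u₀ u₁).n) :
    ∃ p < (merged u₀ u₁).n, prev u₀ u₁ p = q := by
  rw [merged_n] at *
  by_cases h1 : q = u₀.length
  · exact ⟨0, by omega, by simp [prev, h1]⟩
  · by_cases h2 : q = u₀.length + 1 + u₁.length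
    · exact ⟨u₀.length + 1, by omega, by simp [prev, h2]⟩
    · refine ⟨q + 1, by omega, ?_⟩
      rw [prev, if_neg (by omega), if_neg (by omega), Nat.add_sub_cancel]

/-- The ranks in either string are obtained by counting the ranks of its colour. -/
lemma sa_merged {i : ℕ} (hi : i < (merged u₀ u₁).n) :
    (merged u₀ u₁).K ((merged u₀ u₁).col i) i < (part u₀ u₁ ((merged u₀ u₁).col i)).length ∧
    sa (cat u₀ u₁) i = pos u₀ ((merged u₀ u₁).col i)
      (sa (part u₀ u₁ ((merged u₀ u₁).col i)) ((merged u₀ u₁).K ((merged u₀ u₁).col i) i)) := by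
  have hn := cat_length u₀ u₁
  have hi' : i < (cat u₀ u₁).length := by rwa [hn]
  obtain ⟨p, hp, hq⟩ := exists_pos (q := sa (cat u₀ u₁) i) (by rw [← hn]; exact sa_lt hi')
  rw [show decide (u₀.length + 1 ≤ sa (cat u₀ u₁) i) = (merged u₀ u₁).col i from rfl] at hp hq
  set b := (merged u₀ u₁).col i with hb
  obtain ⟨r, hr, hrp⟩ := sa_surj hp
  -- Both sides count the suffixes of the same string that are smaller. By `compare_pos` the order
  -- is the same in the string and in the concatenation.
  have key : r = (merged u₀ u₁).K b i := by
    rw [Merge.K, Nat.count_eq_card_filter_range, rank_eq_card hr, hrp]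
    symm
    refine Finset.card_bij (fun j _ => if b then sa (cat u₀ u₁) j - (u₀.length + 1)
      else sa (cat u₀ u₁) j) ?_ ?_ ?_
    · intro j hj
      simp only [Finset.mem_filter, Finset.mem_range] at hj ⊢
      obtain ⟨p', hp', hq'⟩ := exists_pos (q := sa (cat u₀ u₁) j)
        (by rw [← hn]; exact sa_lt (by omega))
      rw [show decide (u₀.length + 1 ≤ sa (cat u₀ u₁) j) = (merged u₀ u₁).col j from rfl,
        hj.2] at hp' hq'
      have h1 : (if b then sa (cat u₀ u₁) j - (u₀.length + 1) else sa (cat u₀ u₁) j) = p' := by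
        rw [hq']; cases b <;> simp [pos]
      rw [h1]
      have h2 := sa_lt_of_lt hj.1 hi'
      refine ⟨hp', ?_⟩
      rw [hq, hq'] at h2
      refine (compare_pos hp' hp ?_).1.1 h2
      rintro rfl
      exact absurd h2 (lt_irrefl _)
    · intro j hj k hk h
      rw [Finset.mem_filter, Finset.mem_range] at hj hk
      refine sa_inj (t := cat u₀ u₁) (by omega) (by omega) ?_
      have hj' := hj.2
      have hk' := hk.2
      cases hbb : b <;> rw [hbb] at hj' hk' <;> simp [hbb, merged] at h hj' hk' <;> omega
    · intro p' hp'
      simp only [Finset.mem_filter, Finset.mem_range] at hp' ⊢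
      obtain ⟨j, hj, hjp⟩ := sa_surj (t := cat u₀ u₁) (p := pos u₀ b p')
        (by rw [hn]; exact pos_lt hp'.1)
      refine ⟨j, ⟨?_, ?_⟩, ?_⟩
      · rw [← sa_lt_iff hj hi', hjp, hq]
        refine (compare_pos hp'.1 hp ?_).1.2 hp'.2
        rintro rfl
        exact absurd hp'.2 (lt_irrefl _)
      · simp only [merged]
        rw [hjp]; exact decide_pos hp'.1
      · rw [hjp]; cases b <;> simp [pos]
  rw [← key, hrp]
  exact ⟨hr, hq⟩

lemma merged_bw {i : ℕ} (hi : i < (merged u₀ u₁).n) :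
    (merged u₀ u₁).bw ((merged u₀ u₁).col i) ((merged u₀ u₁).K ((merged u₀ u₁).col i) i) =
      (merged u₀ u₁).sym i := by
  obtain ⟨h1, h2⟩ := sa_merged hi
  set b := (merged u₀ u₁).col i
  set r := (merged u₀ u₁).K b i
  have h3 := sa_lt h1
  have h4 : (merged u₀ u₁).sym i = (cat u₀ u₁).getD (prev u₀ u₁ (sa (cat u₀ u₁) i)) 0 := rfl
  rw [h4, h2, prev_pos h3, getD_pos (by split_ifs <;> omega)]
  have h5 : (merged u₀ u₁).bw b r = (bwt (part u₀ u₁ b)).getD r 0 := rfl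
  rw [h5, bwt, List.getD_eq_getElem _ _ (by simpa), List.getElem_map, ← sa_eq h1]
  split_ifs <;> rfl

/-- Neighbouring ranks of one colour are neighbours in the suffix array of their own string, so both
LCP values compare the same two suffixes. -/
lemma merged_lc {i : ℕ} (hi : i + 1 < (merged u₀ u₁).n)
    (hc : (merged u₀ u₁).col i = (merged u₀ u₁).col (i + 1)) :
    (merged u₀ u₁).lc ((merged u₀ u₁).col (i + 1))
      ((merged u₀ u₁).K ((merged u₀ u₁).col (i + 1)) (i + 1)) = (merged u₀ u₁).lcp (i + 1) := by
  have hn := cat_length u₀ u₁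
  obtain ⟨h1, h2⟩ := sa_merged hi
  obtain ⟨h3, h4⟩ := sa_merged (show i < (merged u₀ u₁).n by omega)
  rw [hc] at h3 h4
  have h5 := (merged u₀ u₁).K_succ ((merged u₀ u₁).col (i + 1)) i
  rw [if_pos hc] at h5
  set b := (merged u₀ u₁).col (i + 1)
  set r := (merged u₀ u₁).K b i
  change lcpArray (part u₀ u₁ b) _ = lcpArray (cat u₀ u₁) (i + 1)
  rw [h5] at h1 h2 ⊢
  rw [lcpArray_eq (by omega) h1, lcpArray_eq (by omega) (by omega), Nat.add_sub_cancel,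
    Nat.add_sub_cancel, h2, h4, (compare_pos (sa_lt h3) (sa_lt h1) ?_).2]
  intro h
  have := sa_inj h3 h1 h
  omega

lemma cat_getD_lt {q : ℕ} : (cat u₀ u₁).getD q 0 < σ + 2 := by
  by_cases hq : q < (cat u₀ u₁).length
  · rw [List.getD_eq_getElem _ _ hq]
    have : (cat u₀ u₁)[q] ∈ cat u₀ u₁ := List.getElem_mem _
    generalize (cat u₀ u₁)[q] = y at this ⊢
    simp only [cat, text, List.mem_append, List.mem_map, List.mem_singleton] at this
    rcases this with (⟨x, -, h⟩ | h) | (⟨x, -, h⟩ | h)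
    · have := x.isLt; omega
    · simp [h]
    · have := x.isLt; omega
    · simp [h]
  · rw [List.getD_eq_default _ _ (by omega)]; omega

/-- The first part has the form of an `if` so that the value of the marker can be rewritten in once
the position is known to be the last one. -/
lemma text_getD {b : Fin 2} {u : List (Fin σ)} {q : ℕ} (hq : q < (text b u).length) :
    (text b u).getD q 0 = (if q = u.length then b.val else (text b u).getD q 0) ∧
      (q < u.length → 2 ≤ (text b u).getD q 0) := by
  constructor
  · split_ifs with h
    · subst h; simp [text]
    · rfl
  · intro h
    simp [text, h, List.getElem?_append_left]

/-- The end markers occur only at the ends of their strings. -/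
lemma cat_getD_marker {q : ℕ} (hq : q < (merged u₀ u₁).n) :
    (cat u₀ u₁).getD q 0 < 2 ↔ q = u₀.length ∨ q = u₀.length + 1 + u₁.length := by
  obtain ⟨p, hp, h⟩ := exists_pos hq
  have := getD_pos hp
  rw [← h] at this
  rw [this]
  cases hb : decide (u₀.length + 1 ≤ q) <;> simp only [hb, part, pos] at h hp ⊢ <;>
    obtain ⟨h1, h2⟩ := text_getD hp <;> simp only [text_length] at hp
  · by_cases h3 : p < u₀.length
    · have := h2 h3; omega
    · rw [h1, if_pos (by omega)]; simp; omega
  · by_cases h3 : p < u₁.length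
    · have := h2 h3; omega
    · rw [h1, if_pos (by omega)]; simp; omega

lemma cat_getD_end (b : Bool) :
    (cat u₀ u₁).getD (if b then u₀.length + 1 + u₁.length else u₀.length) 0 = b.toNat := by
  cases b
  · rw [if_neg (by simp), show u₀.length = pos u₀ false u₀.length from rfl,
      getD_pos (by simp [part])]
    simpa [part] using (text_getD (b := 0) (u := u₀) (q := u₀.length) (by simp)).1
  · rw [if_pos rfl, show u₀.length + 1 + u₁.length = pos u₀ true u₁.length from rfl,
      getD_pos (by simp [part])]
    simpa [part] using (text_getD (b := 1) (u := u₁) (q := u₁.length) (by simp)).1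

end Strings
end Gap

/-! ### The LF mapping on the suffixes of the concatenation -/

namespace Gap

section Strings

variable {σ : ℕ} {u₀ u₁ : List (Fin σ)}

/-- The cyclic predecessor wraps around only onto an end marker, so a letter there means that it is
the position just before. -/
lemma drop_prev {q : ℕ} (hq : q < (merged u₀ u₁).n)
    (h : 2 ≤ (cat u₀ u₁).getD (prev u₀ u₁ q) 0) :
    (cat u₀ u₁).drop (prev u₀ u₁ q) =
      (cat u₀ u₁).getD (prev u₀ u₁ q) 0 :: (cat u₀ u₁).drop q := by
  have hp := prev_lt hq
  have h1 : prev u₀ u₁ q + 1 = q := by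
    have h2 := (cat_getD_marker hp).not.1 (by omega)
    push Not at h2
    unfold prev at h2 ⊢
    rw [merged_n] at hq
    by_cases h3 : q = 0
    · simp [h3] at h2
    · by_cases h4 : q = u₀.length + 1
      · simp [h4] at h2
      · rw [if_neg h3, if_neg h4]; omega
  have h5 : prev u₀ u₁ q < (cat u₀ u₁).length := by rwa [cat_length]
  rw [List.drop_eq_getElem_cons h5, h1, List.getD_eq_getElem _ _ h5]

lemma drop_eq_cons {q : ℕ} (hq : q < (merged u₀ u₁).n) :
    (cat u₀ u₁).drop q = (cat u₀ u₁).getD q 0 :: (cat u₀ u₁).drop (q + 1) := by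
  have h5 : q < (cat u₀ u₁).length := by rwa [cat_length]
  rw [List.drop_eq_getElem_cons h5, List.getD_eq_getElem _ _ h5]

lemma marker_inj {q q' : ℕ} (hq : q < (merged u₀ u₁).n) (hq' : q' < (merged u₀ u₁).n)
    (h : (cat u₀ u₁).getD q 0 = (cat u₀ u₁).getD q' 0) (h2 : (cat u₀ u₁).getD q 0 < 2) :
    q = q' := by
  have h3 := (cat_getD_marker hq).1 h2
  have h4 := (cat_getD_marker hq').1 (by omega)
  have h5 := cat_getD_end (u₀ := u₀) (u₁ := u₁) false
  have h6 := cat_getD_end (u₀ := u₀) (u₁ := u₁) true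
  simp only [if_true, if_false, Bool.false_eq_true] at h5 h6
  rcases h3 with h3 | h3 <;> rcases h4 with h4 | h4 <;> first
    | (rw [h3, h4]; done)
    | (rw [h3, h4, h5, h6] at h; simp at h)

/-- Comparing the suffixes that precede two suffixes. -/
lemma prev_lt_iff {i x : ℕ} (hi : i < (merged u₀ u₁).n) (hx : x < (merged u₀ u₁).n) :
    (cat u₀ u₁).drop (prev u₀ u₁ (sa (cat u₀ u₁) i)) <
      (cat u₀ u₁).drop (prev u₀ u₁ (sa (cat u₀ u₁) x)) ↔
    (merged u₀ u₁).sym i < (merged u₀ u₁).sym x ∨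
      ((merged u₀ u₁).sym i = (merged u₀ u₁).sym x ∧ i < x) := by
  have hi' : i < (cat u₀ u₁).length := by rwa [cat_length]
  have hx' : x < (cat u₀ u₁).length := by rwa [cat_length]
  have hsi : sa (cat u₀ u₁) i < (merged u₀ u₁).n := by rw [← cat_length]; exact sa_lt hi'
  have hsx : sa (cat u₀ u₁) x < (merged u₀ u₁).n := by rw [← cat_length]; exact sa_lt hx'
  have e1 : (merged u₀ u₁).sym i = (cat u₀ u₁).getD (prev u₀ u₁ (sa (cat u₀ u₁) i)) 0 := rfl
  have e2 : (merged u₀ u₁).sym x = (cat u₀ u₁).getD (prev u₀ u₁ (sa (cat u₀ u₁) x)) 0 := rfl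
  by_cases hs : (merged u₀ u₁).sym i = (merged u₀ u₁).sym x
  -- Equal markers belong to one and the same suffix. Equal letters can be removed from both
  -- suffixes, which leaves the comparison of the ranks.
  · by_cases h2 : (merged u₀ u₁).sym i < 2
    · have h3 := marker_inj (prev_lt hsi) (prev_lt hsx) hs h2
      have h4 := sa_inj hi' hx' (prev_inj hsi hsx h3)
      subst h4; simp
    · rw [drop_prev hsi (by rw [← e1]; omega), drop_prev hsx (by rw [← e2]; omega), ← e1, ← e2,
        List.cons_lt_cons_iff, sa_lt_iff hi' hx']
  · rw [drop_eq_cons (prev_lt hsi), drop_eq_cons (prev_lt hsx), ← e1, ← e2,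
      List.cons_lt_cons_iff]
    simp [hs]

/-- The LF mapping leads to the preceding suffix. -/
lemma sa_LF {x : ℕ} (hx : x < (merged u₀ u₁).n) :
    sa (cat u₀ u₁) ((merged u₀ u₁).LF x) = prev u₀ u₁ (sa (cat u₀ u₁) x) := by
  have hn := cat_length u₀ u₁
  have hx' : x < (cat u₀ u₁).length := by rwa [hn]
  have hsx : sa (cat u₀ u₁) x < (merged u₀ u₁).n := by rw [← hn]; exact sa_lt hx'
  obtain ⟨r, hr, hrp⟩ := sa_surj (t := cat u₀ u₁) (p := prev u₀ u₁ (sa (cat u₀ u₁) x))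
    (by rw [hn]; exact prev_lt hsx)
  rw [← hrp]
  congr 1
  -- The rank of the predecessor is the number of smaller suffixes. Each suffix is the predecessor
  -- of exactly one other, and `prev_lt_iff` splits the smaller ones into the two counts that define
  -- LF.
  rw [rank_eq_card hr, hrp, Merge.LF, Merge.cum, Merge.cnt, Nat.count_eq_card_filter_range,
    Nat.count_eq_card_filter_range, ← Finset.card_union_of_disjoint]
  · refine Finset.card_bij (fun i _ => prev u₀ u₁ (sa (cat u₀ u₁) i)) ?_ ?_ ?_
    · intro i hi
      have hi1 : i < (merged u₀ u₁).n := by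
        simp only [Finset.mem_union, Finset.mem_filter, Finset.mem_range] at hi; omega
      have hsi : sa (cat u₀ u₁) i < (merged u₀ u₁).n := by
        rw [← hn]; exact sa_lt (by rwa [hn])
      simp only [Finset.mem_union, Finset.mem_filter, Finset.mem_range] at hi ⊢
      refine ⟨by rw [hn]; exact prev_lt hsi, (prev_lt_iff hi1 hx).2 ?_⟩
      tauto
    · intro i hi j hj h
      have aux : ∀ i ∈ (Finset.range (merged u₀ u₁).n).filter
          (fun i => (merged u₀ u₁).sym i < (merged u₀ u₁).sym x) ∪
          (Finset.range x).filter (fun i => (merged u₀ u₁).sym i = (merged u₀ u₁).sym x),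
          i < (cat u₀ u₁).length := by
        intro i hi
        rw [hn]
        simp only [Finset.mem_union, Finset.mem_filter, Finset.mem_range] at hi; omega
      have hi1 := aux i hi
      have hj1 := aux j hj
      exact sa_inj hi1 hj1 (prev_inj (by rw [← hn]; exact sa_lt hi1)
        (by rw [← hn]; exact sa_lt hj1) h)
    · intro p hp
      simp only [Finset.mem_union, Finset.mem_filter, Finset.mem_range] at hp ⊢
      obtain ⟨q, hq, rfl⟩ := prev_surj (by rw [← hn]; exact hp.1)
      obtain ⟨i, hi, rfl⟩ := sa_surj (t := cat u₀ u₁) (p := q) (by rwa [hn])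
      rw [hn] at hi
      refine ⟨i, ?_, rfl⟩
      have := (prev_lt_iff hi hx).1 hp.2
      tauto
  · rw [Finset.disjoint_left]
    intro i hi hi'
    simp only [Finset.mem_filter] at hi hi'
    omega

lemma merged_col_LF {x : ℕ} (hx : x < (merged u₀ u₁).n) :
    (merged u₀ u₁).col ((merged u₀ u₁).LF x) = (merged u₀ u₁).col x := by
  simp only [merged] at *
  rw [decide_eq_decide]
  have := sa_LF hx
  simp only [merged] at this
  rw [this]
  exact prev_color _

/-- LF is a bijection that preserves colours, and the positions on the left are the images of the
ranks with a smaller symbol and of the ranks below `x` with symbol `c`. -/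
lemma merged_K_LF (b : Bool) (c x : ℕ) (hx : x ≤ (merged u₀ u₁).n) :
    (merged u₀ u₁).K b ((merged u₀ u₁).cum c + (merged u₀ u₁).cnt c x) =
      (merged u₀ u₁).cumCol b c + (merged u₀ u₁).acc b c x := by
  have hle := (merged u₀ u₁).cum_add_cnt_le c hx
  have hlt : ∀ i < (merged u₀ u₁).n, (merged u₀ u₁).LF i <
      (merged u₀ u₁).cum c + (merged u₀ u₁).cnt c x ↔
      (merged u₀ u₁).sym i < c ∨ ((merged u₀ u₁).sym i = c ∧ i < x) := by
    intro i hi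
    have h1 := (merged u₀ u₁).LF_lt_cum hi
    rcases lt_trichotomy ((merged u₀ u₁).sym i) c with h | h | h
    · have := (merged u₀ u₁).cum_mono (Nat.succ_le_of_lt h)
      simp only [Nat.succ_eq_add_one] at this
      simp only [h, true_or, iff_true]; omega
    · subst h
      simp only [lt_irrefl, false_or, true_and, Merge.LF, Nat.add_lt_add_iff_left]
      exact ⟨fun h => Nat.lt_of_count_lt_count h, (merged u₀ u₁).cnt_lt⟩
    · have h2 := (merged u₀ u₁).cum_mono (Nat.succ_le_of_lt h)
      have h3 := (merged u₀ u₁).cnt_mono c hx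
      rw [Nat.succ_eq_add_one, Merge.cum_succ] at h2
      have : ¬ (merged u₀ u₁).LF i < (merged u₀ u₁).cum c + (merged u₀ u₁).cnt c x := by
        unfold Merge.LF; omega
      simp only [this, false_iff]; omega
  unfold Merge.K Merge.cumCol Merge.acc
  rw [Nat.count_eq_card_filter_range, Nat.count_eq_card_filter_range,
    Nat.count_eq_card_filter_range, ← Finset.card_union_of_disjoint]
  · symm
    refine Finset.card_bij (fun i _ => (merged u₀ u₁).LF i) ?_ ?_ ?_
    · intro i hi
      have hi1 : i < (merged u₀ u₁).n := by
        simp only [Finset.mem_union, Finset.mem_filter, Finset.mem_range] at hi; omega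
      simp only [Finset.mem_union, Finset.mem_filter, Finset.mem_range] at hi ⊢
      rw [hlt i hi1, merged_col_LF hi1]
      tauto
    · intro i hi j hj h
      refine (merged u₀ u₁).LF_inj ?_ ?_ h
      · simp only [Finset.mem_union, Finset.mem_filter, Finset.mem_range] at hi; omega
      · simp only [Finset.mem_union, Finset.mem_filter, Finset.mem_range] at hj; omega
    · intro p hp
      simp only [Finset.mem_union, Finset.mem_filter, Finset.mem_range] at hp ⊢
      obtain ⟨i, hi, rfl⟩ := (merged u₀ u₁).LF_surj (lt_of_lt_of_le hp.1 hle)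
      rw [hlt i hi, merged_col_LF hi] at hp
      exact ⟨i, by tauto, rfl⟩
  · rw [Finset.disjoint_left]
    intro i hi hi'
    simp only [Finset.mem_filter] at hi hi'
    omega

/-- If `y` is the closest earlier rank with the same symbol, then LF maps `y` right before the image
of `x`, and the LCP value there is one more than that of the suffixes of ranks `y` and `x`, which
`le_lcpLen_sa` expresses by the values between them. If there is no such rank, the image of `x`
opens a bucket and its LCP value is at most `0`. -/
lemma merged_lcp_LF {x : ℕ} (hx : x < (merged u₀ u₁).n) (h : ℕ) :
    (merged u₀ u₁).lcp ((merged u₀ u₁).LF x) < (h : ℤ) + 1 ↔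
      ∃ s ≤ x, (merged u₀ u₁).lcp s < h ∧
        (merged u₀ u₁).cnt ((merged u₀ u₁).sym x) s =
          (merged u₀ u₁).cnt ((merged u₀ u₁).sym x) x := by
  have hn := cat_length u₀ u₁
  have hx' : x < (cat u₀ u₁).length := by rwa [hn]
  set D := merged u₀ u₁ with hD
  have hz : D.lcp 0 = -1 := by simp [hD, merged, lcpArray]
  have hlf := D.LF_lt hx
  have e2 : D.sym x = (cat u₀ u₁).getD (sa (cat u₀ u₁) (D.LF x)) 0 := by rw [sa_LF hx]; rfl
  by_cases h0 : D.cnt (D.sym x) x = 0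
  · have h1 : D.lcp (D.LF x) < (h : ℤ) + 1 := by
      by_cases h2 : D.LF x = 0
      · rw [h2, hz]; omega
      · obtain ⟨y, hy, hy'⟩ := D.LF_surj (p := D.LF x - 1) (by omega)
        have h3 : D.sym y ≠ D.sym x := by
          intro h3
          unfold Merge.LF at *
          rw [h3] at hy'
          omega
        have e1 : D.sym y = (cat u₀ u₁).getD (sa (cat u₀ u₁) (D.LF x - 1)) 0 := by
          rw [← hy', sa_LF hy]; rfl
        have h4 : D.lcp (D.LF x) = 0 := by
          change lcpArray (cat u₀ u₁) _ = 0
          rw [lcpArray_eq (by omega) (by rwa [hn]), drop_eq_cons (q := sa _ (D.LF x - 1)),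
            drop_eq_cons (q := sa _ (D.LF x)), ← e1, ← e2]
          · simp [lcpLen, h3]
          · rw [← hn]; exact sa_lt (by rwa [hn])
          · rw [← hn]; exact sa_lt (by rw [hn]; omega)
        rw [h4]; omega
    simp only [h1, true_iff]
    exact ⟨0, by omega, by rw [hz]; omega, by simp [h0]⟩
  · obtain ⟨y, -, hy, hys, hlf'⟩ := D.exists_LF_eq (c := D.sym x) (s := 0) (e := x)
      (p := D.LF x - 1) hx.le (by simp only [Merge.cnt_zero, Merge.LF]; omega)
      (by simp only [Merge.LF]; omega)
    have hyn : y < D.n := by omega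
    have hcy : D.cnt (D.sym x) y + 1 = D.cnt (D.sym x) x := by
      simp only [Merge.LF, hys] at hlf'; omega
    -- A marker occurs only once, so a repeated symbol is a letter.
    have h2 : 2 ≤ D.sym x := by
      by_contra h2
      have h3 := marker_inj (q := sa (cat u₀ u₁) (D.LF x)) (q' := sa (cat u₀ u₁) (D.LF y))
        (by rw [← hn]; exact sa_lt (by rwa [hn]))
        (by rw [← hn]; exact sa_lt (by rw [hn]; exact D.LF_lt hyn))
        (by rw [← e2, sa_LF hyn, ← hys]; rfl) (by rw [← e2]; omega)
      have := D.LF_inj hx hyn (sa_inj (by rwa [hn]) (by rw [hn]; exact D.LF_lt hyn) h3)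
      omega
    have h4 : D.lcp (D.LF x) = (lcpLen ((cat u₀ u₁).drop (sa (cat u₀ u₁) y))
        ((cat u₀ u₁).drop (sa (cat u₀ u₁) x)) : ℤ) + 1 := by
      change lcpArray (cat u₀ u₁) _ = _
      have e3 : (cat u₀ u₁).getD (prev u₀ u₁ (sa (cat u₀ u₁) x)) 0 = D.sym x := rfl
      have e4 : (cat u₀ u₁).getD (prev u₀ u₁ (sa (cat u₀ u₁) y)) 0 = D.sym x := hys
      have : 0 < D.LF x := by unfold Merge.LF; omega
      rw [lcpArray_eq (by omega) (by rwa [hn]), ← hlf', sa_LF hyn, sa_LF hx,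
        drop_prev _ (by rw [e4]; exact h2), drop_prev _ (by rw [e3]; exact h2), e3, e4]
      · simp [lcpLen]
      · rw [← hD, ← hn]; exact sa_lt hx'
      · rw [← hD, ← hn]; exact sa_lt (by rw [hn]; omega)
    have h5 := (le_lcpLen_sa (t := cat u₀ u₁) h hy hx').not
    have h6 : ∀ s ≤ x, D.cnt (D.sym x) s = D.cnt (D.sym x) x ↔ y < s := by
      intro s hs
      constructor
      · intro h7
        by_contra h8
        have := D.cnt_mono (D.sym x) (le_of_not_gt h8); omega
      · intro h7
        have h8 := D.cnt_mono (D.sym x) hs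
        have h9 := D.cnt_mono (D.sym x) (show y + 1 ≤ s from h7)
        rw [D.cnt_succ, if_pos hys] at h9
        omega
    rw [h4]
    constructor
    · intro h7
      have h8 := h5.1 (by omega)
      push Not at h8
      obtain ⟨m, hm, hm', hm''⟩ := h8
      exact ⟨m, hm', hm'', (h6 m hm').2 hm⟩
    · rintro ⟨s, hs, hs', hs''⟩
      have := h5.2 (fun h8 => absurd (h8 s ((h6 s hs).1 hs'') hs) (by
        rw [not_le]; exact hs'))
      omega

theorem merged_valid (u₀ u₁ : List (Fin σ)) : (merged u₀ u₁).Valid σ := by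
  have hn := cat_length u₀ u₁
  have hKf : (merged u₀ u₁).K false (merged u₀ u₁).n = u₀.length + 1 := by
    rw [Merge.K, Nat.count_eq_card_filter_range, ← Finset.card_range (u₀.length + 1)]
    refine Finset.card_bij (fun i _ => sa (cat u₀ u₁) i) ?_ ?_ ?_
    · intro i hi
      simp only [Finset.mem_filter, Finset.mem_range, merged, decide_eq_false_iff_not] at hi ⊢
      omega
    · intro i hi j hj h
      simp only [Finset.mem_filter, Finset.mem_range] at hi hj
      exact sa_inj (by rw [hn]; exact hi.1) (by rw [hn]; exact hj.1) h
    · intro p hp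
      simp only [Finset.mem_filter, Finset.mem_range] at hp ⊢
      obtain ⟨i, hi, rfl⟩ := sa_surj (t := cat u₀ u₁) (p := p) (by rw [hn, merged_n]; omega)
      exact ⟨i, ⟨by rwa [← hn], by simp [merged]; omega⟩, rfl⟩
  constructor
  · simp [merged]
  · simp [merged]
  · exact hKf
  · have := (merged u₀ u₁).K_add (merged u₀ u₁).n
    rw [hKf] at this
    have h2 := merged_n u₀ u₁
    change _ = u₁.length + 1
    omega
  · exact fun i _ => cat_getD_lt
  · exact fun i hi => merged_bw hi
  · exact fun i hi hc => merged_lc hi hc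
  · intro i hi h
    have hsi : sa (cat u₀ u₁) i < (merged u₀ u₁).n := by rw [← hn]; exact sa_lt (by rwa [hn])
    have h1 := (cat_getD_marker (prev_lt hsi)).1 h
    have h2 := prev_color (u₀ := u₀) (u₁ := u₁) (sa (cat u₀ u₁) i)
    change (cat u₀ u₁).getD (prev u₀ u₁ (sa (cat u₀ u₁) i)) 0 =
      (decide (u₀.length + 1 ≤ sa (cat u₀ u₁) i)).toNat
    have key : ∀ q, q = u₀.length ∨ q = u₀.length + 1 + u₁.length →
        (cat u₀ u₁).getD q 0 = (decide (u₀.length + 1 ≤ q)).toNat := by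
      rintro q (rfl | rfl)
      · simpa using cat_getD_end (u₀ := u₀) (u₁ := u₁) false
      · simpa using cat_getD_end (u₀ := u₀) (u₁ := u₁) true
    have h3 : decide (u₀.length + 1 ≤ sa (cat u₀ u₁) i) =
        decide (u₀.length + 1 ≤ prev u₀ u₁ (sa (cat u₀ u₁) i)) := decide_eq_decide.2 h2.symm
    rw [h3]
    exact key _ h1
  · intro c hc
    obtain ⟨b, hb⟩ : ∃ b : Bool, b.toNat = c := by
      rcases (show c = 0 ∨ c = 1 by omega) with rfl | rfl
      · exact ⟨false, rfl⟩
      · exact ⟨true, rfl⟩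
    have hq : (if b then u₀.length + 1 + u₁.length else u₀.length) < (merged u₀ u₁).n := by
      rw [merged_n]; split_ifs <;> omega
    obtain ⟨p, hp, hpq⟩ := prev_surj hq
    obtain ⟨i, hi, rfl⟩ := sa_surj (t := cat u₀ u₁) (p := p) (by rwa [hn])
    rw [Merge.cnt, Nat.count_eq_card_filter_range, Finset.card_eq_one]
    refine ⟨i, ?_⟩
    ext j
    simp only [Finset.mem_filter, Finset.mem_range, Finset.mem_singleton]
    have hi' : (merged u₀ u₁).sym i = c := by
      change (cat u₀ u₁).getD (prev u₀ u₁ (sa (cat u₀ u₁) i)) 0 = c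
      rw [hpq, cat_getD_end, hb]
    constructor
    · rintro ⟨h1, h2⟩
      have hsj : sa (cat u₀ u₁) j < (merged u₀ u₁).n := by
        rw [← hn]; exact sa_lt (by rwa [hn])
      exact sa_inj (by rwa [hn]) hi (prev_inj hsj hp (marker_inj (prev_lt hsj) (prev_lt hp)
        (h2.trans hi'.symm) (by change (merged u₀ u₁).sym j < 2; omega)))
    · rintro rfl
      exact ⟨by rwa [← hn], hi'⟩
  · simp [merged, lcpArray]
  · change lcpArray (cat u₀ u₁) _ = -1
    rw [lcpArray, if_neg (by rw [hn]; omega)]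
  · intro i h1 h2
    change 0 ≤ lcpArray (cat u₀ u₁) i
    rw [lcpArray_eq h1 (by rwa [hn])]; omega
  · intro i hi
    change lcpArray (cat u₀ u₁) i < _
    by_cases h : 1 ≤ i ∧ i < (cat u₀ u₁).length
    · rw [lcpArray_eq h.1 h.2]
      have h1 := lcpLen_le_left ((cat u₀ u₁).drop (sa (cat u₀ u₁) (i - 1)))
        ((cat u₀ u₁).drop (sa (cat u₀ u₁) i))
      have h2 := lcpLen_le_right ((cat u₀ u₁).drop (sa (cat u₀ u₁) (i - 1)))
        ((cat u₀ u₁).drop (sa (cat u₀ u₁) i))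
      rw [List.length_drop, hn] at h1 h2
      have h3 : sa (cat u₀ u₁) (i - 1) ≠ sa (cat u₀ u₁) i := fun h3 => by
        have := sa_inj (by omega) h.2 h3
        omega
      have := merged_n u₀ u₁
      norm_cast
      omega
    · rw [lcpArray, if_neg h]; omega
  · exact fun b c x hx => merged_K_LF b c x hx
  · exact fun x hx h => merged_lcp_LF hx h

end Strings
end Gap

namespace Gap

/-! ### A program logic

A judgement `Runs X c R A t Q` says that `c`, started with registers `R` and memory `A` at time `t`,
halts with registers, memory and time that satisfy `Q`, and writes only within the capacity of the
arrays. -/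

/-- A machine: word size, input, capacity of the arrays, and a bound for the integers that fit into
a word. -/
structure Machine where
  w : ℕ
  inp : In → ℕ → ℤ
  cap : Arr → ℕ
  bd : ℕ
  -- The value `-1` is needed for the ends of LCP arrays and as the initial value of `blockId`.
  word_eq : ∀ z : ℤ, -1 ≤ z → z ≤ bd → word w z = z

abbrev Regs := Reg → ℤ
abbrev Mem := Arr → ℕ → ℤ

/-- Write a register. -/
def set (R : Regs) (r : Reg) (z : ℤ) : Regs := Function.update R r z

/-- Write a memory cell. -/
def put (A : Mem) (a : Arr) (m : ℕ) (z : ℤ) : Mem :=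
  Function.update A a (Function.update (A a) m z)

lemma set_apply (R : Regs) (r : Reg) (z : ℤ) (r' : Reg) :
    set R r z r' = if r' = r then z else R r' := Function.update_apply ..

lemma put_apply (A : Mem) (a : Arr) (m : ℕ) (z : ℤ) (b : Arr) :
    put A a m z b = if b = a then fun i => if i = m then z else A a i else A b := by
  unfold put
  rw [Function.update_apply]
  split_ifs
  · funext i; rw [Function.update_apply]
  · rfl

variable (X : Machine)

/-- The value of an expression. -/
def val (R : Regs) (A : Mem) (e : Expr) : ℤ := e.eval X.w X.inp ⟨R, A, fun _ => 0⟩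

/-- The truth of a condition. -/
def holds (R : Regs) (A : Mem) (c : Cond) : Prop := c.Holds X.w X.inp ⟨R, A, fun _ => 0⟩

/-- Evaluation ignores `used`, so assertions need to speak of registers and memory only. -/
lemma eval_eq (R : Regs) (A : Mem) (u : Arr → ℕ) (e : Expr) :
    e.eval X.w X.inp ⟨R, A, u⟩ = val X R A e := by
  unfold val
  induction e with
  | lit | reg => rfl
  | add e f h1 h2 | sub e f h1 h2 => simp only [Expr.eval, h1, h2]
  | input a i h | load a i h => simp only [Expr.eval, h]

lemma holds_eq (R : Regs) (A : Mem) (u : Arr → ℕ) (c : Cond) :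
    c.Holds X.w X.inp ⟨R, A, u⟩ ↔ holds X R A c := by
  unfold holds
  induction c with
  | eq e f | lt e f => simp only [Cond.Holds, eval_eq]
  | not c h => simp only [Cond.Holds, h]
  | and c d h1 h2 | or c d h1 h2 => simp only [Cond.Holds, h1, h2]

section Values
variable (R : Regs) (A : Mem)

@[simp] lemma val_lit (z : ℤ) : val X R A (.lit z) = word X.w z := rfl
@[simp] lemma val_ofNat (k : ℕ) : val X R A (ofNat(k) : Expr) = word X.w k := rfl
@[simp] lemma val_reg (r : Reg) : val X R A (.reg r) = R r := rfl
@[simp] lemma val_add (e f : Expr) :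
    val X R A (e + f) = word X.w (val X R A e + val X R A f) := rfl
@[simp] lemma val_sub (e f : Expr) :
    val X R A (e - f) = word X.w (val X R A e - val X R A f) := rfl
@[simp] lemma val_input (a : In) (i : Expr) :
    val X R A (.input a i) = X.inp a (val X R A i).toNat := rfl
@[simp] lemma val_load (a : Arr) (i : Expr) :
    val X R A (.load a i) = A a (val X R A i).toNat := rfl

@[simp] lemma holds_eq_iff (e f : Expr) :
    holds X R A (.eq e f) ↔ val X R A e = val X R A f := Iff.rfl
@[simp] lemma holds_lt_iff (e f : Expr) :
    holds X R A (.lt e f) ↔ val X R A e < val X R A f := Iff.rfl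
@[simp] lemma holds_not_iff (c : Cond) : holds X R A (.not c) ↔ ¬ holds X R A c := Iff.rfl
@[simp] lemma holds_and_iff (c d : Cond) :
    holds X R A (.and c d) ↔ holds X R A c ∧ holds X R A d := Iff.rfl
@[simp] lemma holds_or_iff (c d : Cond) :
    holds X R A (.or c d) ↔ holds X R A c ∨ holds X R A d := Iff.rfl

@[simp] lemma cost_lit (z : ℤ) : (Expr.lit z).cost = 1 := rfl
@[simp] lemma cost_ofNat (k : ℕ) : Expr.cost (ofNat(k) : Expr) = 1 := rfl
@[simp] lemma cost_reg (r : Reg) : (Expr.reg r).cost = 1 := rfl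
@[simp] lemma cost_add (e f : Expr) : (e + f).cost = e.cost + f.cost + 1 := rfl
@[simp] lemma cost_sub (e f : Expr) : (e - f).cost = e.cost + f.cost + 1 := rfl
@[simp] lemma cost_input (a : In) (i : Expr) : (Expr.input a i).cost = i.cost + 1 := rfl
@[simp] lemma cost_load (a : Arr) (i : Expr) : (Expr.load a i).cost = i.cost + 1 := rfl
@[simp] lemma cost_eq (e f : Expr) : (Cond.eq e f).cost = e.cost + f.cost + 1 := rfl
@[simp] lemma cost_lt (e f : Expr) : (Cond.lt e f).cost = e.cost + f.cost + 1 := rfl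
@[simp] lemma cost_not (c : Cond) : (Cond.not c).cost = c.cost + 1 := rfl
@[simp] lemma cost_and (c d : Cond) : (Cond.and c d).cost = c.cost + d.cost + 1 := rfl
@[simp] lemma cost_or (c d : Cond) : (Cond.or c d).cost = c.cost + d.cost + 1 := rfl

end Values

/-- All `u` within the capacities are allowed. Thus commands compose without tracking the cells
used, and the bounds on them survive to the final state. -/
def Runs (c : Cmd) (R : Regs) (A : Mem) (t : ℕ) (Q : Regs → Mem → ℕ → Prop) : Prop :=
  ∀ u : Arr → ℕ, (∀ a, u a ≤ X.cap a) → ∃ R' A' u' T,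
    Exec X.w X.inp c ⟨R, A, u⟩ ⟨R', A', u'⟩ T ∧ (∀ a, u' a ≤ X.cap a) ∧ Q R' A' (t + T)

variable {X} {R : Regs} {A : Mem} {t : ℕ} {Q : Regs → Mem → ℕ → Prop}

lemma Runs.mono {c : Cmd} {P : Regs → Mem → ℕ → Prop} (h : Runs X c R A t P)
    (hPQ : ∀ R' A' t', P R' A' t' → Q R' A' t') : Runs X c R A t Q := fun u hu => by
  obtain ⟨R', A', u', T, h1, h2, h3⟩ := h u hu
  exact ⟨R', A', u', T, h1, h2, hPQ _ _ _ h3⟩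

lemma Runs.skip (h : Q R A (t + 1)) : Runs X .skip R A t Q :=
  fun u hu => ⟨R, A, u, 1, .skip _, hu, h⟩

lemma Runs.assign {r : Reg} {e : Expr} {z : ℤ} (hz : val X R A e = z)
    (h : Q (set R r z) A (t + (e.cost + 1))) : Runs X (.assign r e) R A t Q := fun u hu => by
  refine ⟨_, _, u, _, .assign r e ⟨R, A, u⟩, hu, ?_⟩
  rw [eval_eq, hz]
  exact h

lemma Runs.store {a : Arr} {i e : Expr} {m : ℕ} {z : ℤ} (hi : val X R A i = m)
    (hz : val X R A e = z) (hc : cell X.w a z = z) (hm : m < X.cap a)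
    (h : Q R (put A a m z) (t + (i.cost + e.cost + 1))) :
    Runs X (.store a i e) R A t Q := fun u hu => by
  refine ⟨_, _, _, _, .store a i e ⟨R, A, u⟩, ?_, ?_⟩
  · intro b
    rw [eval_eq, hi, Int.toNat_natCast, Function.update_apply]
    split_ifs with hb
    · subst hb
      exact max_le (hu b) hm
    · exact hu b
  · rw [eval_eq, eval_eq, hi, hz, hc, Int.toNat_natCast]
    exact h

lemma Runs.seq {c d : Cmd} (h : Runs X c R A t fun R' A' t' => Runs X d R' A' t' Q) :
    Runs X (.seq c d) R A t Q := fun u hu => by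
  obtain ⟨R', A', u', T, h1, h2, h3⟩ := h u hu
  obtain ⟨R'', A'', u'', T', h1', h2', h3'⟩ := h3 u' h2
  exact ⟨R'', A'', u'', T + T', .seq h1 h1', h2', by rwa [← add_assoc]⟩

lemma Runs.ite {b : Cond} {c d : Cmd} (h1 : holds X R A b → Runs X c R A (t + (b.cost + 1)) Q)
    (h2 : ¬ holds X R A b → Runs X d R A (t + (b.cost + 1)) Q) :
    Runs X (.ite b c d) R A t Q := fun u hu => by
  by_cases hb : holds X R A b
  · obtain ⟨R', A', u', T, h3, h4, h5⟩ := h1 hb u hu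
    exact ⟨R', A', u', _, .iteTrue ((holds_eq X R A u b).2 hb) h3, h4, by rwa [← add_assoc]⟩
  · obtain ⟨R', A', u', T, h3, h4, h5⟩ := h2 hb u hu
    exact ⟨R', A', u', _, .iteFalse (fun h => hb ((holds_eq X R A u b).1 h)) h3, h4,
      by rwa [← add_assoc]⟩

/-- Loops with an invariant that depends on a decreasing measure. -/
lemma Runs.loop {b : Cond} {c : Cmd} (I : ℕ → Regs → Mem → ℕ → Prop)
    (step : ∀ m R A t, I m R A t →
      (holds X R A b ∧ Runs X c R A (t + (b.cost + 1)) fun R' A' t' => ∃ m' < m, I m' R' A' t') ∨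
      (¬ holds X R A b ∧ Q R A (t + (b.cost + 1))))
    {m : ℕ} (h : I m R A t) : Runs X (.loop b c) R A t Q := by
  induction m using Nat.strong_induction_on generalizing R A t with
  | _ m ih =>
    intro u hu
    rcases step m R A t h with ⟨h1, h2⟩ | ⟨h1, h2⟩
    · obtain ⟨R', A', u', T, h3, h4, m', hm', h5⟩ := h2 u hu
      obtain ⟨R'', A'', u'', T', h3', h4', h5'⟩ := ih m' hm' h5 u' h4
      exact ⟨R'', A'', u'', _, .loopTrue ((holds_eq X R A u b).2 h1) h3 h3', h4',
        by rwa [← add_assoc, ← add_assoc]⟩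
    · exact ⟨R, A, u, _, .loopFalse (fun h => h1 ((holds_eq X R A u b).1 h)), hu, h2⟩

/-- Loops with an invariant indexed by a counter. -/
lemma Runs.loop_range {b : Cond} {c : Cmd} (I : ℕ → Regs → Mem → ℕ → Prop) {i N : ℕ}
    (hi : i ≤ N)
    (step : ∀ j R A t, i ≤ j → j < N → I j R A t →
      holds X R A b ∧ Runs X c R A (t + (b.cost + 1)) (I (j + 1)))
    (exit : ∀ R A t, I N R A t → ¬ holds X R A b ∧ Q R A (t + (b.cost + 1)))
    (h : I i R A t) : Runs X (.loop b c) R A t Q := by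
  refine Runs.loop (fun m R A t => ∃ j, i ≤ j ∧ j ≤ N ∧ m = N - j ∧ I j R A t) ?_
    ⟨i, le_rfl, hi, rfl, h⟩
  rintro m R A t ⟨j, hij, hj, rfl, hI⟩
  rcases hj.lt_or_eq with h1 | rfl
  · obtain ⟨h2, h3⟩ := step j R A t hij h1 hI
    exact .inl ⟨h2, h3.mono fun R' A' t' h' => ⟨N - (j + 1), by omega, j + 1, by omega, h1, rfl, h'⟩⟩
  · exact .inr (exit R A t hI)

/-- `for` loops. The body may change the time, the registers other than the counter, and the
memory. -/
lemma Runs.forUpto {r : Reg} {e : Expr} {body : Cmd} {N : ℕ} (I : ℕ → Regs → Mem → ℕ → Prop)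
    (hN : N ≤ X.bd)
    (he : ∀ i R A t, i ≤ N → I i R A t → val X R A e = N)
    (init : I 0 (set R r 0) A (t + 2))
    (hr : ∀ i R A t, i ≤ N → I i R A t → R r = i)
    (step : ∀ i R A t, i < N → I i R A t → R r = i → Runs X body R A (t + (e.cost + 3))
      fun R' A' t' => R' r = i ∧ I (i + 1) (set R' r ((i : ℤ) + 1)) A' (t' + 4))
    (exit : ∀ R A t, I N R A t → R r = N → Q R A (t + (e.cost + 3))) :
    Runs X (forUpto r e body) R A t Q := by
  refine .seq (.assign (z := 0) (X.word_eq 0 (by omega) (by omega)) ?_)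
  -- One step each for the counter, the comparison and the branching; the four steps after the body
  -- are the increment.
  have hcost : (Cond.lt (.reg r) e).cost + 1 = e.cost + 3 := by simp; omega
  refine .loop_range (I := I) (Nat.zero_le N) ?_ ?_ init
  · intro j R A t _ hj hI
    have h1 := hr j R A t hj.le hI
    refine ⟨?_, ?_⟩
    · rw [holds_lt_iff, val_reg, he j R A t hj.le hI, h1]; exact_mod_cast hj
    · rw [hcost]
      refine .seq ((step j R A _ hj hI h1).mono ?_)
      rintro R' A' t' ⟨h2, h3⟩
      refine .assign (z := (j : ℤ) + 1) ?_ h3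
      simp (disch := omega) only [val_add, val_reg, h2, val_ofNat, X.word_eq, Nat.cast_one]
  · intro R A t hI
    have h1 := hr N R A t le_rfl hI
    refine ⟨by rw [holds_lt_iff, val_reg, he N R A t le_rfl hI, h1]; exact lt_irrefl _, ?_⟩
    rw [hcost]
    exact exit R A t hI h1

end Gap

/-! ### Invariants of an iteration, and the processing of one position -/

namespace Gap

open Merge

/-- The machine `X` is large enough for the Gap algorithm on the merge `D` and has its input. -/
structure Machine.Fits (X : Machine) (D : Merge) (σ : ℕ) : Prop where
  bwt0 : ∀ i, X.inp .bwt0 i = D.bw false i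
  bwt1 : ∀ i, X.inp .bwt1 i = D.bw true i
  lcp0 : ∀ i, X.inp .lcp0 i = D.lc false i
  lcp1 : ∀ i, X.inp .lcp1 i = D.lc true i
  -- Addresses in the two interleaved lists dominate; the other terms leave room for addresses in
  -- `Z` and for small constants.
  bd : 2 * ((σ + 5) * D.n) + 2 * D.n + 2 * σ + 20 ≤ X.bd
  capZ : X.cap .Z = 2 * D.n
  capC : X.cap .C = σ + 2
  capF : X.cap .F = σ + 2
  capBlockId : X.cap .blockId = σ + 2
  capOcc : X.cap .occ = σ + 2
  capBwt : X.cap .bwt01 = D.n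
  capLcp : X.cap .lcp01 = D.n + 1
  capIrr : ∀ m ≤ D.n, 2 * ((σ + 5) * D.idx (m + 1) D.n) ≤ X.cap .irr

section Rules

variable {X : Machine} {R : Regs} {A : Mem} {t : ℕ} {Q : Regs → Mem → ℕ → Prop}

lemma val_add_nat {e f : Expr} {a b : ℕ} (he : val X R A e = a) (hf : val X R A f = b)
    (h : a + b ≤ X.bd) : val X R A (e + f) = ((a + b : ℕ) : ℤ) := by
  rw [val_add, he, hf, X.word_eq _ (by omega) (by omega), Nat.cast_add]

lemma val_sub_nat {e f : Expr} {a b : ℕ} (he : val X R A e = a) (hf : val X R A f = b)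
    (hba : b ≤ a) (h : a ≤ X.bd) : val X R A (e - f) = ((a - b : ℕ) : ℤ) := by
  rw [val_sub, he, hf, X.word_eq _ (by omega) (by omega), Nat.cast_sub hba]

lemma val_load_nat {a : Arr} {i : Expr} {m : ℕ} (h : val X R A i = m) :
    val X R A (.load a i) = A a m := by rw [val_load, h, Int.toNat_natCast]

lemma val_input_nat {a : In} {i : Expr} {m : ℕ} (h : val X R A i = m) :
    val X R A (.input a i) = X.inp a m := by rw [val_input, h, Int.toNat_natCast]

lemma val_zero (h : 20 ≤ X.bd) : val X R A 0 = 0 := X.word_eq 0 (by omega) (by omega)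

lemma val_one (h : 20 ≤ X.bd) : val X R A 1 = ((1 : ℕ) : ℤ) :=
  X.word_eq 1 (by omega) (by omega)

lemma val_two (h : 20 ≤ X.bd) : val X R A 2 = ((2 : ℕ) : ℤ) :=
  X.word_eq 2 (by omega) (by omega)

lemma val_three (h : 20 ≤ X.bd) : val X R A 3 = ((3 : ℕ) : ℤ) :=
  X.word_eq 3 (by omega) (by omega)

lemma val_lit_eq {k : ℤ} (h : -1 ≤ k) (h' : k ≤ X.bd) : val X R A (.lit k) = k := by
  rw [val_lit, X.word_eq _ h h']

lemma set_set (R : Regs) (r : Reg) (z z' : ℤ) : set (set R r z) r z' = set R r z' := by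
  funext r'; simp only [set_apply]; split_ifs <;> rfl

/-- Filling cells of an array in a loop over the symbols. -/
lemma Runs.fill {σ : ℕ} {a : Arr} {i e : Expr} (f : ℕ → ℕ) (g : ℕ → ℤ) (hσ : σ + 3 ≤ X.bd)
    (hf : ∀ x y, f x = f y → x = y)
    -- The expressions may read cells of `a` that are still unwritten, as happens when two records
    -- are merged.
    (hval : ∀ x < σ + 2, ∀ A' : Mem, (∀ b, b ≠ a → A' b = A b) →
      (∀ j, (∀ y < x, f y ≠ j) → A' a j = A a j) →
      val X (set R .x x) A' i = f x ∧ val X (set R .x x) A' e = g x)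
    (hcell : ∀ x < σ + 2, cell X.w a (g x) = g x) (hcap : ∀ x < σ + 2, f x < X.cap a)
    (post : ∀ A' : Mem, ∀ t', (∀ b, b ≠ a → A' b = A b) → (∀ x < σ + 2, A' a (f x) = g x) →
      (∀ j, (∀ y < σ + 2, f y ≠ j) → A' a j = A a j) →
      t' ≤ t + 6 + (σ + 2) * (i.cost + e.cost + 9) → Q (set R .x ((σ + 2 : ℕ) : ℤ)) A' t') :
    Runs X (forSymbols σ (.store a i e)) R A t Q := by
  refine Runs.forUpto (N := σ + 2) (fun x R' A' t' => R' = set R .x (x : ℤ) ∧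
    (∀ b, b ≠ a → A' b = A b) ∧ (∀ y < x, A' a (f y) = g y) ∧
    (∀ j, (∀ y < x, f y ≠ j) → A' a j = A a j) ∧ t' ≤ t + 2 + x * (i.cost + e.cost + 9))
    (by omega) ?_ ?_ ?_ ?_ ?_
  · intro x R' A' t' _ _
    rw [val_lit_eq (by omega) (by omega)]; push_cast; rfl
  · exact ⟨by simp, fun _ _ => rfl, by simp, fun _ _ => rfl, by omega⟩
  · rintro x R' A' t' _ ⟨rfl, -⟩
    simp [set_apply]
  · rintro x R' A' t' hx ⟨rfl, h1, h2, h3, h4⟩ -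
    obtain ⟨v1, v2⟩ := hval x hx A' h1 h3
    refine .store v1 v2 (hcell x hx) (hcap x hx) ⟨by simp [set_apply], ?_, ?_, ?_, ?_, ?_⟩
    · rw [set_set]; push_cast; rfl
    · intro b hb
      rw [put_apply, if_neg hb, h1 b hb]
    · intro y hy
      rw [put_apply, if_pos rfl]
      by_cases hyx : y = x
      · subst hyx; simp
      · have hne : f y ≠ f x := fun h => hyx (hf y x h)
        simp only [hne, if_false]
        exact h2 y (by omega)
    · intro j hj
      rw [put_apply, if_pos rfl]
      have hne : j ≠ f x := fun h => hj x (by omega) h.symm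
      simp only [hne, if_false]
      exact h3 j fun y hy => hj y (by omega)
    · simp only [cost_lit]
      have : (x + 1) * (i.cost + e.cost + 9) = x * (i.cost + e.cost + 9) + (i.cost + e.cost + 9) :=
        by ring
      omega
  · rintro R' A' t' ⟨rfl, h1, h2, h3, h4⟩ -
    refine post A' _ h1 h2 h3 ?_
    simp only [cost_lit]; omega

end Rules

/-- The bit that belongs to position `p` in the bit vector of depth `d`. -/
noncomputable def Merge.bit (D : Merge) (d p : ℕ) : ℤ := by
  classical exact if D.zbit d p then 1 else 0

lemma Merge.bit_cases (D : Merge) (d p : ℕ) : D.bit d p = 0 ∨ D.bit d p = 1 := by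
  unfold Merge.bit; split_ifs <;> simp

lemma Merge.bit_eq {D : Merge} {d p : ℕ} {b : Bool} (h : D.zbit d p ↔ b = true) :
    D.bit d p = (b.toNat : ℤ) := by
  unfold Merge.bit
  cases b <;> simp_all

lemma cell_bit (D : Merge) (w d p : ℕ) : cell w .Z (D.bit d p) = D.bit d p := by
  rcases D.bit_cases d p with h | h <;> rw [h] <;> rfl

/-- A maximal run `[s, e)` of irrelevant positions below `k`. -/
structure Merge.RunTo (D : Merge) (m k s e : ℕ) : Prop where
  start : D.RunStart m s
  lt : s < e
  le : e ≤ k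
  irr : ∀ i, s ≤ i → i < e → D.Irr m i
  maximal : e = k ∨ ¬ D.Irr m e

/-- The list with parity `p` holds the records of the irrelevant runs below `k`. -/
def Records (D : Merge) (σ m k p : ℕ) (M : ℕ → ℤ) : Prop :=
  ∀ s e, D.RunTo m k s e →
    M (2 * ((σ + 5) * D.idx m s) + p) = s ∧
    M (2 * ((σ + 5) * D.idx m s + 1) + p) = ((D.K false e - D.K false s : ℕ) : ℤ) ∧
    M (2 * ((σ + 5) * D.idx m s + 2) + p) = ((D.K true e - D.K true s : ℕ) : ℤ) ∧
    ∀ x < σ + 2, M (2 * ((σ + 5) * D.idx m s + 3 + x) + p) = ((D.cnt x e - D.cnt x s : ℕ) : ℤ)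

/-- Parameters of an iteration: its index, and the values of the registers `cur`, `nxt`, `p`, `q`. -/
structure Iter where
  m : ℕ
  cu : ℕ
  nx : ℕ
  p : ℕ
  q : ℕ

/-- The registers that do not change while iteration `m + 1` runs. -/
structure FixR (D : Merge) (σ : ℕ) (I : Iter) (R : Regs) : Prop where
  n0 : R .n0 = (D.n0 : ℤ)
  n1 : R .n1 = (D.n1 : ℤ)
  n : R .n = (D.n : ℤ)
  h : R .h = ((I.m + 1 : ℕ) : ℤ)
  cur : R .cur = (I.cu : ℤ)
  nxt : R .nxt = (I.nx : ℤ)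
  p : R .p = (I.p : ℤ)
  q : R .q = (I.q : ℤ)
  len : R .len = (((σ + 5) * D.idx I.m D.n : ℕ) : ℤ)

def fixedRegs : List Reg := [.n0, .n1, .n, .h, .cur, .nxt, .p, .q, .len]

lemma FixR.congr {D : Merge} {σ : ℕ} {I : Iter} {R R' : Regs} (H : FixR D σ I R)
    (h : ∀ r ∈ fixedRegs, R' r = R r) : FixR D σ I R' := by
  constructor
  · rw [h _ (by decide), H.n0]
  · rw [h _ (by decide), H.n1]
  · rw [h _ (by decide), H.n]
  · rw [h _ (by decide), H.h]
  · rw [h _ (by decide), H.cur]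
  · rw [h _ (by decide), H.nxt]
  · rw [h _ (by decide), H.p]
  · rw [h _ (by decide), H.q]
  · rw [h _ (by decide), H.len]

lemma FixR.set {D : Merge} {σ : ℕ} {I : Iter} {R : Regs} (H : FixR D σ I R) {r : Reg} {z : ℤ}
    (hr : r ∉ fixedRegs) : FixR D σ I (set R r z) :=
  H.congr fun r' hr' => by
    rw [set_apply, if_neg]
    rintro rfl
    exact hr hr'

/-- The memory that does not change while iteration `m + 1` runs. -/
structure FixA (D : Merge) (σ : ℕ) (I : Iter) (A : Mem) : Prop where
  halves : (I.cu = 0 ∧ I.nx = D.n) ∨ (I.cu = D.n ∧ I.nx = 0)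
  lists : (I.p = 0 ∧ I.q = 1) ∨ (I.p = 1 ∧ I.q = 0)
  C : ∀ c < σ + 2, A .C c = D.cum c
  Z : ∀ p < D.n, A .Z (I.cu + p) = D.bit I.m p
  recs : Records D σ I.m D.n I.p (A .irr)

/-- The memory during iteration `m + 1`, after `k0` and `k1` symbols of the BWTs, with the
irrelevant blocks below `k` copied. -/
structure Dyn (D : Merge) (σ : ℕ) (I : Iter) (k0 k1 k : ℕ) (A : Mem) : Prop where
  -- Final bits are held in both halves of `Z`, so they need no move.
  old : ∀ p < D.n, D.Irr I.m p → A .Z (I.nx + p) = D.bit (I.m + 1) p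
  new : ∀ x < D.n, ¬ D.Irr I.m x → D.LF x < D.free (D.sym x) k0 k1 →
    A .Z (I.nx + D.LF x) = D.bit (I.m + 1) (D.LF x)
  copy : ∀ p < k, D.Irr (I.m + 1) p → A .Z (I.nx + p) = D.bit (I.m + 1) p
  B_zero : A B 0 = 1
  B_val : ∀ p, 0 < p → p < D.n → A B p = 0 ∨ (A B p = D.lcp p + 1 ∧ D.lcp p < I.m + 1)
  -- Only iteration `d + 1` would mark this boundary, and it misses it only if the preimage is
  -- skipped then.
  B_old : ∀ x < D.n, ∀ d : ℕ, d < I.m → D.lcp (D.LF x) = d → A B (D.LF x) = 0 → D.Irr d x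
  B_new : ∀ x < D.n, ¬ D.Irr I.m x → D.LF x < D.free (D.sym x) k0 k1 →
    D.lcp (D.LF x) < I.m + 1 → A B (D.LF x) ≠ 0
  -- Markers are left out: their position is given by the bit itself.
  F : ∀ c, 2 ≤ c → c < σ + 2 → A .F c = (D.free c k0 k1 : ℤ)

/-- The state while the active block `[s, e)` is scanned. -/
structure InBlock (D : Merge) (σ : ℕ) (I : Iter) (s e k0 k1 : ℕ) (R : Regs) (A : Mem) : Prop where
  fixR : FixR D σ I R
  fixA : FixA D σ I A
  dyn : Dyn D σ I k0 k1 s A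
  scan : D.Scan s e k0 k1
  reg_k : R .k = ((k0 + k1 : ℕ) : ℤ)
  reg_k0 : R .k0 = (k0 : ℤ)
  reg_k1 : R .k1 = (k1 : ℤ)
  reg_z0 : R .z0 = ((k0 - D.K false s : ℕ) : ℤ)
  reg_z1 : R .z1 = ((k1 - D.K true s : ℕ) : ℤ)
  reg_id : R .id = (s : ℤ)
  occ : ∀ c < σ + 2, A .occ c =
    ((D.rank false c k0 + D.rank true c k1 - D.cnt c s : ℕ) : ℤ)
  -- Identifiers are starts of blocks, or `-1` initially, so those left over from earlier blocks are
  -- smaller than `s`.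
  seen : ∀ c < σ + 2,
    (D.rank false c k0 + D.rank true c k1 = D.cnt c s ∧ A .blockId c < s) ∨
    (D.cnt c s < D.rank false c k0 + D.rank true c k1 ∧ A .blockId c = s)

/-- The registers that are not changed while a block is scanned. -/
def blockFrame : List Reg := [.rd, .act, .last, .newLen]

variable {X : Machine} {D : Merge} {σ : ℕ} {I : Iter} {R : Regs} {A : Mem} {t : ℕ}

set_option maxHeartbeats 1000000 in
-- By `scan_step`, the bit is written where the vector of depth `m + 1` has that very bit. A
-- boundary is considered exactly at the first occurrence of a symbol in the block, when the free
-- position is the start of the image block.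
lemma runs_processPosition (hX : X.Fits D σ) (V : D.Valid σ) {s e k0 k1 : ℕ}
    (hB : D.Blk I.m s e) (hirr : ∀ i, s ≤ i → i < e → ¬ D.Irr I.m i)
    (H : InBlock D σ I s e k0 k1 R A) (hk : k0 + k1 < e) :
    Runs X processPosition R A t fun R' A' t' => ∃ k0' k1', k0' + k1' = k0 + k1 + 1 ∧
      InBlock D σ I s e k0' k1' R' A' ∧ (∀ r ∈ blockFrame, R' r = R r) ∧ A' .irr = A .irr ∧
      t' ≤ t + 100 := by
  obtain ⟨x, hsx, hxe, hz, hbw, hz', hlo, hhi, hmark, hscan⟩ := V.scan_step hB H.scan hk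
  have hen := hB.le
  have hxn : x < D.n := by omega
  have hbd := hX.bd
  have hbd' : 20 ≤ X.bd := by omega
  have hsym := V.sym_lt x hxn
  have hfix := H.fixR
  have hl0 := H.scan.left0
  have hl1 := H.scan.left1
  have hhalf := H.fixA.halves
  have himg := V.blk_image (c := D.sym x) hB (by omega)
  have hcle := D.cum_add_cnt_le (D.sym x) hen
  have hLFx : D.cum (D.sym x) + D.cnt (D.sym x) s ≤ D.n := by omega
  set c := D.sym x with hc
  set f := D.free c k0 k1 with hf
  set b := D.col x with hb
  set k0' := if b then k0 else k0 + 1 with hk0'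
  set k1' := if b then k1 + 1 else k1 with hk1'
  have hkk : k0' + k1' = k0 + k1 + 1 := by
    rw [hk0', hk1']; cases b <;> simp <;> omega
  have hrank : ∀ c', D.rank false c' k0' + D.rank true c' k1' =
      D.rank false c' k0 + D.rank true c' k1 + if c' = c then 1 else 0 := by
    intro c'
    rw [hk0', hk1']
    cases hbb : b <;> simp only [hbb, if_true, if_false, Bool.false_eq_true] at hbw ⊢ <;>
      rw [rank_succ, hbw] <;> simp only [eq_comm (a := c)] <;> omega
  have hfree : ∀ c', D.free c' k0' k1' = D.free c' k0 k1 + if c' = c then 1 else 0 := by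
    intro c'
    have := hrank c'
    unfold Merge.free; omega
  have hfeq : f = D.cum c + (D.rank false c k0 + D.rank true c k1) := by
    rw [hf, Merge.free]; omega
  have hfn : f < D.n := by omega
  have hbit : D.bit (I.m + 1) f = (b.toNat : ℤ) := Merge.bit_eq hz'
  have hbt : b.toNat ≤ 1 := Bool.toNat_le b
  have hvb : val X R A (get .Z (v .cur + v .k)) = (b.toNat : ℤ) := by
    rw [val_load_nat (val_add_nat (a := I.cu) (b := k0 + k1) (by rw [val_reg, hfix.cur])
      (by rw [val_reg, H.reg_k]) (by omega)), H.fixA.Z _ (by omega)]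
    exact Merge.bit_eq hz
  unfold processPosition
  refine .seq (.assign hvb ?_)
  -- reading the symbol
  refine .seq (.mono (P := fun R' A' t' => A' = A ∧ R' .b = (b.toNat : ℤ) ∧ R' .c = (c : ℤ) ∧
    R' .k0 = (k0' : ℤ) ∧ R' .k1 = (k1' : ℤ) ∧ R' .z0 = ((k0' - D.K false s : ℕ) : ℤ) ∧
    R' .z1 = ((k1' - D.K true s : ℕ) : ℤ) ∧
    (∀ r, r ∉ [Reg.b, .c, .k0, .k1, .z0, .z1] → R' r = R r) ∧ t' ≤ t + 30) ?_ ?_)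
  · refine .ite (fun h => ?_) (fun h => ?_)
    · have hb0 : b = false := by
        rw [holds_eq_iff, val_reg, val_zero hbd'] at h
        simp only [set_apply, if_true] at h
        cases hbb : b <;> simp [hbb] at h ⊢
      simp only [hb0, if_false, Bool.false_eq_true] at hbw hk0' hk1'
      refine .seq (.assign (z := (c : ℤ)) ?_ (.seq (.assign (z := ((k0 + 1 : ℕ) : ℤ)) ?_
        (.assign (z := ((k0 - D.K false s + 1 : ℕ) : ℤ)) ?_ ?_))))
      · rw [val_input_nat (m := k0) (by simp [set_apply, H.reg_k0]), hX.bwt0, hbw]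
      · exact val_add_nat (by simp [set_apply, H.reg_k0]) (val_one hbd') (by omega)
      · exact val_add_nat (by simp [set_apply, H.reg_z0]) (val_one hbd') (by omega)
      · refine ⟨rfl, by simp [set_apply], by simp [set_apply], by simp [set_apply, hk0'],
          by simp [set_apply, hk1', H.reg_k1], ?_, by simp [set_apply, hk1', H.reg_z1], ?_, ?_⟩
        · simp only [set_apply, if_true, hk0']; congr 1; omega
        · intro r hr
          simp only [List.mem_cons, List.not_mem_nil, or_false, not_or] at hr
          simp [set_apply, hr]
        · simp
    · have hb1 : b = true := by
        rw [holds_eq_iff, val_reg, val_zero hbd'] at h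
        simp only [set_apply, if_true] at h
        cases hbb : b <;> simp [hbb] at h ⊢
      simp only [hb1, if_true] at hbw hk0' hk1'
      refine .seq (.assign (z := (c : ℤ)) ?_ (.seq (.assign (z := ((k1 + 1 : ℕ) : ℤ)) ?_
        (.assign (z := ((k1 - D.K true s + 1 : ℕ) : ℤ)) ?_ ?_))))
      · rw [val_input_nat (m := k1) (by simp [set_apply, H.reg_k1]), hX.bwt1, hbw]
      · exact val_add_nat (by simp [set_apply, H.reg_k1]) (val_one hbd') (by omega)
      · exact val_add_nat (by simp [set_apply, H.reg_z1]) (val_one hbd') (by omega)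
      · refine ⟨rfl, by simp [set_apply], by simp [set_apply], by simp [set_apply, hk0', H.reg_k0],
          by simp [set_apply, hk1'], by simp [set_apply, hk0', H.reg_z0], ?_, ?_, ?_⟩
        · simp only [set_apply, if_true, hk1']; congr 1; omega
        · intro r hr
          simp only [List.mem_cons, List.not_mem_nil, or_false, not_or] at hr
          simp [set_apply, hr]
        · simp
  rintro R1 A1 t1 ⟨rfl, r1b, r1c, r1k0, r1k1, r1z0, r1z1, r1, ht1⟩
  -- counting the symbol
  have hrle : D.rank false c k0 + D.rank true c k1 ≤ D.n := by omega
  have hocc := H.occ c hsym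
  refine .seq (.store (m := c)
    (z := ((D.rank false c k0 + D.rank true c k1 - D.cnt c s + 1 : ℕ) : ℤ)) (by rw [val_reg, r1c])
    (val_add_nat (by rw [val_load_nat (m := c) (by rw [val_reg, r1c]), hocc])
      (val_one hbd') (by omega)) (X.word_eq _ (by omega) (by omega))
    (by rw [hX.capOcc]; exact hsym) ?_)
  set A2 := put A1 .occ c _ with hA2
  have a2 : ∀ a, a ≠ .occ → A2 a = A1 a := fun a ha => by rw [hA2, put_apply, if_neg ha]
  -- the free position
  refine .seq (.mono (P := fun R' A' t' => (∀ a, a ≠ .F → A' a = A2 a) ∧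
    (∀ c', 2 ≤ c' → c' < σ + 2 → A' .F c' = (D.free c' k0' k1' : ℤ)) ∧ R' .j = (f : ℤ) ∧
    (∀ r, r ≠ .j → R' r = R1 r) ∧ t' ≤ t + 60) ?_ ?_)
  · refine .ite (fun h => ?_) (fun h => ?_)
    · have hc2 : 2 ≤ c := by
        rw [holds_not_iff, holds_lt_iff, val_reg, val_two hbd', r1c] at h
        omega
      have hFc : A2 .F c = (f : ℤ) := by rw [a2 _ (by decide), H.dyn.F c hc2 hsym]
      refine .seq (.assign (z := (f : ℤ)) (by rw [val_load_nat (m := c) (by rw [val_reg, r1c]), hFc])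
        (.store (m := c) (z := ((f + 1 : ℕ) : ℤ)) (by simp [set_apply, r1c])
          (val_add_nat (by rw [val_load_nat (m := c) (by simp [set_apply, r1c]), hFc])
            (val_one hbd') (by omega)) (X.word_eq _ (by omega) (by omega))
          (by rw [hX.capF]; exact hsym) ⟨?_, ?_, by simp [set_apply], ?_, ?_⟩))
      · intro a ha
        rw [put_apply, if_neg ha]
      · intro c' h1 h2
        rw [put_apply, if_pos rfl, hfree]
        by_cases hcc : c' = c
        · subst hcc; simp [hf]
        · simp only [hcc, if_false, add_zero]
          rw [a2 _ (by decide), H.dyn.F c' h1 h2]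
      · intro r hr
        simp [set_apply, hr]
      · simp; omega
    · have hc2 : c < 2 := by
        rw [holds_not_iff, holds_lt_iff, val_reg, val_two hbd', r1c] at h
        omega
      refine .assign (z := (f : ℤ)) (by rw [val_reg, r1b, ← hmark hc2])
        ⟨fun _ _ => rfl, ?_, by simp [set_apply], ?_, by simp; omega⟩
      · intro c' h1 h2
        rw [a2 _ (by decide), H.dyn.F c' h1 h2, hfree, if_neg (by omega), add_zero]
      · intro r hr
        simp [set_apply, hr]
  rintro R2 A3 t2 ⟨a3, a3F, r2j, r2, ht2⟩
  -- moving the bit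
  refine .seq (.store (m := I.nx + f) (z := (b.toNat : ℤ))
    (val_add_nat (by rw [val_reg, r2 _ (by decide), r1 _ (by decide), hfix.nxt])
      (by rw [val_reg, r2j]) (by omega)) (by rw [val_reg, r2 _ (by decide), r1b])
    (by rw [← hbit]; exact cell_bit ..) (by rw [hX.capZ]; omega) ?_)
  set A4 := put A3 .Z (I.nx + f) _ with hA4
  have a4 : ∀ a, a ≠ .Z → A4 a = A3 a := fun a ha => by rw [hA4, put_apply, if_neg ha]
  have a4Z : ∀ i, A4 .Z i = if i = I.nx + f then (b.toNat : ℤ) else A1 .Z i := by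
    intro i
    rw [hA4, put_apply, if_pos rfl, a3 _ (by decide), a2 _ (by decide)]
  have a4B : A4 B = A1 B := by
    rw [a4 _ (by decide), a3 _ (by decide), a2 _ (by decide)]
  have a4id : A4 .blockId = A1 .blockId := by
    rw [a4 _ (by decide), a3 _ (by decide), a2 _ (by decide)]
  have hseen := H.seen c hsym
  -- marking the boundary
  refine .seq (.mono (P := fun R' A' t' => R' = R2 ∧ (∀ a, a ≠ .blockId → a ≠ B → A' a = A4 a) ∧
    (∀ c' < σ + 2, c' ≠ c → A' .blockId c' = A1 .blockId c') ∧ A' .blockId c = s ∧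
    (∀ i, i ≠ f → A' B i = A1 B i) ∧
    (A' B f = A1 B f ∧ (D.cum c + D.cnt c s = f → A1 B f ≠ 0) ∨
      D.cum c + D.cnt c s = f ∧ A1 B f = 0 ∧ A' B f = ((I.m + 1 : ℕ) : ℤ)) ∧
    t' ≤ t + 90) ?_ ?_)
  · have hvc : ∀ A', val X R2 A' (v .c) = (c : ℤ) := fun _ => by
      rw [val_reg, r2 _ (by decide), r1c]
    have hvid : ∀ A', val X R2 A' (v .id) = (s : ℤ) := fun _ => by
      rw [val_reg, r2 _ (by decide), r1 _ (by decide), H.reg_id]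
    have hvj : ∀ A', val X R2 A' (v .j) = (f : ℤ) := fun _ => by rw [val_reg, r2j]
    refine .ite (fun h => ?_) (fun h => ?_)
    · have hne : A1 .blockId c ≠ s := by
        rw [holds_not_iff, holds_eq_iff, val_load_nat (hvc _), hvid, a4id] at h
        exact h
      have hst : D.cum c + D.cnt c s = f := by
        rcases hseen with ⟨h1, -⟩ | ⟨-, h1⟩
        · rw [hfeq, h1]
        · exact absurd h1 hne
      refine .seq (.store (m := c) (z := (s : ℤ)) (hvc _) (hvid _)
        (X.word_eq _ (by omega) (by omega)) (by rw [hX.capBlockId]; exact hsym) ?_)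
      set A5 := put A4 .blockId c _ with hA5
      have a5 : ∀ a, a ≠ .blockId → A5 a = A4 a := fun a ha => by rw [hA5, put_apply, if_neg ha]
      have a5id : ∀ c', A5 .blockId c' = if c' = c then (s : ℤ) else A1 .blockId c' := by
        intro c'
        rw [hA5, put_apply, if_pos rfl, a4id]
      have a5B : A5 B = A1 B := by rw [a5 _ (by decide), a4B]
      refine .ite (fun h' => ?_) (fun h' => ?_)
      · have hB0 : A1 B f = 0 := by
          rw [holds_eq_iff, val_load_nat (hvj _), val_zero hbd', a5B] at h'
          exact h'
        refine .store (m := f) (z := ((I.m + 1 : ℕ) : ℤ)) (hvj _)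
          (by rw [val_reg, r2 _ (by decide), r1 _ (by decide), hfix.h])
          (X.word_eq _ (by omega) ?_) (by rw [hX.capLcp]; omega) ?_
        -- There still is an active position, so `m ≤ n` and the mark `m + 1` fits into a word.
        · have := V.lt_of_active_pos (m := I.m - 1) (i := s) (by omega)
          have h3 := hirr s le_rfl (by omega)
          rcases Nat.eq_zero_or_pos I.m with h4 | h4
          · rw [h4]; push_cast; omega
          · rw [show I.m = I.m - 1 + 1 by omega] at h3
            have := this h3
            push_cast; omega
        · refine ⟨rfl, ?_, ?_, ?_, ?_, ?_, ?_⟩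
          · intro a h1 h2
            rw [put_apply, if_neg h2, a5 a h1]
          · intro c' _ hcc
            rw [put_apply, if_neg (by decide), a5id, if_neg hcc]
          · rw [put_apply, if_neg (by decide), a5id, if_pos rfl]
          · intro i hi
            rw [put_apply, if_pos rfl, a5B]
            simp only [hi, if_false]
          · right
            refine ⟨hst, hB0, ?_⟩
            rw [put_apply, if_pos rfl]
            simp
          · simp; omega
      · have hB0 : A1 B f ≠ 0 := by
          rw [holds_eq_iff, val_load_nat (hvj _), val_zero hbd', a5B] at h'
          exact h'
        refine .skip ⟨rfl, fun a h1 _ => a5 a h1, ?_, ?_, ?_, ?_, ?_⟩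
        · intro c' _ hcc
          rw [a5id, if_neg hcc]
        · rw [a5id, if_pos rfl]
        · intro i _
          rw [a5B]
        · exact .inl ⟨by rw [a5B], fun _ => hB0⟩
        · simp; omega
    · have heq : A1 .blockId c = s := by
        rw [holds_not_iff, holds_eq_iff, val_load_nat (hvc _), hvid, a4id, not_not] at h
        exact h
      refine .skip ⟨rfl, fun _ _ _ => rfl, fun c' _ _ => by rw [a4id], by rw [a4id, heq],
        fun i _ => by rw [a4B], .inl ⟨by rw [a4B], fun h1 => ?_⟩, by simp; omega⟩
      rcases hseen with ⟨-, h2⟩ | ⟨h2, -⟩ <;> omega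
  rintro R3 A6 t3 ⟨rfl, a6, a6id, a6c, a6B, a6f, ht3⟩
  refine .assign (z := ((k0 + k1 + 1 : ℕ) : ℤ)) (val_add_nat
    (by rw [val_reg, r2 _ (by decide), r1 _ (by decide), H.reg_k]) (val_one hbd')
    (by omega)) ?_
  -- the invariant
  have a6Z : ∀ i, A6 .Z i = if i = I.nx + f then D.bit (I.m + 1) f else A1 .Z i := by
    intro i
    rw [a6 _ (by decide) (by decide), a4Z, hbit]
  have a6irr : A6 .irr = A1 .irr := by
    rw [a6 _ (by decide) (by decide), a4 _ (by decide), a3 _ (by decide), a2 _ (by decide)]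
  have a6mono : ∀ i, A1 B i ≠ 0 → A6 B i ≠ 0 := by
    intro i hi
    by_cases h : i = f
    · subst h
      rcases a6f with ⟨h1, -⟩ | ⟨-, -, h1⟩
      · rwa [h1]
      · rw [h1]; push_cast; omega
    · rwa [a6B i h]
  have hregs : ∀ r, r ∉ [Reg.b, .c, .k0, .k1, .z0, .z1, .j, .k] →
      set R3 .k ((k0 + k1 + 1 : ℕ) : ℤ) r = R r := by
    intro r hr
    simp only [List.mem_cons, List.not_mem_nil, or_false, not_or] at hr
    obtain ⟨h1, h2, h3, h4, h5, h6, h7, h8⟩ := hr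
    rw [set_apply, if_neg h8, r2 r h7, r1 r (by
      simp only [List.mem_cons, List.not_mem_nil, or_false, not_or]
      exact ⟨h1, h2, h3, h4, h5, h6⟩)]
  -- Within the image block, which has depth `m + 1`, only the start is a boundary of that depth.
  have hfirst : D.cum c + D.cnt c s = f → D.lcp f < I.m + 1 := by
    intro h
    have := himg.left
    rw [h] at this
    push_cast at this; omega
  have hlast : D.cum c + D.cnt c s ≠ f → (I.m : ℤ) + 1 ≤ D.lcp f := by
    intro h
    have := himg.inner f (by omega) hhi
    push_cast at this; omega
  refine ⟨k0', k1', hkk, ⟨?_, ?_, ?_, hscan, ?_, ?_, ?_, ?_, ?_, ?_, ?_, ?_⟩, ?_, a6irr, ?_⟩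
  · have : ∀ r ∈ fixedRegs, r ∉ [Reg.b, .c, .k0, .k1, .z0, .z1, .j, .k] := by decide
    exact hfix.congr fun r hr => hregs r (this r hr)
  · refine ⟨hhalf, H.fixA.lists, ?_, ?_, by rw [a6irr]; exact H.fixA.recs⟩
    · intro c' hc'
      rw [a6 _ (by decide) (by decide), a4 _ (by decide), a3 _ (by decide), a2 _ (by decide)]
      exact H.fixA.C c' hc'
    · intro p hp
      rw [a6Z, if_neg (by omega), H.fixA.Z p hp]
  · refine ⟨?_, ?_, ?_, ?_, ?_, ?_, ?_, ?_⟩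
    · intro p hp hi
      rw [a6Z]
      split_ifs with h
      · rw [show p = f by omega]
      · exact H.dyn.old p hp hi
    · intro y hy hi hlt
      rw [a6Z]
      split_ifs with h
      · rw [show D.LF y = f by omega]
      · refine H.dyn.new y hy hi ?_
        rw [hfree] at hlt
        split_ifs at hlt with hcc
        · have : D.LF y ≠ f := by omega
          rw [hcc] at hlt ⊢; omega
        · exact hlt
    · intro p hp hi
      rw [a6Z]
      split_ifs with h
      · rw [show p = f by omega]
      · exact H.dyn.copy p hp hi
    · by_cases h : 0 = f
      · rcases a6f with ⟨h1, -⟩ | ⟨-, h1, -⟩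
        · rw [h, h1, ← h, H.dyn.B_zero]
        · rw [← h, H.dyn.B_zero] at h1; omega
      · rw [a6B 0 h, H.dyn.B_zero]
    · intro p h0 hp
      by_cases h : p = f
      · subst h
        rcases a6f with ⟨h1, -⟩ | ⟨h1, h2, h3⟩
        · rw [h1]; exact H.dyn.B_val f h0 hp
        · right
          have h4 := hfirst h1
          have h5 := V.lcp_nonneg f h0 hp
          -- A smaller LCP value without a mark would mean, by `B_old`, that the preimage of `f` is
          -- irrelevant; but it lies in the active block that is being scanned.
          have h6 : D.lcp f = I.m := by
            by_contra h6
            obtain ⟨y, hy1, hy2, -, hy3⟩ := D.exists_LF_eq hen hlo hhi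
            rw [← hy3] at h2 h4 h5 h6
            refine hirr y hy1 hy2 (Irr.mono (m := (D.lcp (D.LF y)).toNat) ?_ (by omega))
            exact H.dyn.B_old y (by omega) _ (by omega) (by omega) h2
          rw [h3, h6]
          push_cast; omega
      · rw [a6B p h]; exact H.dyn.B_val p h0 hp
    · intro y hy d hd hl hz
      refine H.dyn.B_old y hy d hd hl ?_
      by_contra h0
      exact a6mono _ h0 hz
    · intro y hy hi hlt hl
      rw [hfree] at hlt
      by_cases h : D.LF y = f
      · rw [h]
        rw [h] at hl
        have h1 : D.cum c + D.cnt c s = f := by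
          by_contra h1
          have := hlast h1; omega
        rcases a6f with ⟨h2, h3⟩ | ⟨-, -, h2⟩
        · rw [h2]; exact h3 h1
        · rw [h2]; push_cast; omega
      · refine a6mono _ (H.dyn.B_new y hy hi ?_ hl)
        split_ifs at hlt with hcc
        · rw [hcc] at hlt ⊢; omega
        · exact hlt
    · intro c' h1 h2
      rw [a6 _ (by decide) (by decide), a4 _ (by decide), a3F c' h1 h2]
  · rw [set_apply, if_pos rfl, hkk]
  · simp only [set_apply, reduceCtorEq, if_false]
    rw [r2 _ (by decide), r1k0]
  · simp only [set_apply, reduceCtorEq, if_false]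
    rw [r2 _ (by decide), r1k1]
  · simp only [set_apply, reduceCtorEq, if_false]
    rw [r2 _ (by decide), r1z0]
  · simp only [set_apply, reduceCtorEq, if_false]
    rw [r2 _ (by decide), r1z1]
  · rw [hregs _ (by decide), H.reg_id]
  · intro c' hc'
    rw [a6 _ (by decide) (by decide), a4 _ (by decide), a3 _ (by decide), hA2, put_apply,
      if_pos rfl, hrank]
    by_cases hcc : c' = c
    · subst hcc
      simp only [if_true]
      congr 1
      omega
    · simp only [hcc, if_false, add_zero]
      exact H.occ c' hc'
  · intro c' hc'
    rw [hrank]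
    by_cases hcc : c' = c
    · subst hcc
      right
      simp only [if_true]
      refine ⟨by omega, a6c⟩
    · rw [a6id c' hc' hcc, if_neg hcc, add_zero]
      exact H.seen c' hc'
  · have : ∀ r ∈ blockFrame, r ∉ [Reg.b, .c, .k0, .k1, .z0, .z1, .j, .k] := by decide
    exact fun r hr => hregs r (this r hr)
  · simp; omega

end Gap

/-! ### Processing an active block -/

namespace Gap

open Merge

variable {X : Machine} {D : Merge} {σ : ℕ} {I : Iter} {R : Regs} {A : Mem} {t : ℕ}

lemma Merge.Blk.irr_iff {m s e i : ℕ} (hB : D.Blk m s e) (h1 : s ≤ i) (h2 : i < e) :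
    (D.Irr m i ↔ D.Irr m s) ∧ (D.Irr (m + 1) i ↔ D.Irr (m + 1) s) := by
  have hle := hB.le
  have hs := hB.same h1 h2 le_rfl hB.lt
  constructor
  · cases m with
    | zero => rfl
    | succ m =>
      have hs' : D.Same m i s := hs.mono (by omega)
      exact ⟨fun h => Mono.of_same h (by omega) hs', fun h => Mono.of_same h (by omega) hs'.symm⟩
  · exact ⟨fun h => Mono.of_same h (by omega) hs, fun h => Mono.of_same h (by omega) hs.symm⟩

lemma Dyn.congr {k0 k1 k : ℕ} {A' : Mem} (H : Dyn D σ I k0 k1 k A) (hZ : A' .Z = A .Z)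
    (hB : A' B = A B) (hF : A' .F = A .F) : Dyn D σ I k0 k1 k A' := by
  constructor
  · rw [hZ]; exact H.old
  · rw [hZ]; exact H.new
  · rw [hZ]; exact H.copy
  · rw [hB]; exact H.B_zero
  · rw [hB]; exact H.B_val
  · rw [hB]; exact H.B_old
  · rw [hB]; exact H.B_new
  · rw [hF]; exact H.F

lemma FixA.congr {A' : Mem} (H : FixA D σ I A) (hC : A' .C = A .C) (hZ : A' .Z = A .Z)
    (hirr : A' .irr = A .irr) : FixA D σ I A' :=
  ⟨H.halves, H.lists, by rw [hC]; exact H.C, by rw [hZ]; exact H.Z, by rw [hirr]; exact H.recs⟩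

/-- The state between two blocks, at position `k`, apart from the list that is being written. -/
structure Between (D : Merge) (σ : ℕ) (I : Iter) (k : ℕ) (R : Regs) (A : Mem) : Prop where
  fixR : FixR D σ I R
  fixA : FixA D σ I A
  dyn : Dyn D σ I (D.K false k) (D.K true k) k A
  reg_k : R .k = (k : ℤ)
  reg_k0 : R .k0 = (D.K false k : ℤ)
  reg_k1 : R .k1 = (D.K true k : ℤ)
  ids : ∀ c < σ + 2, A .blockId c < k
  rd : R .rd = (((σ + 5) * D.idx I.m k : ℕ) : ℤ)
  act : (R .act = 1 ∧ ∃ i < k, ¬ D.Irr (I.m + 1) i) ∨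
    (R .act = 0 ∧ ∀ i < k, D.Irr (I.m + 1) i)
  le : k ≤ D.n
  -- The scan pauses only at boundaries of depth `m`.
  lcp : D.lcp k < I.m
  -- It never pauses strictly inside an irrelevant run, so an irrelevant `k` starts its run.
  border : k = 0 ∨ k = D.n ∨ ¬ (D.Irr I.m k ∧ D.Irr I.m (k - 1))

/-- The state of the list that is being written. -/
structure Recorded (D : Merge) (σ : ℕ) (I : Iter) (k : ℕ) (R : Regs) (A : Mem) : Prop where
  last : (R .last = 1 ∧ 0 < k ∧ D.Irr (I.m + 1) (k - 1)) ∨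
    (R .last = 0 ∧ (k = 0 ∨ ¬ D.Irr (I.m + 1) (k - 1)))
  newLen : R .newLen = (((σ + 5) * D.idx (I.m + 1) k : ℕ) : ℤ)
  recs : Records D σ (I.m + 1) k I.q (A .irr)

/-- The description of the block `[s, e)` that has just been scanned. -/
structure Item (D : Merge) (σ : ℕ) (I : Iter) (s e : ℕ) (R : Regs) (A : Mem) : Prop where
  lt : s < e
  id : R .id = (s : ℤ)
  z0 : R .z0 = ((D.K false e - D.K false s : ℕ) : ℤ)
  z1 : R .z1 = ((D.K true e - D.K true s : ℕ) : ℤ)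
  occ : ∀ c < σ + 2, A .occ c = ((D.cnt c e - D.cnt c s : ℕ) : ℤ)
  mono : (R .mono = 1 ∧ ∀ i, s ≤ i → i < e → D.Irr (I.m + 1) i) ∨
    (R .mono = 0 ∧ ∀ i, s ≤ i → i < e → ¬ D.Irr (I.m + 1) i)

/-- Bits of a monochrome block of depth `m` are the same at depth `m + 1`, so copying agrees with
any bit that has already been moved there. -/
lemma Dyn.copy_step {k0 k1 s e j : ℕ} {A : Mem} (V : D.Valid σ)
    (H : Dyn D σ I k0 k1 j A) (hB : D.Blk I.m s e) (hsj : s ≤ j) (hje : j < e)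
    (hm : D.Mono I.m s) : Dyn D σ I k0 k1 (j + 1) (put A .Z (I.nx + j) (D.bit I.m j)) := by
  have hle := hB.le
  have hbit : D.bit (I.m + 1) j = D.bit I.m j := by
    have := V.zbit_congr (d := I.m) (d' := I.m + 1) (p := j) (by omega)
      ((hB.irr_iff hsj hje).2.2 hm) (by omega)
    unfold Merge.bit
    by_cases h : D.zbit I.m j <;> simp [h, this]
  have hZ : ∀ i, put A .Z (I.nx + j) (D.bit I.m j) .Z i =
      if i = I.nx + j then D.bit (I.m + 1) j else A .Z i := by
    intro i; rw [put_apply, if_pos rfl, hbit]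
  have hne : ∀ a, a ≠ .Z → put A .Z (I.nx + j) (D.bit I.m j) a = A a := by
    intro a ha; rw [put_apply, if_neg ha]
  constructor
  · intro p hp hi
    rw [hZ]
    split_ifs with h
    · rw [show p = j by omega]
    · exact H.old p hp hi
  · intro x hx hi hlt
    rw [hZ]
    split_ifs with h
    · rw [show D.LF x = j by omega]
    · exact H.new x hx hi hlt
  · intro p hp hi
    rw [hZ]
    split_ifs with h
    · rw [show p = j by omega]
    · exact H.copy p (by omega) hi
  · rw [hne _ (by decide)]; exact H.B_zero
  · rw [hne _ (by decide)]; exact H.B_val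
  · rw [hne _ (by decide)]; exact H.B_old
  · rw [hne _ (by decide)]; exact H.B_new
  · rw [hne _ (by decide)]; exact H.F

/-- The test for the end of a block. -/
lemma block_test (hX : X.Fits D σ) (V : D.Valid σ) {s e k0 k1 : ℕ} (hB : D.Blk I.m s e)
    (hirr : ∀ i, s ≤ i → i < e → ¬ D.Irr I.m i) (H : InBlock D σ I s e k0 k1 R A) :
    holds X R A (.and (.lt (v .k) (v .n)) (.or (.eq (v .k) (v .id))
      (.or (.eq (get B (v .k)) 0) (.eq (get B (v .k)) (v .h))))) ↔ k0 + k1 < e := by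
  have hle := hB.le
  have hbd := hX.bd
  have hse := hB.lt
  have hs := D.K_add s
  have he := D.K_add e
  obtain ⟨l0, r0, l1, r1, ho⟩ := H.scan
  have hget : val X R A (get B (v .k)) = A B (k0 + k1) := val_load_nat (by rw [val_reg, H.reg_k])
  simp only [holds_and_iff, holds_or_iff, holds_eq_iff, holds_lt_iff, hget]
  rw [val_zero (by omega)]
  simp only [val_reg, H.reg_k, H.fixR.n, H.reg_id, H.fixR.h, Nat.cast_inj, Nat.cast_lt]
  constructor
  · rintro ⟨h1, h2⟩
    by_contra h3
    obtain rfl : k0 + k1 = e := by omega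
    have hlcp := hB.right
    -- At the end `e` of the block, a missing mark would make the preimage irrelevant after
    -- iteration `lcp e`. Then `e` is irrelevant one iteration later, and so is `e - 1`, which
    -- shares its block of depth `lcp e`; but `e - 1` is active. An existing mark lies between `1`
    -- and `m`, hence it is neither `0` nor `h = m + 1`.
    rcases H.dyn.B_val (k0 + k1) (by omega) h1 with h4 | ⟨h4, h5⟩
    · obtain ⟨x, hx, hxe⟩ := D.LF_surj h1
      have h6 := V.lcp_nonneg _ (by omega) h1
      have h7 := H.dyn.B_old x hx (D.lcp (D.LF x)).toNat (by rw [hxe]; omega)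
        (by rw [hxe]; omega) (by rw [hxe]; exact h4)
      have h8 := V.irr_LF hx h7
      rw [hxe] at h8
      have h9 : k0 + k1 = (k0 + k1 - 1) + 1 := by omega
      rw [h9] at h8 h6 hlcp
      have h10 := (irr_succ_iff (by omega) (by omega)).1 h8
      exact hirr _ (by omega) (by omega) (h10.mono (by omega))
    · rcases h2 with h2 | h2 | h2
      · omega
      · change A B (k0 + k1) = 0 at h2
        have := V.lcp_nonneg _ (by omega) h1; omega
      · push_cast at h2; omega
  · intro h
    refine ⟨by omega, ?_⟩
    rcases Nat.eq_or_lt_of_le (show s ≤ k0 + k1 by omega) with h1 | h1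
    · exact .inl h1.symm
    · have h2 := hB.inner _ h1 h
      rcases H.dyn.B_val (k0 + k1) (by omega) (by omega) with h4 | ⟨h4, h5⟩
      · exact .inr (.inl h4)
      · right; right
        push_cast; omega

lemma cost_block_test : (Cond.and (.lt (v .k) (v .n)) (.or (.eq (v .k) (v .id))
    (.or (.eq (get B (v .k)) 0) (.eq (get B (v .k)) (v .h))))).cost = 17 := rfl

/-- The loop covers exactly the block of depth `m` at `s` (`block_test`), and the block is
monochrome if and only if one of the counters `z0`, `z1` is zero. After the scan only the copying
remains to be done. -/
lemma runs_processBlock (hX : X.Fits D σ) (V : D.Valid σ) {s : ℕ} (H : Between D σ I s R A)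
    (hs : s < D.n) (hi : ¬ D.Irr I.m s) :
    Runs X (processBlock σ) R A t fun R' A' t' => ∃ e, Between D σ I e R' A' ∧
      Item D σ I s e R' A' ∧ R' .last = R .last ∧ R' .newLen = R .newLen ∧ A' .irr = A .irr ∧
      (∀ i, s ≤ i → i < e → ¬ D.Irr I.m i) ∧ t' ≤ t + 50 * (σ + 5) + 200 * (e - s) := by
  obtain ⟨s', e, hB, h1, h2⟩ := V.exists_blk I.m hs
  have hss : s' = s := by
    by_contra h
    have := hB.inner s (by omega) h2
    have := H.lcp
    omega
  subst hss
  have hle := hB.le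
  have hbd := hX.bd
  have hbd' : 20 ≤ X.bd := by omega
  have hirr : ∀ i, s' ≤ i → i < e → ¬ D.Irr I.m i := fun i h3 h4 h5 =>
    hi ((hB.irr_iff h3 h4).1.1 h5)
  have hfree := V.free_K (c := 0) hs.le
  have hKs := D.K_add s'
  have hKe := D.K_add e
  unfold processBlock
  refine .seq (.assign (z := (s' : ℤ)) (by rw [val_reg, H.reg_k])
    (.seq (.assign (z := 0) (val_zero hbd') (.seq (.assign (z := 0) (val_zero hbd') ?_)))))
  refine .seq (.fill (fun x => x) (fun _ => 0) (by omega) (fun _ _ h => h) ?_ ?_ ?_ ?_)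
  · intro x hx A' _ _
    exact ⟨by simp [set_apply], val_zero hbd'⟩
  · intro x _
    exact X.word_eq 0 (by omega) (by omega)
  · intro x hx
    rw [hX.capOcc]; exact hx
  intro A1 t1 a1 a1occ _ ht1
  simp only [cost_ofNat, cost_reg] at ht1
  have hin : InBlock D σ I s' e (D.K false s') (D.K true s')
      (set (set (set (set R .id s') .z0 0) .z1 0) .x ((σ + 2 : ℕ) : ℤ)) A1 := by
    refine ⟨(((H.fixR.set (by decide)).set (by decide)).set (by decide)).set (by decide),
      H.fixA.congr (a1 _ (by decide)) (a1 _ (by decide)) (a1 _ (by decide)),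
      H.dyn.congr (a1 _ (by decide)) (a1 _ (by decide)) (a1 _ (by decide)), scan_start hB,
      ?_, ?_, ?_, ?_, ?_, ?_, ?_, ?_⟩
    · rw [hKs]; simp [set_apply, H.reg_k]
    · simp [set_apply, H.reg_k0]
    · simp [set_apply, H.reg_k1]
    · simp [set_apply]
    · simp [set_apply]
    · simp [set_apply]
    · intro c hc
      rw [a1occ c hc, V.rank_K _ _ hs.le, V.rank_K _ _ hs.le, D.acc_add, Nat.sub_self]; rfl
    · intro c hc
      left
      rw [V.rank_K _ _ hs.le, V.rank_K _ _ hs.le, D.acc_add, a1 _ (by decide)]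
      exact ⟨rfl, H.ids c hc⟩
  refine .seq (.loop_range (i := s') (N := e) (fun j R' A' t' => ∃ k0 k1, k0 + k1 = j ∧
    InBlock D σ I s' e k0 k1 R' A' ∧ (∀ r ∈ blockFrame, R' r = R r) ∧ A' .irr = A .irr ∧
    t' ≤ t1 + 130 * (j - s')) hB.lt.le ?_ ?_ ?_)
  · rintro j R' A' t' hsj hje ⟨k0, k1, rfl, hI, hfr, hir, ht'⟩
    refine ⟨(block_test hX V hB hirr hI).2 hje, ?_⟩
    refine (runs_processPosition hX V hB hirr hI hje).mono ?_
    rintro R'' A'' t'' ⟨k0', k1', hkk, hI', hfr', hir', ht''⟩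
    refine ⟨k0', k1', hkk, hI', fun r hr => (hfr' r hr).trans (hfr r hr), hir'.trans hir, ?_⟩
    rw [cost_block_test] at ht''
    omega
  swap
  · refine ⟨_, _, hKs, hin, ?_, a1 _ (by decide), by omega⟩
    intro r hr
    simp only [blockFrame, List.mem_cons, List.not_mem_nil, or_false] at hr
    rcases hr with rfl | rfl | rfl | rfl <;> simp [set_apply]
  rintro R2 A2 t2 ⟨k0, k1, hke, hI, hfr, hir, ht2⟩
  refine ⟨fun h => absurd ((block_test hX V hB hirr hI).1 h) (by omega), ?_⟩
  obtain ⟨rfl, rfl⟩ := hI.scan.end_eq hke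
  have hidx : D.idx I.m e = D.idx I.m s' := by
    refine idx_eq hB.lt.le fun i h3 h4 h5 => hirr i h3 h4 h5.1
  have hsub0 := D.K_mono false hB.lt.le
  have hsub1 := D.K_mono true hB.lt.le
  have hlcpe : D.lcp e < I.m := hB.right
  have hborder : e = 0 ∨ e = D.n ∨ ¬ (D.Irr I.m e ∧ D.Irr I.m (e - 1)) := by
    right; right
    exact fun h => hirr _ (by omega) (by omega) h.2
  have hids : ∀ c < σ + 2, A2 .blockId c < e := by
    intro c hc
    rcases hI.seen c hc with ⟨-, h⟩ | ⟨-, h⟩ <;> omega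
  have hocc : ∀ c < σ + 2, A2 .occ c = ((D.cnt c e - D.cnt c s' : ℕ) : ℤ) := by
    intro c hc
    rw [hI.occ c hc, V.rank_K _ _ hle, V.rank_K _ _ hle, D.acc_add]
  have hmono := hB.mono_iff_K le_rfl hB.lt
  have htest : ∀ c : ℕ, c = (σ + 2) * 11 → c ≤ 11 * (σ + 5) := by intro c h; omega
  have ht2' := htest _ rfl
  refine .ite (fun h => ?_) (fun h => ?_)
  · rw [holds_or_iff, holds_eq_iff, holds_eq_iff, val_zero hbd', val_reg, val_reg, hI.reg_z0,
      hI.reg_z1] at h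
    have hm : D.Mono I.m s' := hmono.2 (by omega)
    refine .seq (.assign (z := 1) (val_one hbd') (.seq (.assign (z := (s' : ℤ))
      (by simp [set_apply, hI.reg_id]) ?_)))
    refine .loop_range (i := s') (N := e) (fun j R' A' t' =>
      (∀ r, r ≠ .j → R' r = set R2 .mono 1 r) ∧ R' .j = (j : ℤ) ∧ (∀ a, a ≠ .Z → A' a = A2 a) ∧
      FixA D σ I A' ∧ Dyn D σ I (D.K false e) (D.K true e) j A' ∧
      t' ≤ t2 + 40 + 30 * (j - s')) hB.lt.le ?_ ?_ ?_
    · rintro j R' A' t' hsj hje ⟨hr, hj, ha, hfA, hd, ht'⟩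
      have hrk : R' .k = (e : ℤ) := by
        rw [hr _ (by decide)]; simp [set_apply, hI.reg_k, hke]
      have hrn : R' .nxt = (I.nx : ℤ) := by
        rw [hr _ (by decide)]; simp [set_apply, hI.fixR.nxt]
      have hrc : R' .cur = (I.cu : ℤ) := by
        rw [hr _ (by decide)]; simp [set_apply, hI.fixR.cur]
      have hhalf := hfA.halves
      refine ⟨by rw [holds_lt_iff, val_reg, val_reg, hrk, hj]; exact_mod_cast hje, ?_⟩
      refine .seq (.store (m := I.nx + j) (z := D.bit I.m j)
        (val_add_nat (by rw [val_reg, hrn]) (by rw [val_reg, hj]) (by omega)) ?_ (cell_bit ..)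
        (by rw [hX.capZ]; omega) (.assign (z := ((j + 1 : ℕ) : ℤ))
          (val_add_nat (by rw [val_reg, hj]) (val_one hbd') (by omega)) ?_))
      · rw [val_load_nat (val_add_nat (by rw [val_reg, hrc]) (by rw [val_reg, hj]) (by omega)),
          hfA.Z j (by omega)]
      · refine ⟨?_, by simp [set_apply], ?_, ?_, hd.copy_step V hB hsj hje hm, ?_⟩
        · intro r hne
          rw [set_apply, if_neg hne, hr r hne]
        · intro a hne
          rw [put_apply, if_neg hne, ha a hne]
        · refine ⟨hhalf, hfA.lists, ?_, ?_, ?_⟩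
          · rw [put_apply, if_neg (by decide)]; exact hfA.C
          · intro p hp
            rw [put_apply, if_pos rfl, if_neg (by omega), hfA.Z p hp]
          · rw [put_apply, if_neg (by decide)]; exact hfA.recs
        · simp; omega
    · rintro R' A' t' ⟨hr, hj, ha, hfA, hd, ht'⟩
      have hr' : ∀ r, r ≠ .j → r ≠ .mono → R' r = R2 r := by
        intro r h3 h4
        rw [hr r h3, set_apply, if_neg h4]
      refine ⟨?_, e, ⟨?_, hfA, hd, ?_, ?_, ?_, ?_, ?_, ?_, hle, hlcpe, hborder⟩,
        ⟨hB.lt, ?_, ?_, ?_, ?_, ?_⟩, ?_, ?_, ?_, hirr, ?_⟩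
      · rw [holds_lt_iff, val_reg, val_reg, hj, hr' _ (by decide) (by decide), hI.reg_k, hke]
        exact lt_irrefl _
      · exact hI.fixR.congr fun r hrr => hr' r (by rintro rfl; revert hrr; decide)
          (by rintro rfl; revert hrr; decide)
      · rw [hr' _ (by decide) (by decide), hI.reg_k, hke]
      · rw [hr' _ (by decide) (by decide), hI.reg_k0]
      · rw [hr' _ (by decide) (by decide), hI.reg_k1]
      · rw [ha _ (by decide)]; exact hids
      · rw [hr' _ (by decide) (by decide), hfr _ (by decide), H.rd, hidx]
      · rw [hr' _ (by decide) (by decide), hfr _ (by decide)]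
        rcases H.act with ⟨h3, i, h4, h5⟩ | ⟨h3, h4⟩
        · exact .inl ⟨h3, i, by omega, h5⟩
        · refine .inr ⟨h3, fun i hie => ?_⟩
          by_cases his : i < s'
          · exact h4 i his
          · exact (hB.irr_iff (by omega) hie).2.2 hm
      · rw [hr' _ (by decide) (by decide), hI.reg_id]
      · rw [hr' _ (by decide) (by decide), hI.reg_z0]
      · rw [hr' _ (by decide) (by decide), hI.reg_z1]
      · rw [ha _ (by decide)]; exact hocc
      · left
        refine ⟨by rw [hr _ (by decide)]; simp [set_apply], fun i h3 h4 => ?_⟩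
        exact (hB.irr_iff h3 h4).2.2 hm
      · rw [hr' _ (by decide) (by decide), hfr _ (by decide)]
      · rw [hr' _ (by decide) (by decide), hfr _ (by decide)]
      · rw [ha _ (by decide), hir]
      · have := hB.lt
        simp only [cost_lt, cost_reg]
        omega
    · refine ⟨?_, by simp [set_apply], fun _ _ => rfl, hI.fixA, ?_, by simp⟩
      · intro r hr
        rw [set_apply, if_neg hr]
      · exact hI.dyn
  · rw [holds_or_iff, holds_eq_iff, holds_eq_iff, val_zero hbd', val_reg, val_reg, hI.reg_z0,
      hI.reg_z1] at h
    have hm : ¬ D.Mono I.m s' := fun hm => by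
      have := hmono.1 hm; omega
    have hm' : ∀ i, s' ≤ i → i < e → ¬ D.Irr (I.m + 1) i := fun i h3 h4 h5 =>
      hm ((hB.irr_iff h3 h4).2.1 h5)
    refine .seq (.assign (z := 0) (val_zero hbd') (.assign (z := 1) (val_one hbd') ?_))
    refine ⟨e, ⟨(hI.fixR.set (by decide)).set (by decide), hI.fixA, ?_, ?_, ?_, ?_, hids, ?_, ?_,
      hle, hlcpe, hborder⟩, ⟨hB.lt, ?_, ?_, ?_, hocc, ?_⟩, ?_, ?_, hir, hirr, ?_⟩
    · refine ⟨hI.dyn.old, hI.dyn.new, ?_, hI.dyn.B_zero, hI.dyn.B_val, hI.dyn.B_old,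
        hI.dyn.B_new, hI.dyn.F⟩
      intro p hp hpi
      by_cases hps : p < s'
      · exact hI.dyn.copy p hps hpi
      · exact absurd hpi (hm' p (by omega) hp)
    · simp [set_apply, hI.reg_k, hke]
    · simp [set_apply, hI.reg_k0]
    · simp [set_apply, hI.reg_k1]
    · simp only [set_apply, reduceCtorEq, if_false]
      rw [hfr _ (by decide), H.rd, hidx]
    · exact .inl ⟨by simp [set_apply], s', hB.lt, hm' s' le_rfl hB.lt⟩
    · simp [set_apply, hI.reg_id]
    · simp only [set_apply, reduceCtorEq, if_false]
      exact hI.reg_z0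
    · simp only [set_apply, reduceCtorEq, if_false]
      exact hI.reg_z1
    · exact .inr ⟨by simp [set_apply], hm'⟩
    · simp only [set_apply, reduceCtorEq, if_false]
      exact hfr _ (by decide)
    · simp only [set_apply, reduceCtorEq, if_false]
      exact hfr _ (by decide)
    · have := hB.lt
      rw [cost_block_test]
      simp only [cost_or, cost_eq, cost_reg, cost_ofNat]
      omega

end Gap

/-! ### Skipping an irrelevant run -/

namespace Gap

open Merge

variable {X : Machine} {D : Merge} {σ : ℕ} {I : Iter} {R : Regs} {A : Mem} {t : ℕ}

open Classical in
lemma Merge.idx_le (D : Merge) (m x : ℕ) : D.idx m x ≤ x := Nat.count_le _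

lemma Merge.RunStart.exists_runTo {m k s : ℕ} (h : D.RunStart m s) (hs : s < k) :
    ∃ e, D.RunTo m k s e := by
  classical
  have he : ∃ e, s < e ∧ (e = k ∨ ¬ D.Irr m e) := ⟨k, hs, .inl rfl⟩
  refine ⟨Nat.find he, h, (Nat.find_spec he).1, Nat.find_min' he ⟨hs, .inl rfl⟩, ?_,
    (Nat.find_spec he).2⟩
  intro i h1 h2
  rcases h1.eq_or_lt with rfl | h1
  · exact h.1
  · by_contra h3
    exact Nat.find_min he h2 ⟨h1, .inr h3⟩

lemma Merge.exists_runTo_last {m k : ℕ} (hk : 0 < k) (h : D.Irr m (k - 1)) :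
    ∃ s, D.RunTo m k s k := by
  induction k with
  | zero => omega
  | succ k ih =>
    by_cases h1 : k = 0 ∨ ¬ D.Irr m (k - 1)
    · refine ⟨k, ⟨h, h1⟩, by omega, le_rfl, fun i h2 h3 => ?_, .inl rfl⟩
      rwa [show i = k by omega]
    · obtain ⟨s, hs⟩ := ih (by omega) (by tauto)
      refine ⟨s, hs.start, hs.lt.trans (by omega), le_rfl, fun i h2 h3 => ?_, .inl rfl⟩
      by_cases h4 : i = k
      · rwa [h4]
      · exact hs.irr i h2 (by omega)

lemma Merge.RunTo.idx_eq {m k s e : ℕ} (h : D.RunTo m k s e) : D.idx m e = D.idx m s + 1 :=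
  idx_run h.start h.lt h.irr

lemma Merge.LF_lt_iff {x y : ℕ} : D.LF x < D.cum (D.sym x) + D.cnt (D.sym x) y ↔ x < y := by
  unfold Merge.LF
  rw [Nat.add_lt_add_iff_left]
  exact ⟨fun h => Nat.lt_of_count_lt_count h, D.cnt_lt⟩

lemma word_word (w : ℕ) (z : ℤ) : word w (word w z) = word w z := Int.bmod_bmod

lemma val_addr {r : Reg} {e : Expr} {a b : ℕ} (he : val X R A e = a) (hr : R r = b)
    (h : 2 * a + b ≤ X.bd) : val X R A (addr r e) = ((2 * a + b : ℕ) : ℤ) := by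
  unfold addr
  rw [two_mul]
  exact val_add_nat (val_add_nat he he (by omega)) (by rw [val_reg, hr]) (by omega)

/-- The recorded counts advance the counters and `F` exactly as a scan of the run would. No bit is
moved and no boundary is marked: the invariants ask for that only at images of active ranks. -/
lemma runs_skipBlock (hX : X.Fits D σ) (V : D.Valid σ) {s : ℕ} (H : Between D σ I s R A)
    (hs : s < D.n) (hi : D.Irr I.m s) :
    Runs X (skipBlock σ) R A t fun R' A' t' => ∃ e, Between D σ I e R' A' ∧
      Item D σ I s e R' A' ∧ R' .last = R .last ∧ R' .newLen = R .newLen ∧ A' .irr = A .irr ∧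
      D.RunTo I.m D.n s e ∧ t' ≤ t + 50 * (σ + 5) := by
  have hst : D.RunStart I.m s := by
    refine ⟨hi, ?_⟩
    rcases H.border with h | h | h
    · exact .inl h
    · omega
    · exact .inr fun h' => h ⟨hi, h'⟩
  obtain ⟨e, hR⟩ := hst.exists_runTo hs
  have hle := hR.le
  have hlt := hR.lt
  have hbd := hX.bd
  have hbd' : 20 ≤ X.bd := by omega
  have hfix := H.fixR
  obtain ⟨-, rec0, rec1, recx⟩ := H.fixA.recs s e hR
  have hlists := H.fixA.lists
  have hidx := D.idx_le I.m s
  have hrd := H.rd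
  have hmul : (σ + 5) * D.idx I.m s + (σ + 5) ≤ (σ + 5) * D.n := by
    rw [← Nat.mul_succ]; exact Nat.mul_le_mul_left _ (by omega)
  have hnext : (σ + 5) * D.idx I.m e = (σ + 5) * D.idx I.m s + (σ + 5) := by
    rw [hR.idx_eq, Nat.mul_succ]
  set a := (σ + 5) * D.idx I.m s with ha
  have hKs := D.K_add s
  have hKe := D.K_add e
  have hK0 := D.K_mono false hlt.le
  have hK1 := D.K_mono true hlt.le
  unfold skipBlock
  refine .seq (.assign (z := (s : ℤ)) (by rw [val_reg, H.reg_k]) ?_)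
  refine .seq (.assign (z := ((D.K false e - D.K false s : ℕ) : ℤ)) ?_ ?_)
  · rw [val_load_nat (m := 2 * (a + 1) + I.p), rec0]
    exact val_addr (val_add_nat (by simp [set_apply, hrd]) (val_one hbd') (by omega))
      (by simp [set_apply, hfix.p]) (by omega)
  refine .seq (.assign (z := ((D.K true e - D.K true s : ℕ) : ℤ)) ?_ ?_)
  · rw [val_load_nat (m := 2 * (a + 2) + I.p), rec1]
    exact val_addr (val_add_nat (by simp [set_apply, hrd]) (val_two hbd') (by omega))
      (by simp [set_apply, hfix.p]) (by omega)
  set R1 := set (set (set R .id s) .z0 ((D.K false e - D.K false s : ℕ) : ℤ)) .z1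
    ((D.K true e - D.K true s : ℕ) : ℤ) with hR1
  refine .seq (Runs.forUpto (N := σ + 2) (fun x R' A' t' => R' = set R1 .x (x : ℤ) ∧
    (∀ b, b ≠ .occ → b ≠ .F → A' b = A b) ∧
    (∀ y < x, A' .occ y = ((D.cnt y e - D.cnt y s : ℕ) : ℤ)) ∧
    (∀ y, 2 ≤ y → y < σ + 2 → A' .F y =
      ((D.cum y + D.cnt y (if y < x then e else s) : ℕ) : ℤ)) ∧
    t' ≤ t + 50 + 40 * x) (by omega) ?_ ?_ ?_ ?_ ?_)
  · intro x R' A' t' _ _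
    rw [val_lit_eq (by omega) (by omega)]; push_cast; rfl
  · refine ⟨rfl, fun _ _ _ => rfl, by simp, fun y h1 h2 => ?_, ?_⟩
    · rw [H.dyn.F y h1 h2, V.free_K hs.le]; simp
    · simp [addr]
  · rintro x R' A' t' _ ⟨rfl, -⟩
    simp [set_apply]
  · rintro x R' A' t' hx ⟨rfl, h1, h2, h3, h4⟩ -
    have hcle := D.cnt_mono x hlt.le
    have hcn := D.cum_add_cnt_le x hle
    have hvx : ∀ A', val X (set R1 .x (x : ℤ)) A' (v .x) = (x : ℤ) := fun _ => by
      simp [set_apply]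
    refine .seq (.store (m := x) (z := ((D.cnt x e - D.cnt x s : ℕ) : ℤ)) (hvx _) ?_
      (X.word_eq _ (by omega) (by omega)) (by rw [hX.capOcc]; exact hx) ?_)
    · rw [val_load_nat (m := 2 * (a + 3 + x) + I.p), h1 _ (by decide) (by decide), recx x hx]
      exact val_addr (val_add_nat (val_add_nat (by simp [set_apply, R1, hrd]) (val_three hbd')
        (by omega)) (hvx _) (by omega)) (by simp [set_apply, R1, hfix.p]) (by omega)
    -- For the two markers nothing is known about `F`, so no bound on the sum is available. It is
    -- stored unchanged because the result of an addition is a word already.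
    refine .store (m := x) (hvx _) rfl (word_word ..) (by rw [hX.capF]; exact hx)
      ⟨by simp [set_apply], ?_, ?_, ?_, ?_, ?_⟩
    · rw [set_set]; push_cast; rfl
    · intro b h5 h6
      rw [put_apply, if_neg h6, put_apply, if_neg h5, h1 b h5 h6]
    · intro y hy
      rw [put_apply, if_neg (by decide), put_apply, if_pos rfl]
      by_cases hyx : y = x
      · subst hyx; simp
      · simp only [hyx, if_false]
        exact h2 y (by omega)
    · intro y h5 h6
      rw [put_apply, if_pos rfl]
      have hF : ∀ z, put A' .occ x z .F = A' .F := fun z => by rw [put_apply, if_neg (by decide)]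
      by_cases hyx : y = x
      · subst hyx
        have h7 := h3 y h5 h6
        rw [if_neg (lt_irrefl _)] at h7
        simp only [if_true]
        rw [if_pos (Nat.lt_succ_self y)]
        have := val_add_nat (X := X) (R := set R1 .x (y : ℤ))
          (A := put A' .occ y ((D.cnt y e - D.cnt y s : ℕ) : ℤ)) (e := get .F (v .x))
          (f := get .occ (v .x)) (a := D.cum y + D.cnt y s) (b := D.cnt y e - D.cnt y s)
          (by rw [val_load_nat (hvx _), hF, h7])
          (by rw [val_load_nat (hvx _), put_apply, if_pos rfl]; simp) (by omega)
        refine this.trans ?_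
        congr 1; omega
      · simp only [hyx, if_false]
        rw [hF, h3 y h5 h6]
        by_cases hyx' : y < x
        · rw [if_pos hyx', if_pos (by omega)]
        · rw [if_neg hyx', if_neg (by omega)]
    · simp [addr]; omega
  rintro R' A' t1 ⟨rfl, h1, h2, h3, h4⟩ -
  have hz0 : set R1 .x ((σ + 2 : ℕ) : ℤ) .z0 = ((D.K false e - D.K false s : ℕ) : ℤ) := by
    simp [set_apply, R1]
  have hz1 : set R1 .x ((σ + 2 : ℕ) : ℤ) .z1 = ((D.K true e - D.K true s : ℕ) : ℤ) := by
    simp [set_apply, R1]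
  have hk0 : set R1 .x ((σ + 2 : ℕ) : ℤ) .k0 = (D.K false s : ℤ) := by
    simp [set_apply, R1, H.reg_k0]
  have hk1 : set R1 .x ((σ + 2 : ℕ) : ℤ) .k1 = (D.K true s : ℤ) := by
    simp [set_apply, R1, H.reg_k1]
  have hk : set R1 .x ((σ + 2 : ℕ) : ℤ) .k = (s : ℤ) := by
    simp [set_apply, R1, H.reg_k]
  have hrd2 : set R1 .x ((σ + 2 : ℕ) : ℤ) .rd = (a : ℤ) := by
    simp [set_apply, R1, hrd]
  have hR2 : ∀ r, r ∉ [Reg.id, .z0, .z1, .x] → set R1 .x ((σ + 2 : ℕ) : ℤ) r = R r := by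
    intro r hr
    simp only [List.mem_cons, List.not_mem_nil, or_false, not_or] at hr
    simp [set_apply, R1, hr]
  set R2 := set R1 .x ((σ + 2 : ℕ) : ℤ)
  refine .seq (.assign (z := ((D.K false s + (D.K false e - D.K false s) : ℕ) : ℤ))
    (val_add_nat hk0 hz0 (by omega)) ?_)
  refine .seq (.assign (z := ((D.K true s + (D.K true e - D.K true s) : ℕ) : ℤ))
    (val_add_nat (by simp [set_apply, hk1]) (by simp [set_apply, hz1]) (by omega)) ?_)
  refine .seq (.assign
    (z := ((s + (D.K false e - D.K false s) + (D.K true e - D.K true s) : ℕ) : ℤ))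
    (val_add_nat (val_add_nat (by simp [set_apply, hk]) (by simp [set_apply, hz0]) (by omega))
      (by simp [set_apply, hz1]) (by omega)) ?_)
  refine .seq (.assign (z := ((a + (σ + 5) : ℕ) : ℤ))
    (val_add_nat (by simp [set_apply, hrd2])
      ((val_lit_eq (by omega) (by omega)).trans (by push_cast; rfl)) (by omega)) ?_)
  refine .assign (z := 1) (val_one hbd') ?_
  have hirr : ∀ i, s ≤ i → i < e → D.Irr (I.m + 1) i := fun i h5 h6 =>
    (hR.irr i h5 h6).mono (by omega)
  refine ⟨e, ⟨?_, H.fixA.congr (h1 _ (by decide) (by decide)) (h1 _ (by decide) (by decide))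
    (h1 _ (by decide) (by decide)), ?_, ?_, ?_, ?_, ?_, ?_, ?_, hle, ?_, ?_⟩,
    ⟨hlt, ?_, ?_, ?_, h2, .inl ⟨by simp [set_apply], hirr⟩⟩, ?_, ?_,
    h1 _ (by decide) (by decide), hR, ?_⟩
  · refine hfix.congr fun r hr => ?_
    have : ∀ r ∈ fixedRegs, r ∉ [Reg.id, .z0, .z1, .x] ∧
      r ≠ .k0 ∧ r ≠ .k1 ∧ r ≠ .k ∧ r ≠ .rd ∧ r ≠ .mono := by decide
    obtain ⟨h5, h6, h7, h8, h9, h10⟩ := this r hr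
    rw [← hR2 r h5]
    simp [set_apply, h6, h7, h8, h9, h10]
  · have hZ := h1 .Z (by decide) (by decide)
    have hB := h1 B (by decide) (by decide)
    -- The ranks passed over are irrelevant, so moving the free positions creates no new obligation.
    have hback : ∀ x < D.n, ¬ D.Irr I.m x → D.LF x < D.free (D.sym x) (D.K false e) (D.K true e) →
        D.LF x < D.free (D.sym x) (D.K false s) (D.K true s) := by
      intro x _ h5 h6
      rw [V.free_K hle, LF_lt_iff] at h6
      rw [V.free_K hs.le, LF_lt_iff]
      by_contra h7
      exact h5 (hR.irr x (by omega) h6)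
    refine ⟨by rw [hZ]; exact H.dyn.old, ?_, ?_, by rw [hB]; exact H.dyn.B_zero,
      by rw [hB]; exact H.dyn.B_val, by rw [hB]; exact H.dyn.B_old, ?_, ?_⟩
    · intro x hx h5 h6
      rw [hZ]
      exact H.dyn.new x hx h5 (hback x hx h5 h6)
    · intro p hp h5
      rw [hZ]
      by_cases h6 : p < s
      · exact H.dyn.copy p h6 h5
      · exact H.dyn.old p (by omega) (hR.irr p (by omega) hp)
    · intro x hx h5 h6 h7
      rw [hB]
      exact H.dyn.B_new x hx h5 (hback x hx h5 h6) h7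
    · intro c h5 h6
      rw [h3 c h5 h6, if_pos h6, V.free_K hle]
  · simp only [set_apply, reduceCtorEq, if_false, if_true]
    congr 1; omega
  · simp only [set_apply, reduceCtorEq, if_false, if_true]
    congr 1; omega
  · simp only [set_apply, reduceCtorEq, if_false, if_true]
    congr 1; omega
  · intro c hc
    rw [h1 _ (by decide) (by decide)]
    exact (H.ids c hc).trans (by omega)
  · simp only [set_apply, reduceCtorEq, if_false, if_true]
    rw [hnext]
  · have hact : R2 .act = R .act := hR2 _ (by decide)
    simp only [set_apply, reduceCtorEq, if_false]
    rw [hact]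
    rcases H.act with ⟨h5, i, h6, h7⟩ | ⟨h5, h6⟩
    · exact .inl ⟨h5, i, by omega, h7⟩
    · refine .inr ⟨h5, fun i hie => ?_⟩
      by_cases his : i < s
      · exact h6 i his
      · exact hirr i (by omega) hie
  -- A run ends at a boundary of depth `m`: otherwise `e` would share a block with `e - 1` and be
  -- irrelevant as well.
  · rcases hR.maximal with rfl | h5
    · rw [V.lcp_end]; omega
    · rcases hle.eq_or_lt with rfl | hle'
      · rw [V.lcp_end]; omega
      · obtain ⟨m, hm⟩ : ∃ m, I.m = m + 1 := Nat.exists_eq_succ_of_ne_zero fun h6 => by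
          rw [h6] at hi; exact hi
        by_contra h6
        have he : e = (e - 1) + 1 := by omega
        rw [hm] at h5 h6
        rw [he] at h5 h6 hle'
        refine h5 ((irr_succ_iff hle' (by push_cast at h6; omega)).2 ?_)
        rw [← hm]
        exact hR.irr _ (by omega) (by omega)
  · rcases hR.maximal with h5 | h5
    · exact .inr (.inl h5)
    · exact .inr (.inr fun h6 => h5 h6.1)
  · simp [set_apply, R2, R1]
  · simp only [set_apply, reduceCtorEq, if_false]; exact hz0
  · simp only [set_apply, reduceCtorEq, if_false]; exact hz1
  · simp only [set_apply, reduceCtorEq, if_false]; exact hR2 _ (by decide)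
  · simp only [set_apply, reduceCtorEq, if_false]; exact hR2 _ (by decide)
  · simp [recLen]; omega

end Gap

/-! ### Writing the list of irrelevant runs -/

namespace Gap

open Merge

variable {X : Machine} {D : Merge} {σ : ℕ} {I : Iter} {R : Regs} {A : Mem} {t : ℕ}

lemma Records.congr {m k p : ℕ} {M M' : ℕ → ℤ} (H : Records D σ m k p M)
    (h : ∀ j, M' (2 * j + p) = M (2 * j + p)) : Records D σ m k p M' := by
  intro s e hR
  obtain ⟨h1, h2, h3, h4⟩ := H s e hR
  exact ⟨by rw [h, h1], by rw [h, h2], by rw [h, h3], fun x hx => by rw [h, h4 x hx]⟩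

lemma Records.extend_of_not_irr {m k e p : ℕ} {M : ℕ → ℤ} (H : Records D σ m k p M)
    (hke : k ≤ e) (h : ∀ i, k ≤ i → i < e → ¬ D.Irr m i) : Records D σ m e p M := by
  intro s e' hR
  have h1 : s < k := by
    by_contra h1
    exact h s (by omega) (hR.lt.trans_le hR.le) hR.start.1
  have h2 : e' ≤ k := by
    by_contra h2
    exact h k le_rfl (by have := hR.le; omega) (hR.irr k (by omega) (by omega))
  refine H s e' ⟨hR.start, hR.lt, h2, hR.irr, ?_⟩
  by_cases h3 : e' = k
  · exact .inl h3
  · right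
    rcases hR.maximal with h4 | h4
    · omega
    · exact h4

/-- The list after the record of the run `[s₀, e)` has been written. -/
lemma Records.extend {m k e s₀ p : ℕ} {M M' : ℕ → ℤ} (H : Records D σ m k p M)
    (hR : D.RunTo m e s₀ e) (hk : s₀ ≤ k)
    (hold : ∀ j, (∀ y < σ + 5, j ≠ (σ + 5) * D.idx m s₀ + y) → M' (2 * j + p) = M (2 * j + p))
    (h0 : M' (2 * ((σ + 5) * D.idx m s₀) + p) = s₀)
    (h1 : M' (2 * ((σ + 5) * D.idx m s₀ + 1) + p) = ((D.K false e - D.K false s₀ : ℕ) : ℤ))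
    (h2 : M' (2 * ((σ + 5) * D.idx m s₀ + 2) + p) = ((D.K true e - D.K true s₀ : ℕ) : ℤ))
    (h3 : ∀ x < σ + 2,
      M' (2 * ((σ + 5) * D.idx m s₀ + 3 + x) + p) = ((D.cnt x e - D.cnt x s₀ : ℕ) : ℤ)) :
    Records D σ m e p M' := by
  intro s e' hR'
  have hs := hR.lt
  have hs' := hR'.lt
  have hle' := hR'.le
  rcases lt_trichotomy s s₀ with hlt | rfl | hlt
  -- Since `s₀` starts a run, an earlier run ends before `s₀`; its record is complete and lies in
  -- words that are not touched.
  · have hle : e' ≤ s₀ := by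
      by_contra hgt
      rcases hR.start.2 with h4 | h4
      · omega
      · exact h4 (hR'.irr _ (by omega) (by omega))
    have hend : ¬ D.Irr m e' := by
      rcases hR'.maximal with h4 | h4
      · omega
      · exact h4
    obtain ⟨g0, g1, g2, g3⟩ := H s e' ⟨hR'.start, hs', hle.trans hk, hR'.irr, .inr hend⟩
    have hidx : D.idx m s + 1 ≤ D.idx m s₀ := idx_lt hR'.start hlt
    have hmul := Nat.mul_le_mul_left (σ + 5) hidx
    rw [Nat.mul_succ] at hmul
    refine ⟨?_, ?_, ?_, fun x hx => ?_⟩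
    · rw [hold _ fun y hy => by omega, g0]
    · rw [hold _ fun y hy => by omega, g1]
    · rw [hold _ fun y hy => by omega, g2]
    · rw [hold _ fun y hy => by omega, g3 x hx]
  · have he : e' = e := by
      rcases hR'.maximal with h4 | h4
      · exact h4
      · by_contra h5
        exact h4 (hR.irr e' (by omega) (by omega))
    rw [he]
    exact ⟨h0, h1, h2, h3⟩
  · rcases hR'.start.2 with h4 | h4
    · omega
    · exact absurd (hR.irr (s - 1) (by omega) (by omega)) h4

/-- Recording writes only to addresses of the other parity, which leaves the list being read intact.
-/
lemma Between.frame {k : ℕ} {R' : Regs} {A' : Mem} (H : Between D σ I k R A)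
    (hR : ∀ r, r ∉ [Reg.x, .last, .newLen] → R' r = R r) (hA : ∀ a, a ≠ .irr → A' a = A a)
    (hirr : ∀ j, A' .irr (2 * j + I.p) = A .irr (2 * j + I.p)) : Between D σ I k R' A' := by
  refine ⟨H.fixR.congr fun r hr => hR r ?_, ?_, H.dyn.congr (hA _ (by decide)) (hA _ (by decide))
    (hA _ (by decide)), ?_, ?_, ?_, ?_, ?_, ?_, H.le, H.lcp, H.border⟩
  · revert r; decide
  · refine ⟨H.fixA.halves, H.fixA.lists, ?_, ?_, H.fixA.recs.congr hirr⟩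
    · rw [hA _ (by decide)]; exact H.fixA.C
    · rw [hA _ (by decide)]; exact H.fixA.Z
  · rw [hR _ (by decide)]; exact H.reg_k
  · rw [hR _ (by decide)]; exact H.reg_k0
  · rw [hR _ (by decide)]; exact H.reg_k1
  · rw [hA _ (by decide)]; exact H.ids
  · rw [hR _ (by decide)]; exact H.rd
  · rw [hR _ (by decide)]; exact H.act

/-- Blocks arrive from left to right, so an irrelevant one either prolongs the run of the last
record or opens a new run behind it. -/
lemma runs_recordBlock (hX : X.Fits D σ) (hm : I.m ≤ D.n) {s e : ℕ}
    (H : Between D σ I e R A) (HI : Item D σ I s e R A) (HR : Recorded D σ I s R A) :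
    Runs X (.ite (.eq (v .mono) 1) (.seq (recordBlock σ) (.assign .last 1)) (.assign .last 0))
      R A t fun R' A' t' => Between D σ I e R' A' ∧ Recorded D σ I e R' A' ∧
        t' ≤ t + 100 * (σ + 5) := by
  have hle := H.le
  have hlt := HI.lt
  have hbd := hX.bd
  have hbd' : 20 ≤ X.bd := by omega
  have hlists := H.fixA.lists
  refine .ite (fun h => ?_) (fun h => ?_)
  swap
  · have hni : ∀ i, s ≤ i → i < e → ¬ D.Irr (I.m + 1) i := by
      rcases HI.mono with ⟨h1, -⟩ | ⟨-, h1⟩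
      · rw [holds_eq_iff, val_reg, val_one hbd', h1] at h
        exact absurd rfl h
      · exact h1
    refine .assign (z := 0) (val_zero hbd') ⟨H.frame ?_ (fun _ _ => rfl) fun _ => rfl,
      ⟨?_, ?_, HR.recs.extend_of_not_irr hlt.le hni⟩, by simp; omega⟩
    · intro r hr
      simp only [List.mem_cons, List.not_mem_nil, or_false, not_or] at hr
      rw [set_apply, if_neg hr.2.1]
    · right
      exact ⟨by simp [set_apply], .inr (hni _ (by omega) (by omega))⟩
    · rw [set_apply, if_neg (by decide), HR.newLen,
        idx_eq hlt.le fun i h1 h2 h3 => hni i h1 h2 h3.1]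
  have hir : ∀ i, s ≤ i → i < e → D.Irr (I.m + 1) i := by
    rcases HI.mono with ⟨-, h1⟩ | ⟨h1, -⟩
    · exact h1
    · rw [holds_eq_iff, val_reg, val_one hbd', h1] at h
      norm_num at h
  have hxe := hir (e - 1) (by omega) (by omega)
  have hcap := hX.capIrr I.m hm
  -- The current run is among the `idx (m + 1) n` runs present after the iteration, so its record
  -- fits into the capacity.
  have bound : ∀ {s₀}, D.RunTo (I.m + 1) e s₀ e →
      2 * ((σ + 5) * D.idx (I.m + 1) s₀ + (σ + 5)) ≤ X.cap .irr ∧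
      (σ + 5) * D.idx (I.m + 1) s₀ + (σ + 5) ≤ (σ + 5) * D.n ∧
      (σ + 5) * D.idx (I.m + 1) e = (σ + 5) * D.idx (I.m + 1) s₀ + (σ + 5) := by
    intro s₀ hR
    have h1 : D.idx (I.m + 1) s₀ + 1 ≤ D.idx (I.m + 1) D.n := by
      rw [← hR.idx_eq]; exact idx_mono _ hle
    have h2 := Nat.mul_le_mul_left (σ + 5) h1
    have h3 := Nat.mul_le_mul_left (σ + 5) (h1.trans (D.idx_le _ _))
    rw [Nat.mul_succ] at h2 h3
    exact ⟨by omega, h3, by rw [hR.idx_eq, Nat.mul_succ]⟩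
  have hK0s := D.K_mono false hlt.le
  have hK1s := D.K_mono true hlt.le
  have hKe := D.K_add e
  -- the state after the record has been written
  have fin : ∀ {R' A' t'} {s₀ : ℕ}, D.RunTo (I.m + 1) e s₀ e → s₀ ≤ s →
      (∀ r, r ∉ [Reg.x, .newLen] → R' r = R r) → R' .newLen =
        (((σ + 5) * D.idx (I.m + 1) s₀ + (σ + 5) : ℕ) : ℤ) → (∀ a, a ≠ .irr → A' a = A a) →
      (∀ j, (∀ y < σ + 5, j ≠ 2 * ((σ + 5) * D.idx (I.m + 1) s₀ + y) + I.q) →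
        A' .irr j = A .irr j) →
      A' .irr (2 * ((σ + 5) * D.idx (I.m + 1) s₀) + I.q) = (s₀ : ℤ) →
      A' .irr (2 * ((σ + 5) * D.idx (I.m + 1) s₀ + 1) + I.q) =
        ((D.K false e - D.K false s₀ : ℕ) : ℤ) →
      A' .irr (2 * ((σ + 5) * D.idx (I.m + 1) s₀ + 2) + I.q) =
        ((D.K true e - D.K true s₀ : ℕ) : ℤ) →
      (∀ x < σ + 2, A' .irr (2 * ((σ + 5) * D.idx (I.m + 1) s₀ + 3 + x) + I.q) =
        ((D.cnt x e - D.cnt x s₀ : ℕ) : ℤ)) → t' ≤ t + 98 * (σ + 5) →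
      Runs X (.assign .last 1) R' A' t' fun R' A' t' => Between D σ I e R' A' ∧
        Recorded D σ I e R' A' ∧ t' ≤ t + 100 * (σ + 5) := by
    intro R' A' t' s₀ hR hs₀ h1 h2 h3 h4 h5 h6 h7 h8 h9
    refine .assign (z := 1) (val_one hbd') ⟨H.frame ?_ h3 fun j => h4 _ fun y _ => by omega,
      ⟨?_, ?_, HR.recs.extend hR hs₀ (fun j hj => h4 _ fun y hy hy' => hj y hy (by omega))
        h5 h6 h7 h8⟩, by simp; omega⟩
    · intro r hr
      simp only [List.mem_cons, List.not_mem_nil, or_false, not_or] at hr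
      rw [set_apply, if_neg hr.2.1, h1 r (by simp [hr])]
    · left
      exact ⟨by simp [set_apply], by omega, hxe⟩
    · rw [set_apply, if_neg (by decide), h2, (bound hR).2.2]
  unfold recordBlock
  refine .seq (.ite (fun hl => ?_) (fun hl => ?_))
  · -- merging with the preceding run
    obtain ⟨hs0, hprev⟩ : 0 < s ∧ D.Irr (I.m + 1) (s - 1) := by
      rcases HR.last with ⟨-, h1⟩ | ⟨h1, -⟩
      · exact h1
      · rw [holds_eq_iff, val_reg, val_one hbd', h1] at hl
        norm_num at hl
    obtain ⟨s₀, hR⟩ := exists_runTo_last hs0 hprev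
    have hRlt := hR.lt
    have hR' : D.RunTo (I.m + 1) e s₀ e := ⟨hR.start, by omega, le_rfl, fun i h1 h2 => by
      by_cases h3 : i < s
      · exact hR.irr i h1 h3
      · exact hir i (by omega) h2, .inl rfl⟩
    obtain ⟨r0, r1, r2, r3⟩ := HR.recs s₀ s hR
    obtain ⟨b1, b2, b3⟩ := bound hR'
    have fin' := @fin (s₀ := s₀)
    have hnl := HR.newLen
    rw [hR.idx_eq, Nat.mul_succ] at hnl
    set a := (σ + 5) * D.idx (I.m + 1) s₀ with ha
    have hK0 := D.K_mono false hRlt.le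
    have hK1 := D.K_mono true hRlt.le
    have hbase : ∀ (R' : Regs) (A' : Mem), R' .newLen = R .newLen →
        val X R' A' (v .newLen - recLen σ) = (a : ℤ) := by
      intro R' A' h1
      refine (val_sub_nat (a := a + (σ + 5)) (b := σ + 5) (by rw [val_reg, h1, hnl])
        ((val_lit_eq (by omega) (by omega)).trans (by push_cast; rfl)) (by omega)
        (by omega)).trans ?_
      congr 1; omega
    have hadd : ∀ (R' : Regs) (A' : Mem) (y : ℕ) (f : Expr), R' .newLen = R .newLen →
        R' .q = R .q → y < σ + 5 →
        val X R' A' (v .newLen - recLen σ + f) = ((a + y : ℕ) : ℤ) →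
        val X R' A' (addr .q (v .newLen - recLen σ + f)) = ((2 * (a + y) + I.q : ℕ) : ℤ) := by
      intro R' A' y f h1 h2 h3 h4
      exact val_addr h4 (by rw [h2, H.fixR.q]) (by omega)
    have hval1 : ∀ A', val X R A' (addr .q (v .newLen - recLen σ + 1)) =
        ((2 * (a + 1) + I.q : ℕ) : ℤ) := fun A' => hadd R A' 1 1 rfl rfl (by omega)
      (val_add_nat (hbase R A' rfl) (val_one hbd') (by omega))
    have hval2 : ∀ A', val X R A' (addr .q (v .newLen - recLen σ + 2)) =
        ((2 * (a + 2) + I.q : ℕ) : ℤ) := fun A' => hadd R A' 2 2 rfl rfl (by omega)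
      (val_add_nat (hbase R A' rfl) (val_two hbd') (by omega))
    refine .seq (.store (m := 2 * (a + 1) + I.q) (z := ((D.K false e - D.K false s₀ : ℕ) : ℤ))
      (hval1 A) ?_ (X.word_eq _ (by omega) (by omega)) (by omega) ?_)
    · refine (val_add_nat (a := D.K false s - D.K false s₀) (b := D.K false e - D.K false s)
        (by rw [val_load_nat (hval1 A), r1]) (by rw [val_reg, HI.z0]) (by omega)).trans ?_
      congr 1; omega
    refine .seq (.store (m := 2 * (a + 2) + I.q) (z := ((D.K true e - D.K true s₀ : ℕ) : ℤ))
      (hval2 _) ?_ (X.word_eq _ (by omega) (by omega)) (by omega) ?_)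
    · refine (val_add_nat (a := D.K true s - D.K true s₀) (b := D.K true e - D.K true s)
        ?_ (by rw [val_reg, HI.z1]) (by omega)).trans ?_
      · rw [val_load_nat (hval2 _), put_apply, if_pos rfl, if_neg (by omega), r2]
      · congr 1; omega
    set A1 := put (put A .irr (2 * (a + 1) + I.q) ((D.K false e - D.K false s₀ : ℕ) : ℤ)) .irr
      (2 * (a + 2) + I.q) ((D.K true e - D.K true s₀ : ℕ) : ℤ) with hA1
    have a1 : ∀ b, b ≠ .irr → A1 b = A b := by
      intro b hb
      rw [hA1, put_apply, if_neg hb, put_apply, if_neg hb]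
    have a1i : ∀ j, A1 .irr j = if j = 2 * (a + 2) + I.q then
        ((D.K true e - D.K true s₀ : ℕ) : ℤ) else if j = 2 * (a + 1) + I.q then
        ((D.K false e - D.K false s₀ : ℕ) : ℤ) else A .irr j := by
      intro j
      rw [hA1, put_apply, if_pos rfl, put_apply, if_pos rfl]
    refine .fill (fun x => 2 * (a + 3 + x) + I.q) (fun x => ((D.cnt x e - D.cnt x s₀ : ℕ) : ℤ))
      (by omega) (fun x y h1 => by omega) ?_ ?_ ?_ ?_
    · intro x hx A' h1 h2
      have hcn := D.cum_add_cnt_le x hle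
      have hc0 := D.cnt_mono x hRlt.le
      have hc1 := D.cnt_mono x hlt.le
      have h3 : val X (set R .x (x : ℤ)) A' (addr .q (v .newLen - recLen σ + 3 + v .x)) =
          ((2 * (a + 3 + x) + I.q : ℕ) : ℤ) :=
        val_addr (val_add_nat (val_add_nat (hbase _ _ (by simp [set_apply])) (val_three hbd')
          (by omega)) (by simp [set_apply]) (by omega)) (by simp [set_apply, H.fixR.q]) (by omega)
      refine ⟨h3, ?_⟩
      refine (val_add_nat (a := D.cnt x s - D.cnt x s₀) (b := D.cnt x e - D.cnt x s) ?_ ?_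
        (by omega)).trans ?_
      · rw [val_load_nat h3, h2 _ fun y hy => by omega, a1i, if_neg (by omega),
          if_neg (by omega), r3 x hx]
      · rw [val_load_nat (m := x) (by simp [set_apply]), h1 _ (by decide), a1 _ (by decide),
          HI.occ x hx]
      · congr 1; omega
    · intro x hx
      have hcn := D.cum_add_cnt_le x hle
      exact X.word_eq _ (by omega) (by omega)
    · intro x hx; omega
    · intro A' t' h1 h2 h3 h4
      refine fin' _ _ _ hR' (by omega) ?_ ?_ ?_ ?_ ?_ ?_ ?_ h2 ?_
      · intro r hr
        simp only [List.mem_cons, List.not_mem_nil, or_false, not_or] at hr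
        rw [set_apply, if_neg hr.1]
      · rw [set_apply, if_neg (by decide), hnl]
      · intro b hb
        rw [h1 b hb, a1 b hb]
      · intro j hj
        have hj1 := hj 1 (by omega)
        have hj2 := hj 2 (by omega)
        rw [h3 j fun y hy => fun h5 => hj (3 + y) (by omega) (by omega), a1i, if_neg hj2,
          if_neg hj1]
      · rw [h3 _ fun y hy => by omega, a1i, if_neg (by omega), if_neg (by omega), r0]
      · rw [h3 _ fun y hy => by omega, a1i, if_neg (by omega), if_pos rfl]
      · rw [h3 _ fun y hy => by omega, a1i, if_pos rfl]
      · simp [addr, recLen] at h4 ⊢; omega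
  · -- a new record
    have hst : D.RunStart (I.m + 1) s := by
      refine ⟨hir s le_rfl hlt, ?_⟩
      rcases HR.last with ⟨h1, -⟩ | ⟨-, h1⟩
      · rw [holds_eq_iff, val_reg, val_one hbd', h1] at hl
        exact absurd rfl hl
      · exact h1
    have hR' : D.RunTo (I.m + 1) e s e := ⟨hst, hlt, le_rfl, hir, .inl rfl⟩
    obtain ⟨b1, b2, b3⟩ := bound hR'
    have fin' := @fin (s₀ := s)
    have hnl := HR.newLen
    set a := (σ + 5) * D.idx (I.m + 1) s with ha
    have hval0 : ∀ A', val X R A' (addr .q (v .newLen)) = ((2 * a + I.q : ℕ) : ℤ) := fun A' =>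
      val_addr (by rw [val_reg, hnl]) (by rw [H.fixR.q]) (by omega)
    have hval1 : ∀ A', val X R A' (addr .q (v .newLen + 1)) =
        ((2 * (a + 1) + I.q : ℕ) : ℤ) := fun A' =>
      val_addr (val_add_nat (by rw [val_reg, hnl]) (val_one hbd') (by omega)) (by rw [H.fixR.q])
        (by omega)
    have hval2 : ∀ A', val X R A' (addr .q (v .newLen + 2)) =
        ((2 * (a + 2) + I.q : ℕ) : ℤ) := fun A' =>
      val_addr (val_add_nat (by rw [val_reg, hnl]) (val_two hbd') (by omega)) (by rw [H.fixR.q])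
        (by omega)
    refine .seq (.store (m := 2 * a + I.q) (z := (s : ℤ)) (hval0 _) (by rw [val_reg, HI.id])
      (X.word_eq _ (by omega) (by omega)) (by omega) ?_)
    refine .seq (.store (m := 2 * (a + 1) + I.q) (hval1 _) (by rw [val_reg, HI.z0])
      (X.word_eq _ (by omega) (by omega)) (by omega) ?_)
    refine .seq (.store (m := 2 * (a + 2) + I.q) (hval2 _) (by rw [val_reg, HI.z1])
      (X.word_eq _ (by omega) (by omega)) (by omega) ?_)
    set A1 := put (put (put A .irr (2 * a + I.q) (s : ℤ)) .irr (2 * (a + 1) + I.q)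
      ((D.K false e - D.K false s : ℕ) : ℤ)) .irr
      (2 * (a + 2) + I.q) ((D.K true e - D.K true s : ℕ) : ℤ) with hA1
    have a1 : ∀ b, b ≠ .irr → A1 b = A b := by
      intro b hb
      rw [hA1, put_apply, if_neg hb, put_apply, if_neg hb, put_apply, if_neg hb]
    have a1i : ∀ j, A1 .irr j = if j = 2 * (a + 2) + I.q then
        ((D.K true e - D.K true s : ℕ) : ℤ) else if j = 2 * (a + 1) + I.q then
        ((D.K false e - D.K false s : ℕ) : ℤ) else if j = 2 * a + I.q then (s : ℤ)
        else A .irr j := by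
      intro j
      rw [hA1, put_apply, if_pos rfl, put_apply, if_pos rfl, put_apply, if_pos rfl]
    refine .seq (.fill (fun x => 2 * (a + 3 + x) + I.q)
      (fun x => ((D.cnt x e - D.cnt x s : ℕ) : ℤ))
      (by omega) (fun x y h1 => by omega) ?_ ?_ ?_ ?_)
    · intro x hx A' h1 h2
      refine ⟨val_addr (val_add_nat (val_add_nat (by simp [set_apply, hnl]) (val_three hbd')
          (by omega)) (by simp [set_apply]) (by omega)) (by simp [set_apply, H.fixR.q])
          (by omega), ?_⟩
      rw [val_load_nat (m := x) (by simp [set_apply]), h1 _ (by decide), a1 _ (by decide),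
        HI.occ x hx]
    · intro x hx
      have hcn := D.cum_add_cnt_le x hle
      exact X.word_eq _ (by omega) (by omega)
    · intro x hx; omega
    · intro A' t' h1 h2 h3 h4
      refine .assign (z := ((a + (σ + 5) : ℕ) : ℤ)) (val_add_nat (by simp [set_apply, hnl])
        ((val_lit_eq (by omega) (by omega)).trans (by push_cast; rfl)) (by omega)) ?_
      refine fin' _ _ _ hR' le_rfl ?_ ?_ ?_ ?_ ?_ ?_ ?_ h2 ?_
      · intro r hr
        simp only [List.mem_cons, List.not_mem_nil, or_false, not_or] at hr
        rw [set_apply, if_neg hr.2, set_apply, if_neg hr.1]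
      · rw [set_apply, if_pos rfl]
      · intro b hb
        rw [h1 b hb, a1 b hb]
      · intro j hj
        have hj0 := hj 0 (by omega)
        have hj1 := hj 1 (by omega)
        have hj2 := hj 2 (by omega)
        rw [h3 j fun y hy => fun h5 => hj (3 + y) (by omega) (by omega), a1i, if_neg hj2,
          if_neg hj1, if_neg (by simpa using hj0)]
      · rw [h3 _ fun y hy => by omega, a1i, if_neg (by omega), if_neg (by omega), if_pos rfl]
      · rw [h3 _ fun y hy => by omega, a1i, if_neg (by omega), if_pos rfl]
      · rw [h3 _ fun y hy => by omega, a1i, if_pos rfl]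
      · simp [addr, recLen] at h4 ⊢; omega

end Gap

/-! ### One iteration -/

namespace Gap

open Merge

variable {X : Machine} {D : Merge} {σ : ℕ} {I : Iter} {R : Regs} {A : Mem} {t : ℕ}

lemma Merge.exists_next_runStart {m k n : ℕ} (hk : k ≤ n) (h : D.idx m k < D.idx m n) :
    ∃ s, k ≤ s ∧ s < n ∧ D.RunStart m s ∧ D.idx m s = D.idx m k := by
  classical
  have hs : ∃ s, k ≤ s ∧ s < n ∧ D.RunStart m s := by
    by_contra h1
    push Not at h1
    exact h.ne' (Merge.idx_eq hk h1)
  obtain ⟨h1, h2, h3⟩ := Nat.find_spec hs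
  refine ⟨Nat.find hs, h1, h2, h3, Merge.idx_eq h1 fun i h4 h5 h6 => ?_⟩
  exact Nat.find_min hs h5 ⟨h4, h5.trans h2, h6⟩

lemma Recorded.congr {k : ℕ} {R' : Regs} {A' : Mem} (H : Recorded D σ I k R A)
    (h1 : R' .last = R .last) (h2 : R' .newLen = R .newLen) (h3 : A' .irr = A .irr) :
    Recorded D σ I k R' A' :=
  ⟨by rw [h1]; exact H.last, by rw [h2]; exact H.newLen, by rw [h3]; exact H.recs⟩

/-- The test whether the next irrelevant block starts at the current position. -/
lemma Between.test (hX : X.Fits D σ) {k : ℕ} (H : Between D σ I k R A) (hk : k < D.n) :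
    holds X R A (.and (.lt (v .rd) (v .len)) (.eq (get .irr (addr .p (v .rd))) (v .k))) ↔
      D.Irr I.m k := by
  have hbd := hX.bd
  have hlists := H.fixA.lists
  have hidx := Nat.mul_le_mul_left (σ + 5) ((D.idx_le I.m k).trans hk.le)
  have hget : val X R A (get .irr (addr .p (v .rd))) =
      A .irr (2 * ((σ + 5) * D.idx I.m k) + I.p) :=
    val_load_nat (val_addr (by rw [val_reg, H.rd]) (by rw [H.fixR.p]) (by omega))
  rw [holds_and_iff, holds_lt_iff, holds_eq_iff, hget, val_reg, val_reg, val_reg, H.rd,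
    H.fixR.len, H.reg_k, Nat.cast_lt, Nat.mul_lt_mul_left (by omega)]
  constructor
  · rintro ⟨h1, h2⟩
    -- The record at `rd` is that of the first run starting at `k` or later, so comparing its start
    -- with `k` decides irrelevance.
    obtain ⟨s, h3, h4, h5, h6⟩ := exists_next_runStart hk.le h1
    obtain ⟨e, he⟩ := h5.exists_runTo h4
    have h7 := (H.fixA.recs s e he).1
    rw [h6, h2, Nat.cast_inj] at h7
    rw [h7]; exact h5.1
  · intro h
    have hst : D.RunStart I.m k := by
      refine ⟨h, ?_⟩
      rcases H.border with h1 | h1 | h1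
      · exact .inl h1
      · omega
      · exact .inr fun h2 => h1 ⟨h, h2⟩
    obtain ⟨e, he⟩ := hst.exists_runTo hk
    exact ⟨idx_lt hst hk, (H.fixA.recs k e he).1⟩

/-- A skipped run is charged to its record, a scanned block to its positions; as a block is never
empty, this pays for the `O(σ)` overhead too. -/
lemma runs_scan (hX : X.Fits D σ) (V : D.Valid σ) (hm : I.m ≤ D.n) (H : Between D σ I 0 R A)
    (HR : Recorded D σ I 0 R A) :
    Runs X (.loop (.lt (v .k) (v .n))
      (.seq (.ite (.and (.lt (v .rd) (v .len)) (.eq (get .irr (addr .p (v .rd))) (v .k)))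
        (skipBlock σ) (processBlock σ))
        (.ite (.eq (v .mono) 1) (.seq (recordBlock σ) (.assign .last 1)) (.assign .last 0))))
      R A t fun R' A' t' => Between D σ I D.n R' A' ∧ Recorded D σ I D.n R' A' ∧
        t' ≤ t + 400 * ((σ + 5) * (D.active I.m D.n + D.idx I.m D.n)) + 4 := by
  have hcost : (Cond.lt (v .k) (v .n)).cost = 3 := rfl
  have hcost' : (Cond.and (.lt (v .rd) (v .len))
    (.eq (get .irr (addr .p (v .rd))) (v .k))).cost = 12 := rfl
  refine .loop (fun μ R' A' t' => ∃ k, μ = D.n - k ∧ Between D σ I k R' A' ∧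
    Recorded D σ I k R' A' ∧ t' ≤ t + 400 * ((σ + 5) * (D.active I.m k + D.idx I.m k))) ?_
    ⟨0, rfl, H, HR, by omega⟩
  rintro μ R' A' t' ⟨k, rfl, H', HR', ht'⟩
  rcases H'.le.eq_or_lt with rfl | hk
  · refine .inr ⟨?_, H', HR', by omega⟩
    rw [holds_lt_iff, val_reg, val_reg, H'.reg_k, H'.fixR.n]
    exact lt_irrefl _
  refine .inl ⟨?_, ?_⟩
  · rw [holds_lt_iff, val_reg, val_reg, H'.reg_k, H'.fixR.n]
    exact_mod_cast hk
  rw [hcost]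
  refine .seq (.ite (fun h => ?_) (fun h => ?_))
  · rw [H'.test hX hk] at h
    refine (runs_skipBlock hX V H' hk h).mono ?_
    rintro R1 A1 t1 ⟨e, H1, HI, h1, h2, h3, hR, ht1⟩
    refine (runs_recordBlock hX hm H1 HI (HR'.congr h1 h2 h3)).mono ?_
    rintro R2 A2 t2 ⟨H2, HR2, ht2⟩
    have hlt := HI.lt
    refine ⟨D.n - e, by omega, e, rfl, H2, HR2, ?_⟩
    rw [hR.idx_eq, active_eq hlt.le hR.irr, ← add_assoc, Nat.mul_succ]
    rw [hcost'] at ht1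
    linarith
  · rw [H'.test hX hk] at h
    refine (runs_processBlock hX V H' hk h).mono ?_
    rintro R1 A1 t1 ⟨e, H1, HI, h1, h2, h3, hni, ht1⟩
    refine (runs_recordBlock hX hm H1 HI (HR'.congr h1 h2 h3)).mono ?_
    rintro R2 A2 t2 ⟨H2, HR2, ht2⟩
    have hlt := HI.lt
    refine ⟨D.n - e, by omega, e, rfl, H2, HR2, ?_⟩
    rw [Merge.idx_eq hlt.le fun i h4 h5 h6 => hni i h4 h5 h6.1, active_add hlt.le hni,
      add_right_comm, Nat.mul_add]
    obtain ⟨y, hy⟩ : ∃ y, e - k = y + 1 := ⟨e - k - 1, by omega⟩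
    have h5 : (σ + 5) * (e - k) = σ * y + 5 * y + (σ + 5) := by rw [hy]; ring
    rw [hcost'] at ht1
    omega

/-- The state between two iterations. -/
structure Outer (D : Merge) (σ : ℕ) (I : Iter) (R : Regs) (A : Mem) : Prop where
  fixA : FixA D σ I A
  old : ∀ p < D.n, D.Irr I.m p → A .Z (I.nx + p) = D.bit (I.m + 1) p
  B_zero : A B 0 = 1
  B_val : ∀ p, 0 < p → p < D.n → A B p = 0 ∨ (A B p = D.lcp p + 1 ∧ D.lcp p < I.m)
  B_old : ∀ x < D.n, ∀ d : ℕ, d < I.m → D.lcp (D.LF x) = d → A B (D.LF x) = 0 → D.Irr d x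
  n0 : R .n0 = (D.n0 : ℤ)
  n1 : R .n1 = (D.n1 : ℤ)
  n : R .n = (D.n : ℤ)
  h : R .h = (I.m : ℤ)
  cur : R .cur = (I.cu : ℤ)
  nxt : R .nxt = (I.nx : ℤ)
  p : R .p = (I.p : ℤ)
  q : R .q = (I.q : ℤ)
  len : R .len = (((σ + 5) * D.idx I.m D.n : ℕ) : ℤ)
  act : (R .act = 1 ∧ (I.m = 0 ∨ ∃ i < D.n, ¬ D.Irr I.m i)) ∨
    (R .act = 0 ∧ 0 < I.m ∧ ∀ i < D.n, D.Irr I.m i)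

lemma Outer.le (V : D.Valid σ) (H : Outer D σ I R A) (h : R .act = 1) : I.m ≤ D.n := by
  rcases H.act with ⟨-, h1 | ⟨i, h1, h2⟩⟩ | ⟨h1, -⟩
  · omega
  · rcases Nat.eq_zero_or_pos I.m with h3 | h3
    · omega
    · rw [show I.m = I.m - 1 + 1 by omega] at h2
      have := V.lt_of_active_pos h1 h2
      omega
  · rw [h] at h1; norm_num at h1

lemma bit_eq_of_irr (V : D.Valid σ) {m d p : ℕ} (hp : p < D.n) (h : D.Irr (m + 1) p) (hd : m ≤ d) :
    D.bit d p = D.bit m p := by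
  have := V.zbit_congr hp h hd
  unfold Merge.bit
  by_cases h : D.zbit m p <;> simp [h, this]

/-- The state after the bit vectors and the lists have been exchanged. -/
lemma Between.next (V : D.Valid σ) (H : Between D σ I D.n R A) (HR : Recorded D σ I D.n R A) :
    FixA D σ ⟨I.m + 1, I.nx, I.cu, I.q, I.p⟩ A ∧
    (∀ p < D.n, D.Irr (I.m + 1) p → A .Z (I.cu + p) = D.bit (I.m + 1 + 1) p) ∧
    ∀ x < D.n, ∀ d : ℕ, d < I.m + 1 → D.lcp (D.LF x) = d → A B (D.LF x) = 0 → D.Irr d x := by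
  have hfree : ∀ x < D.n, D.LF x < D.free (D.sym x) (D.K false D.n) (D.K true D.n) := by
    intro x hx
    rwa [V.free_K le_rfl, LF_lt_iff]
  refine ⟨⟨?_, ?_, H.fixA.C, ?_, HR.recs⟩, ?_, ?_⟩
  · have := H.fixA.halves; dsimp only; omega
  · have := H.fixA.lists; dsimp only; omega
  · intro p hp
    obtain ⟨x, hx, rfl⟩ := D.LF_surj hp
    -- Every position is an LF image. If the preimage was skipped, the position is irrelevant after
    -- this iteration and its bit has been copied; otherwise its bit has been moved.
    by_cases h : D.Irr I.m x
    · exact H.dyn.copy _ hp (V.irr_LF hx h)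
    · exact H.dyn.new x hx h (hfree x hx)
  · intro p hp h
    exact (H.fixA.Z p hp).trans (bit_eq_of_irr V hp h (by omega)).symm
  · intro x hx d hd hl hB
    -- The boundaries with value `m` are those due in this iteration; smaller values are inherited.
    rcases (Nat.lt_succ_iff.1 hd).eq_or_lt with rfl | hd
    · by_contra h
      exact H.dyn.B_new x hx h (hfree x hx) (by omega) hB
    · exact H.dyn.B_old x hx d hd hl hB

lemma runs_iteration (hX : X.Fits D σ) (V : D.Valid σ) (H : Outer D σ I R A) (ha : R .act = 1) :
    Runs X (iteration σ) R A t fun R' A' t' =>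
      Outer D σ ⟨I.m + 1, I.nx, I.cu, I.q, I.p⟩ R' A' ∧
        t' ≤ t + 400 * ((σ + 5) * (D.active I.m D.n + D.idx I.m D.n + 1)) := by
  have hm := H.le V ha
  have hbd := hX.bd
  have hbd' : 20 ≤ X.bd := by omega
  unfold iteration
  refine .seq (.assign (z := ((I.m + 1 : ℕ) : ℤ))
    (val_add_nat (by rw [val_reg, H.h]) (val_one hbd') (by omega)) ?_)
  refine .seq (.assign (z := 0) (val_zero hbd') (.seq (.assign (z := 0) (val_zero hbd')
    (.seq (.assign (z := 0) (val_zero hbd') (.seq (.assign (z := 0) (val_zero hbd')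
    (.seq (.assign (z := 0) (val_zero hbd') (.seq (.assign (z := 0) (val_zero hbd')
    (.seq (.assign (z := 0) (val_zero hbd') ?_)))))))))))))
  set R0 : Regs := set (set (set (set (set (set (set (set R .h ((I.m + 1 : ℕ) : ℤ)) .act 0)
    .last 0) .newLen 0) .rd 0) .k 0) .k0 0) .k1 0 with hR0
  refine .seq (Runs.forUpto (N := σ + 2) (fun x R' A' t' => R' = set R0 .x (x : ℤ) ∧
    (∀ a, a ≠ .F → a ≠ .blockId → A' a = A a) ∧
    (∀ y < x, A' .F y = D.cum y) ∧ (∀ y < x, A' .blockId y = -1) ∧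
    t' ≤ t + 40 + 20 * x) (by omega) ?_ ?_ ?_ ?_ ?_)
  · intro x R' A' t' _ _
    rw [val_lit_eq (by omega) (by omega)]; push_cast; rfl
  · exact ⟨rfl, fun _ _ _ => rfl, by simp, by simp, by simp⟩
  · rintro x R' A' t' _ ⟨rfl, -⟩
    simp [set_apply]
  · rintro x R' A' t' hx ⟨rfl, h1, h2, h3, h4⟩ -
    have hvx : ∀ A', val X (set R0 .x (x : ℤ)) A' (v .x) = (x : ℤ) := fun _ => by
      simp [set_apply]
    have hcum := D.cum_le x
    refine .seq (.store (m := x) (z := (D.cum x : ℤ)) (hvx _) ?_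
      (X.word_eq _ (by omega) (by omega)) (by rw [hX.capF]; exact hx) ?_)
    · rw [val_load_nat (hvx _), h1 _ (by decide) (by decide), H.fixA.C x hx]
    refine .store (m := x) (z := -1) (hvx _) (val_lit_eq (by omega) (by omega))
      (X.word_eq _ (by omega) (by omega)) (by rw [hX.capBlockId]; exact hx)
      ⟨by simp [set_apply], ?_, ?_, ?_, ?_, ?_⟩
    · rw [set_set]; push_cast; rfl
    · intro b h5 h6
      rw [put_apply, if_neg h6, put_apply, if_neg h5, h1 b h5 h6]
    · intro y hy
      rw [put_apply, if_neg (by decide), put_apply, if_pos rfl]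
      by_cases hyx : y = x
      · subst hyx; simp
      · simp only [hyx, if_false]
        exact h2 y (by omega)
    · intro y hy
      rw [put_apply, if_pos rfl]
      by_cases hyx : y = x
      · subst hyx; simp
      · simp only [hyx, if_false]
        rw [put_apply, if_neg (by decide)]
        exact h3 y (by omega)
    · simp; omega
  rintro R1 A1 t1 ⟨rfl, a1, a1F, a1id, ht1⟩ -
  have hR1 : ∀ r, r ∉ [Reg.h, .act, .last, .newLen, .rd, .k, .k0, .k1, .x] →
      set R0 .x ((σ + 2 : ℕ) : ℤ) r = R r := by
    intro r hr
    simp only [List.mem_cons, List.not_mem_nil, or_false, not_or] at hr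
    simp [set_apply, R0, hr]
  have hfix : FixR D σ I (set R0 .x ((σ + 2 : ℕ) : ℤ)) := by
    constructor
    · rw [hR1 _ (by decide), H.n0]
    · rw [hR1 _ (by decide), H.n1]
    · rw [hR1 _ (by decide), H.n]
    · simp [set_apply, R0]
    · rw [hR1 _ (by decide), H.cur]
    · rw [hR1 _ (by decide), H.nxt]
    · rw [hR1 _ (by decide), H.p]
    · rw [hR1 _ (by decide), H.q]
    · rw [hR1 _ (by decide), H.len]
  have hZ := a1 .Z (by decide) (by decide)
  have hB := a1 B (by decide) (by decide)
  have hfree : ∀ c, D.free c 0 0 = D.cum c := fun c => by simp [Merge.free]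
  -- Initially every image lies at or beyond the next free position of its bucket, so the statements
  -- about moved bits and new marks are void.
  have hno : ∀ x, ¬ D.LF x < D.free (D.sym x) (D.K false 0) (D.K true 0) := by
    intro x
    rw [K_zero, K_zero, hfree]
    unfold Merge.LF
    omega
  have HB : Between D σ I 0 (set R0 .x ((σ + 2 : ℕ) : ℤ)) A1 := by
    refine ⟨hfix, H.fixA.congr (a1 _ (by decide) (by decide)) hZ
      (a1 _ (by decide) (by decide)), ⟨?_, ?_, ?_, ?_, ?_, ?_, ?_, ?_⟩, ?_, ?_, ?_, ?_, ?_, ?_,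
      by omega, by rw [V.lcp_zero]; omega, .inl rfl⟩
    · rw [hZ]; exact H.old
    · exact fun x _ _ h => absurd h (hno x)
    · exact fun p hp => absurd hp (by omega)
    · rw [hB]; exact H.B_zero
    · intro p h1 h2
      rw [hB]
      rcases H.B_val p h1 h2 with h3 | ⟨h3, h4⟩
      · exact .inl h3
      · exact .inr ⟨h3, by omega⟩
    · rw [hB]; exact H.B_old
    · exact fun x _ _ h => absurd h (hno x)
    · intro c _ hc
      rw [a1F c hc, K_zero, K_zero, hfree]
    · simp [set_apply, R0]
    · simp [set_apply, R0]
    · simp [set_apply, R0]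
    · intro c hc
      rw [a1id c hc]; norm_num
    · simp [set_apply, R0]
    · right
      exact ⟨by simp [set_apply, R0], fun i hi => absurd hi (by omega)⟩
  have HR : Recorded D σ I 0 (set R0 .x ((σ + 2 : ℕ) : ℤ)) A1 := by
    refine ⟨.inr ⟨by simp [set_apply, R0], .inl rfl⟩, by simp [set_apply, R0], ?_⟩
    intro s e h
    have := h.lt; have := h.le
    omega
  refine .seq ((runs_scan hX V hm HB HR).mono ?_)
  rintro R2 A2 t2 ⟨H2, HR2, ht2⟩
  obtain ⟨g1, g2, g3⟩ := H2.next V HR2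
  unfold swap
  refine .seq (.seq (.assign (z := (I.cu : ℤ)) (by rw [val_reg, H2.fixR.cur])
    (.seq (.assign (z := (I.nx : ℤ)) (by simp [set_apply, H2.fixR.nxt])
    (.assign (z := (I.cu : ℤ)) (by simp [set_apply]) ?_)))))
  refine .seq (.seq (.assign (z := (I.p : ℤ)) (by simp [set_apply, H2.fixR.p])
    (.seq (.assign (z := (I.q : ℤ)) (by simp [set_apply, H2.fixR.q])
    (.assign (z := (I.p : ℤ)) (by simp [set_apply]) ?_)))))
  refine .assign (z := (((σ + 5) * D.idx (I.m + 1) D.n : ℕ) : ℤ))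
    (by simp only [val_reg, set_apply, reduceCtorEq, if_false]; exact HR2.newLen) ?_
  have hset := fun (r : Reg) (h : r ∉ [Reg.x, .cur, .nxt, .p, .q, .len]) =>
    (show set (set (set (set (set (set (set R2 .x (I.cu : ℤ)) .cur (I.nx : ℤ)) .nxt (I.cu : ℤ))
      .x (I.p : ℤ)) .p (I.q : ℤ)) .q (I.p : ℤ)) .len
      (((σ + 5) * D.idx (I.m + 1) D.n : ℕ) : ℤ) r = R2 r by
      simp only [List.mem_cons, List.not_mem_nil, or_false, not_or] at h
      simp only [set_apply, h, if_false])
  refine ⟨⟨g1, g2, H2.dyn.B_zero, ?_, g3, ?_, ?_, ?_, ?_, ?_, ?_, ?_, ?_, ?_, ?_⟩, ?_⟩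
  · intro p h1 h2
    push_cast
    exact H2.dyn.B_val p h1 h2
  · rw [hset _ (by decide), H2.fixR.n0]
  · rw [hset _ (by decide), H2.fixR.n1]
  · rw [hset _ (by decide), H2.fixR.n]
  · rw [hset _ (by decide), H2.fixR.h]
  · simp [set_apply]
  · simp [set_apply]
  · simp [set_apply]
  · simp [set_apply]
  · simp only [set_apply, if_true]
  · rw [hset _ (by decide)]
    rcases H2.act with ⟨h1, h2⟩ | ⟨h1, h2⟩
    · exact .inl ⟨h1, .inr h2⟩
    · exact .inr ⟨h1, Nat.succ_pos _, h2⟩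
  · rw [Nat.mul_succ]
    generalize (σ + 5) * (D.active I.m D.n + D.idx I.m D.n) = P at ht2 ⊢
    simp at ht1 ht2 ⊢
    omega

end Gap

/-! ### Set-up, final phase, and the whole algorithm -/

namespace Gap

open Merge

variable {X : Machine} {D : Merge} {σ : ℕ} {I : Iter} {R : Regs} {A : Mem} {t : ℕ}
  {Q : Regs → Mem → ℕ → Prop}

lemma Merge.Valid.bw_lt (V : D.Valid σ) {b : Bool} {k : ℕ} (hk : k < D.K b D.n) :
    D.bw b k < σ + 2 := by
  obtain ⟨x, -, hx, rfl, rfl⟩ := exists_K_eq (D := D) (b := b) (s := 0) (by simp) hk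
  rw [V.bw_K x hx]
  exact V.sym_lt x hx

lemma Merge.idx_zero_left (D : Merge) (x : ℕ) : D.idx 0 x = 0 := by
  rw [Merge.idx_eq (m := 0) (Nat.zero_le x) fun i _ _ h => h.1.elim, Merge.idx_zero]

/-- At depth `0` the whole range is a single block, its ends being the two values `-1`. -/
lemma Merge.Valid.zbit_zero (V : D.Valid σ) {p : ℕ} (hp : p < D.n) : D.zbit 0 p ↔ D.n0 ≤ p := by
  have hB : D.Blk 0 0 D.n := ⟨by omega, le_rfl, by rw [V.lcp_zero]; norm_num,
    by rw [V.lcp_end]; norm_num, fun m h1 h2 => by exact_mod_cast V.lcp_nonneg m h1 h2⟩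
  rw [hB.zbit_iff (Nat.zero_le _) hp, V.K_false, K_zero, add_zero]

/-- Counting the symbols of one of the input BWTs. -/
lemma runs_count (hX : X.Fits D σ) (V : D.Valid σ) {a : In} {r : Reg} (b : Bool)
    (ha : ∀ i, X.inp a i = D.bw b i) (hr : r ≠ .k) (hR : R r = (D.K b D.n : ℤ)) {g : ℕ → ℕ}
    (hg : ∀ c < σ + 2, g c ≤ D.n) (hA : ∀ c < σ + 2, A .occ c = (g c : ℤ))
    (post : ∀ A' t', (∀ a, a ≠ .occ → A' a = A a) →
      (∀ c < σ + 2, A' .occ c = ((g c + D.rank b c (D.K b D.n) : ℕ) : ℤ)) →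
      t' ≤ t + 20 + 20 * D.K b D.n → Q (set R .k (D.K b D.n : ℤ)) A' t') :
    Runs X (forUpto .k (v r) (incrAt .occ (.input a (v .k)))) R A t Q := by
  have hbd := hX.bd
  have hbd' : 20 ≤ X.bd := by omega
  have hK : D.K b D.n ≤ D.n := by
    have := D.K_add D.n
    cases b <;> omega
  refine Runs.forUpto (N := D.K b D.n) (fun i R' A' t' => R' = set R .k (i : ℤ) ∧
    (∀ a, a ≠ .occ → A' a = A a) ∧
    (∀ c < σ + 2, A' .occ c = ((g c + D.rank b c i : ℕ) : ℤ)) ∧ t' ≤ t + 10 + 20 * i)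
    (by omega) ?_ ?_ ?_ ?_ ?_
  · rintro i R' A' t' _ ⟨rfl, -⟩
    rw [val_reg, set_apply, if_neg hr, hR]
  · exact ⟨rfl, fun _ _ => rfl, fun c hc => by simpa using hA c hc, by simp⟩
  · rintro i R' A' t' _ ⟨rfl, -⟩
    simp [set_apply]
  · rintro i R' A' t' hi ⟨rfl, h1, h2, h3⟩ -
    have hlt := V.bw_lt hi
    have hin : val X (set R .k (i : ℤ)) A' (.input a (v .k)) = (D.bw b i : ℤ) := by
      rw [val_input_nat (m := i) (by simp [set_apply]), ha]
    have hrank : D.rank b (D.bw b i) i ≤ i := Nat.count_le _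
    have hgle := hg _ hlt
    unfold incrAt
    refine .store (m := D.bw b i) (z := ((g (D.bw b i) + D.rank b (D.bw b i) i + 1 : ℕ) : ℤ)) hin
      (val_add_nat (by rw [val_load_nat hin, h2 _ hlt]) (val_one hbd') (by omega))
      (X.word_eq _ (by omega) (by omega)) (by rw [hX.capOcc]; exact hlt)
      ⟨by simp [set_apply], ?_, ?_, ?_, ?_⟩
    · rw [set_set]; push_cast; rfl
    · intro a' ha'
      rw [put_apply, if_neg ha', h1 a' ha']
    · intro c hc
      rw [put_apply, if_pos rfl, rank_succ]
      by_cases h : c = D.bw b i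
      · subst h
        simp only [if_true]
        congr 1
      · simp only [h, if_false]
        rw [if_neg (Ne.symm h), add_zero, h2 c hc]
    · simp; omega
  · rintro R' A' t' ⟨rfl, h1, h2, h3⟩ -
    refine post A' _ h1 h2 ?_
    simp only [cost_reg]; omega

lemma runs_setup (hX : X.Fits D σ) (V : D.Valid σ) (h0 : R .n0 = (D.n0 : ℤ))
    (h1 : R .n1 = (D.n1 : ℤ)) :
    Runs X (setup σ) R A t fun R' A' t' => Outer D σ ⟨0, 0, D.n, 0, 1⟩ R' A' ∧ R' .act = 1 ∧
      t' ≤ t + 300 * (D.n + σ + 1) := by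
  have hbd := hX.bd
  have hbd' : 20 ≤ X.bd := by omega
  have hn : D.n = D.n0 + D.n1 := rfl
  have hnpos := V.n0_pos
  unfold setup
  refine .seq (.assign (z := (D.n : ℤ)) (val_add_nat h0 h1 (by omega)) ?_)
  refine .seq (.assign (z := 0) (val_zero hbd') (.seq (.assign (z := (D.n : ℤ))
    (by simp [set_apply]) (.seq (.assign (z := 0) (val_zero hbd')
    (.seq (.assign (z := 1) (val_one hbd') (.seq (.assign (z := 0) (val_zero hbd')
    (.seq (.assign (z := 0) (val_zero hbd')
    (.seq (.assign (z := 1) (val_one hbd') ?_)))))))))))))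
  set R0 : Regs := set (set (set (set (set (set (set (set R .n (D.n : ℤ)) .cur 0) .nxt (D.n : ℤ))
    .p 0) .q 1) .len 0) .h 0) .act 1 with hR0
  have r0n : R0 .n = (D.n : ℤ) := by simp [R0, set_apply]
  have r00 : R0 .n0 = (D.n0 : ℤ) := by simp [R0, set_apply, h0]
  have r01 : R0 .n1 = (D.n1 : ℤ) := by simp [R0, set_apply, h1]
  -- the bit vector and the block boundaries
  refine .seq (Runs.forUpto (N := D.n) (fun i R' A' t' => R' = set R0 .k (i : ℤ) ∧
    (∀ p < i, A' .Z p = D.bit 0 p ∧ A' B p = 0) ∧ t' ≤ t + 40 + 40 * i)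
    (by omega) ?_ ?_ ?_ ?_ ?_)
  · rintro i R' A' t' _ ⟨rfl, -⟩
    rw [val_reg, set_apply, if_neg (by decide), r0n]
  · exact ⟨rfl, fun p hp => absurd hp (by omega), by simp⟩
  · rintro i R' A' t' _ ⟨rfl, -⟩
    simp [set_apply]
  · rintro i R' A' t' hi ⟨rfl, h2, h3⟩ -
    have hk : ∀ A', val X (set R0 .k (i : ℤ)) A' (v .k) = (i : ℤ) := fun _ => by
      simp [set_apply]
    refine .seq (.mono (P := fun R'' A'' t'' => R'' = set R0 .k (i : ℤ) ∧
      A'' = put A' .Z i (D.bit 0 i) ∧ t'' ≤ t' + 15) ?_ ?_)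
    · refine .ite (fun h => ?_) (fun h => ?_)
      · have hz : D.bit 0 i = 0 := Merge.bit_eq (b := false) (by
          rw [holds_lt_iff, hk, val_reg, set_apply, if_neg (by decide), r00] at h
          rw [V.zbit_zero hi]; simp; omega)
        refine .store (m := i) (z := 0) (hk _) (val_zero hbd') rfl (by rw [hX.capZ]; omega)
          ⟨rfl, by rw [hz], by simp⟩
      · have hz : D.bit 0 i = 1 := Merge.bit_eq (b := true) (by
          rw [holds_lt_iff, hk, val_reg, set_apply, if_neg (by decide), r00] at h
          rw [V.zbit_zero hi]; simp; omega)
        refine .store (m := i) (z := 1) (hk _) (val_one hbd') rfl (by rw [hX.capZ]; omega)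
          ⟨rfl, by rw [hz], by simp⟩
    · rintro R'' A'' t'' ⟨rfl, rfl, ht⟩
      refine .store (m := i) (z := 0) (hk _) (val_zero hbd') (X.word_eq _ (by omega) (by omega))
        (by rw [hX.capLcp]; omega) ⟨by simp [set_apply], ?_, ?_, ?_⟩
      · rw [set_set]; push_cast; rfl
      · intro p hp
        have hz : ∀ z, put A' .Z i z B = A' B := fun z => by rw [put_apply, if_neg (by decide)]
        rw [put_apply, if_neg (by decide), put_apply, if_pos rfl, put_apply, if_pos rfl, hz]
        by_cases hpi : p = i
        · subst hpi; simp
        · simp only [hpi, if_false]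
          exact h2 p (by omega)
      · simp at ht ⊢; omega
  rintro R1 A1 t1 ⟨rfl, a1, ht1⟩ -
  refine .seq (.store (m := 0) (z := 1) (val_zero hbd') (val_one hbd')
    (X.word_eq _ (by omega) (by omega)) (by rw [hX.capLcp]; omega) ?_)
  refine .seq (.store (m := D.n) (z := 1) (by simp [set_apply, r0n]) (val_one hbd')
    (X.word_eq _ (by omega) (by omega)) (by rw [hX.capLcp]; omega) ?_)
  set A2 := put (put A1 B 0 1) B D.n 1 with hA2
  have a2Z : ∀ p < D.n, A2 .Z p = D.bit 0 p := by
    intro p hp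
    rw [hA2, put_apply, if_neg (by decide), put_apply, if_neg (by decide)]
    exact (a1 p hp).1
  have a2B : ∀ p < D.n, A2 B p = if p = 0 then 1 else 0 := by
    intro p hp
    rw [hA2, put_apply, if_pos rfl, if_neg (by omega), put_apply, if_pos rfl, (a1 p hp).2]
  -- counting the symbols
  refine .seq (.fill (fun x => x) (fun _ => 0) (by omega) (fun _ _ h => h) ?_ ?_ ?_ ?_)
  · intro x hx A' _ _
    exact ⟨by simp [set_apply], val_zero hbd'⟩
  · intro x _
    exact X.word_eq 0 (by omega) (by omega)
  · intro x hx
    rw [hX.capOcc]; exact hx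
  intro A3 t3 a3 a3occ _ ht3
  refine .seq (runs_count hX V false hX.bwt0 (by decide) (by simp [set_apply, r00, V.K_false])
    (g := fun _ => 0) (fun _ _ => by omega) (fun c hc => a3occ c hc) ?_)
  intro A4 t4 a4 a4occ ht4
  rw [V.K_false] at a4occ
  refine .seq (runs_count hX V true hX.bwt1 (by decide) (by simp [set_apply, r01, V.K_true])
    (fun c _ => ?_) a4occ ?_)
  · have : D.rank false c D.n0 ≤ D.n0 := Nat.count_le _
    omega
  intro A5 t5 a5 a5occ ht5
  have hocc : ∀ c < σ + 2, A5 .occ c = (D.cnt c D.n : ℤ) := by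
    intro c hc
    rw [a5occ c hc, ← D.acc_add, ← V.rank_K false c le_rfl, ← V.rank_K true c le_rfl, V.K_false]
    simp
  rw [set_set]
  set R5 := set (set (set R0 .k (D.n : ℤ)) .x ((σ + 2 : ℕ) : ℤ)) .k (D.K true D.n : ℤ) with hR5
  -- the array `C`
  refine .seq (.assign (z := 0) (val_zero hbd') ?_)
  refine Runs.forUpto (N := σ + 2) (fun x R' A' t' =>
    R' = set (set R5 .j (D.cum x : ℤ)) .x (x : ℤ) ∧ (∀ a, a ≠ .C → A' a = A5 a) ∧
    (∀ y < x, A' .C y = (D.cum y : ℤ)) ∧ t' ≤ t5 + 20 + 20 * x) (by omega) ?_ ?_ ?_ ?_ ?_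
  · intro x R' A' t' _ _
    rw [val_lit_eq (by omega) (by omega)]; push_cast; rfl
  · exact ⟨by simp, fun _ _ => rfl, fun y hy => absurd hy (by omega), by simp⟩
  · rintro x R' A' t' _ ⟨rfl, -⟩
    simp [set_apply]
  · rintro x R' A' t' hx ⟨rfl, h2, h3, h4⟩ -
    have hle := D.cum_le (x + 1)
    rw [cum_succ] at hle
    have hcx := D.cum_le x
    refine .seq (.store (m := x) (z := (D.cum x : ℤ)) (by simp [set_apply])
      (by simp [set_apply]) (X.word_eq _ (by omega) (by omega)) (by rw [hX.capC]; exact hx) ?_)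
    refine .assign (z := ((D.cum x + D.cnt x D.n : ℕ) : ℤ)) (val_add_nat (by simp [set_apply])
      ?_ (by omega)) ⟨by simp [set_apply], ?_, ?_, ?_, ?_⟩
    · rw [val_load_nat (m := x) (by simp [set_apply]), put_apply, if_neg (by decide),
        h2 _ (by decide), hocc x hx]
    · rw [cum_succ]
      funext r
      simp only [set_apply]
      push_cast
      split_ifs <;> rfl
    · intro a ha
      rw [put_apply, if_neg ha, h2 a ha]
    · intro y hy
      rw [put_apply, if_pos rfl]
      by_cases hyx : y = x
      · subst hyx; simp
      · simp only [hyx, if_false]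
        exact h3 y (by omega)
    · simp; omega
  rintro R6 A6 t6 ⟨rfl, a6, a6C, ht6⟩ -
  have hR6 : ∀ r, r ∉ [Reg.k, .x, .j] →
      set (set R5 .j (D.cum (σ + 2) : ℤ)) .x ((σ + 2 : ℕ) : ℤ) r = R0 r := by
    intro r hr
    simp only [List.mem_cons, List.not_mem_nil, or_false, not_or] at hr
    simp [set_apply, R5, hr]
  have a6' : ∀ a, a ≠ .C → a ≠ .occ → A6 a = A2 a := by
    intro a h2 h3
    rw [a6 a h2, a5 a h3, a4 a h3, a3 a h3]
  have hidx := D.idx_zero_left D.n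
  refine ⟨⟨⟨.inl ⟨rfl, rfl⟩, .inl ⟨rfl, rfl⟩, a6C, ?_, ?_⟩, ?_, ?_, ?_, ?_, ?_, ?_, ?_, ?_, ?_, ?_,
    ?_, ?_, ?_, ?_⟩, ?_, ?_⟩
  · intro p hp
    rw [a6' _ (by decide) (by decide), Nat.zero_add, a2Z p hp]
  · exact fun s e h => h.start.1.elim
  · exact fun p _ h => h.elim
  · rw [a6' _ (by decide) (by decide), a2B 0 (by omega), if_pos rfl]
  · intro p h2 h3
    rw [a6' _ (by decide) (by decide), a2B p h3, if_neg (by omega)]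
    exact .inl rfl
  · exact fun x _ d hd => absurd hd (Nat.not_lt_zero d)
  · rw [hR6 _ (by decide), r00]
  · rw [hR6 _ (by decide), r01]
  · rw [hR6 _ (by decide), r0n]
  · rw [hR6 _ (by decide)]; simp [R0, set_apply]
  · rw [hR6 _ (by decide)]; simp [R0, set_apply]
  · rw [hR6 _ (by decide)]; simp [R0, set_apply]
  · rw [hR6 _ (by decide)]; simp [R0, set_apply]
  · rw [hR6 _ (by decide)]; simp [R0, set_apply]
  · rw [hR6 _ (by decide), hidx]; simp [R0, set_apply]
  · left
    rw [hR6 _ (by decide)]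
    exact ⟨by simp [R0, set_apply], .inl rfl⟩
  · rw [hR6 _ (by decide)]; simp [R0, set_apply]
  · have := V.K_false
    have := V.K_true
    simp at ht1 ht3 ht4 ht5 ht6 ⊢
    omega

/-- Inside a block, the LCP value is that of one of the inputs. -/
lemma Outer.col_eq (V : D.Valid σ) (H : Outer D σ I R A) (hI : ∀ i < D.n, D.Irr I.m i) {k : ℕ}
    (hk : k + 1 < D.n) (hB : A B (k + 1) = 0) : D.col k = D.col (k + 1) := by
  have aux : ∀ a b : Bool, (a = false ↔ b = false) → a = b := by decide
  have key : ∀ d : ℕ, (d : ℤ) ≤ D.lcp (k + 1) → D.Mono d (k + 1) → D.col k = D.col (k + 1) := by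
    intro d hd hm
    refine aux _ _ (hm k (by omega) fun i h1 h2 => ?_)
    rwa [show i = k + 1 by omega]
  have hirr := hI _ hk
  obtain ⟨m, hm⟩ : ∃ m, I.m = m + 1 := Nat.exists_eq_succ_of_ne_zero fun h => by
    rw [h] at hirr; exact hirr
  -- A large value means that both ranks share a block of depth `m`, which is monochrome. For a
  -- small one, the missing mark makes the preimage irrelevant, and the two ranks share a monochrome
  -- block whose depth is the value itself.
  by_cases h : (m : ℤ) ≤ D.lcp (k + 1)
  · rw [hm] at hirr
    exact key m h hirr
  · have h1 := V.lcp_nonneg (k + 1) (by omega) hk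
    obtain ⟨x, hx, hxk⟩ := D.LF_surj hk
    have h2 := V.irr_LF hx (H.B_old x hx (D.lcp (k + 1)).toNat (by omega)
      (by rw [hxk]; omega) (by rw [hxk]; exact hB))
    rw [hxk] at h2
    exact key _ (by omega) h2

/-- Now the bits are the colours, so counting them gives the positions in the input arrays. The
output overwrites `B` from the left, and each entry of `B` is read before it is replaced. -/
lemma runs_finish (hX : X.Fits D σ) (V : D.Valid σ) (H : Outer D σ I R A) (ha : R .act ≠ 1) :
    Runs X finish R A t fun _ A' t' => (∀ k < D.n, A' .bwt01 k = D.sym k) ∧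
      (∀ k ≤ D.n, A' .lcp01 k = D.lcp k) ∧ t' ≤ t + 100 * (D.n + 1) := by
  have hbd := hX.bd
  have hbd' : 20 ≤ X.bd := by omega
  have hhalf := H.fixA.halves
  obtain ⟨hm, hI⟩ : 0 < I.m ∧ ∀ i < D.n, D.Irr I.m i := by
    rcases H.act with ⟨h1, -⟩ | ⟨-, h1⟩
    · exact absurd h1 ha
    · exact h1
  have hbit : ∀ k < D.n, D.bit I.m k = ((D.col k).toNat : ℤ) := by
    intro k hk
    refine Merge.bit_eq (V.zbit_of_mono hk ?_)
    exact (hI k hk).mono (Nat.le_succ _)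
  unfold finish
  refine .seq (.assign (z := 0) (val_zero hbd') (.seq (.assign (z := 0) (val_zero hbd') ?_)))
  refine .seq (Runs.forUpto (N := D.n) (fun i R' A' t' => R' .k = (i : ℤ) ∧
    R' .k0 = (D.K false i : ℤ) ∧ R' .k1 = (D.K true i : ℤ) ∧
    (∀ r, r ∉ [Reg.k, .k0, .k1, .x] → R' r = R r) ∧ A' .Z = A .Z ∧
    (∀ p < i, A' .bwt01 p = D.sym p) ∧ (∀ p, 0 < p → p < i → A' .lcp01 p = D.lcp p) ∧
    (∀ p, i ≤ p → A' .lcp01 p = A B p) ∧ t' ≤ t + 10 + 60 * i) (by omega) ?_ ?_ ?_ ?_ ?_)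
  · rintro i R' A' t' _ ⟨-, -, -, h1, -⟩
    rw [val_reg, h1 _ (by decide), H.n]
  · refine ⟨by simp [set_apply], by simp [set_apply], by simp [set_apply], ?_, rfl,
      fun p hp => absurd hp (by omega), fun p _ hp => absurd hp (by omega), fun _ _ => rfl,
      by simp⟩
    intro r hr
    simp only [List.mem_cons, List.not_mem_nil, or_false, not_or] at hr
    simp [set_apply, hr]
  · rintro i R' A' t' _ ⟨h, -⟩
    exact h
  · rintro i R' A' t' hi ⟨h1, h2, h3, h4, h5, h6, h7, h8, h9⟩ -
    have hZ : val X R' A' (get .Z (v .cur + v .k)) = ((D.col i).toNat : ℤ) := by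
      rw [val_load_nat (val_add_nat (a := I.cu) (b := i) (by rw [val_reg, h4 _ (by decide), H.cur])
        (by rw [val_reg, h1]) (by omega)), h5, H.fixA.Z i hi, hbit i hi]
    have hsym := V.sym_lt i hi
    have hbw := V.bw_K i hi
    have hKi := D.K_add i
    refine .seq (.mono (P := fun R'' A'' t'' => R'' .k = (i : ℤ) ∧
      R'' .k0 = (D.K false (i + 1) : ℤ) ∧ R'' .k1 = (D.K true (i + 1) : ℤ) ∧
      R'' .x = D.lc (D.col i) (D.K (D.col i) i) ∧
      (∀ r, r ∉ [Reg.k, .k0, .k1, .x] → R'' r = R r) ∧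
      A'' = put A' .bwt01 i (D.sym i) ∧ t'' ≤ t' + 30) ?_ ?_)
    · refine .ite (fun h => ?_) (fun h => ?_)
      · have hc : D.col i = false := by
          rw [holds_eq_iff, hZ, val_zero hbd'] at h
          cases hc : D.col i <;> simp [hc] at h ⊢
        rw [hc] at hbw
        refine .seq (.store (m := i) (z := (D.sym i : ℤ)) (by rw [val_reg, h1])
          (by rw [val_input_nat (by rw [val_reg, h2]), hX.bwt0, hbw])
          (X.word_eq _ (by omega) (by omega)) (by rw [hX.capBwt]; exact hi) ?_)
        refine .seq (.assign (z := D.lc false (D.K false i))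
          (by rw [val_input_nat (by rw [val_reg, h2]), hX.lcp0]) ?_)
        refine .assign (z := ((D.K false i + 1 : ℕ) : ℤ)) (val_add_nat (by simp [set_apply, h2])
          (val_one hbd') (by omega)) ⟨by simp [set_apply, h1], ?_, ?_, ?_, ?_, rfl, ?_⟩
        · rw [K_succ, if_pos hc]; simp [set_apply]
        · rw [K_succ, hc, if_neg (by decide)]; simp [set_apply, h3]
        · rw [hc]; simp [set_apply]
        · intro r hr
          rw [← h4 r hr]
          simp only [List.mem_cons, List.not_mem_nil, or_false, not_or] at hr
          simp [set_apply, hr]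
        · simp
      · have hc : D.col i = true := by
          rw [holds_eq_iff, hZ, val_zero hbd'] at h
          cases hc : D.col i <;> simp [hc] at h ⊢
        rw [hc] at hbw
        refine .seq (.store (m := i) (z := (D.sym i : ℤ)) (by rw [val_reg, h1])
          (by rw [val_input_nat (by rw [val_reg, h3]), hX.bwt1, hbw])
          (X.word_eq _ (by omega) (by omega)) (by rw [hX.capBwt]; exact hi) ?_)
        refine .seq (.assign (z := D.lc true (D.K true i))
          (by rw [val_input_nat (by rw [val_reg, h3]), hX.lcp1]) ?_)
        refine .assign (z := ((D.K true i + 1 : ℕ) : ℤ)) (val_add_nat (by simp [set_apply, h3])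
          (val_one hbd') (by omega)) ⟨by simp [set_apply, h1], ?_, ?_, ?_, ?_, rfl, ?_⟩
        · rw [K_succ, hc, if_neg (by decide)]; simp [set_apply, h2]
        · rw [K_succ, if_pos hc]; simp [set_apply]
        · rw [hc]; simp [set_apply]
        · intro r hr
          rw [← h4 r hr]
          simp only [List.mem_cons, List.not_mem_nil, or_false, not_or] at hr
          simp [set_apply, hr]
        · simp
    rintro R1 A1 t1 ⟨g1, g2, g3, g4, g5, rfl, ht1⟩
    have hBi : val X R1 (put A' .bwt01 i (D.sym i)) (get B (v .k)) = A B i := by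
      rw [val_load_nat (by rw [val_reg, g1]), put_apply, if_neg (by decide), h8 i le_rfl]
    have hlt := V.lcp_lt i hi.le
    -- the value that is written
    refine .mono (P := fun R2 A2 t2 => ∃ z, R2 = R1 ∧
      A2 = put (put A' .bwt01 i (D.sym i)) .lcp01 i z ∧ (0 < i → z = D.lcp i) ∧
      t2 ≤ t1 + 20) ?_ ?_
    · refine .ite (fun h => ?_) (fun h => ?_)
      · rw [holds_eq_iff, hBi, val_zero hbd'] at h
        have hi0 : 0 < i := Nat.pos_of_ne_zero fun h0 => by
          rw [h0, H.B_zero] at h; norm_num at h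
        have hx : R1 .x = D.lcp i := by
          rw [g4]
          obtain ⟨j, rfl⟩ : ∃ j, i = j + 1 := ⟨i - 1, by omega⟩
          exact V.lc_K j hi (H.col_eq V hI hi h)
        have := V.lcp_nonneg i hi0 hi
        exact .store (m := i) (z := D.lcp i) (by rw [val_reg, g1]) (by rw [val_reg, hx])
          (X.word_eq _ (by omega) (by omega)) (by rw [hX.capLcp]; omega)
          ⟨_, rfl, rfl, fun _ => rfl, by simp⟩
      · rw [holds_eq_iff, hBi, val_zero hbd'] at h
        obtain ⟨z, hz1, hz2, hz3, hz4⟩ : ∃ z : ℕ, A B i = ((z + 1 : ℕ) : ℤ) ∧ z + 1 ≤ X.bd ∧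
            (0 < i → (z : ℤ) = D.lcp i) ∧ z ≤ X.bd := by
          rcases Nat.eq_zero_or_pos i with h0 | h0
          -- Position `0` carries the mark `1` although its LCP value is `-1`; the entry is
          -- corrected after the loop.
          · exact ⟨0, by rw [h0, H.B_zero]; rfl, by omega, fun h => absurd h (by omega), by omega⟩
          · have := V.lcp_nonneg i h0 hi
            rcases H.B_val i h0 hi with h' | ⟨h', -⟩
            · exact absurd h' h
            · exact ⟨(D.lcp i).toNat, by rw [h']; push_cast; omega, by omega,
                fun _ => by omega, by omega⟩
        refine .store (m := i) (z := (z : ℤ)) (by rw [val_reg, g1])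
          (val_sub_nat (a := z + 1) (b := 1) (by rw [hBi, hz1]) (val_one hbd') (by omega) hz2)
          (X.word_eq _ (by omega) (by omega)) (by rw [hX.capLcp]; omega)
          ⟨_, rfl, rfl, hz3, by simp⟩
    rintro R2 A2 t2 ⟨z, rfl, rfl, hz, ht2⟩
    refine ⟨g1, by simp [set_apply], ?_, ?_, ?_, ?_, ?_, ?_, ?_, ?_⟩
    · simp [set_apply, g2]
    · simp [set_apply, g3]
    · intro r hr
      rw [← g5 r hr]
      simp only [List.mem_cons, List.not_mem_nil, or_false, not_or] at hr
      simp [set_apply, hr]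
    · rw [put_apply, if_neg (by decide), put_apply, if_neg (by decide), h5]
    · intro p hp
      rw [put_apply, if_neg (by decide), put_apply, if_pos rfl]
      by_cases hpi : p = i
      · subst hpi; simp
      · simp only [hpi, if_false]
        exact h6 p (by omega)
    · intro p h0 hp
      rw [put_apply, if_pos rfl]
      by_cases hpi : p = i
      · subst hpi; simpa using hz h0
      · simp only [hpi, if_false]
        rw [put_apply, if_neg (by decide), h7 p h0 (by omega)]
    · intro p hp
      rw [put_apply, if_pos rfl, if_neg (by omega), put_apply, if_neg (by decide),
        h8 p (by omega)]
    · omega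
  rintro R1 A1 t1 ⟨-, -, -, h4, -, h6, h7, -, h9⟩ -
  refine .seq (.store (m := 0) (z := -1) (val_zero hbd') (val_lit_eq (by omega) (by omega))
    (X.word_eq _ (by omega) (by omega)) (by rw [hX.capLcp]; omega) ?_)
  refine .store (m := D.n) (z := -1) (by rw [val_reg, h4 _ (by decide), H.n])
    (val_lit_eq (by omega) (by omega)) (X.word_eq _ (by omega) (by omega))
    (by rw [hX.capLcp]; omega) ⟨?_, ?_, ?_⟩
  · intro k hk
    rw [put_apply, if_neg (by decide), put_apply, if_neg (by decide), h6 k hk]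
  · intro k hk
    rw [put_apply, if_pos rfl, put_apply, if_pos rfl]
    by_cases h1 : k = D.n
    · rw [if_pos h1, h1, V.lcp_end]
    · rw [if_neg h1]
      by_cases h2 : k = 0
      · rw [if_pos h2, h2, V.lcp_zero]
      · rw [if_neg h2, h7 k (by omega) (by omega)]
  · simp at h9 ⊢; omega

/-- The cost of an iteration is proportional to its number of active positions, and these add up by
`sum_active_le`. The loop ends because no position can be active once `m` exceeds `n`. -/
lemma runs_gap (hX : X.Fits D σ) (V : D.Valid σ) (h0 : R .n0 = (D.n0 : ℤ))
    (h1 : R .n1 = (D.n1 : ℤ)) :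
    Runs X (gap σ) R A t fun _ A' t' => (∀ k < D.n, A' .bwt01 k = D.sym k) ∧
      (∀ k ≤ D.n, A' .lcp01 k = D.lcp k) ∧
      t' ≤ t + 500 * (D.n + σ + 1) + 2000 * ((σ + 5) * (3 * D.n + 2 * D.lcpSum)) := by
  have hbd := hX.bd
  have hbd' : 20 ≤ X.bd := by omega
  unfold gap
  refine .seq ((runs_setup hX V h0 h1).mono ?_)
  rintro R1 A1 t1 ⟨H1, ha1, ht1⟩
  refine .seq (.loop (fun μ R' A' t' => ∃ I : Iter, μ = D.n + 1 - I.m ∧ I.m ≤ D.n + 1 ∧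
    Outer D σ I R' A' ∧
    t' ≤ t1 + 2000 * ((σ + 5) * ∑ m ∈ Finset.range I.m, D.active m D.n)) ?_
    ⟨_, rfl, Nat.zero_le _, H1, by simp⟩)
  rintro μ R' A' t' ⟨I, rfl, hI, H, ht'⟩
  by_cases ha : R' .act = 1
  · refine .inl ⟨by rw [holds_eq_iff, val_reg, val_one hbd', ha]; rfl, ?_⟩
    have hm := H.le V ha
    refine (runs_iteration hX V H ha).mono ?_
    rintro R2 A2 t2 ⟨H2, ht2⟩
    refine ⟨D.n + 1 - (I.m + 1), by omega, _, rfl, by dsimp only; omega, H2, ?_⟩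
    dsimp only
    rw [Finset.sum_range_succ, Nat.mul_add]
    have hpos : 1 ≤ D.active I.m D.n := by
      obtain ⟨i, hi, hi'⟩ : ∃ i < D.n, ¬ D.Irr I.m i := by
        rcases H.act with ⟨-, h2 | h2⟩ | ⟨h2, -⟩
        · have := V.n_ge
          exact ⟨0, by omega, by rw [h2]; exact id⟩
        · exact h2
        · rw [ha] at h2; norm_num at h2
      have h3 := active_mono (D := D) I.m (Nat.succ_le_of_lt hi)
      rw [active_succ, if_neg hi'] at h3
      omega
    have hidx := idx_le_active (D := D) I.m D.n
    -- Here `idx ≤ active + 1` and `1 ≤ active`, so the sum is at most `2 * active + 2`, hence at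
    -- most `4 * active`.
    have hmul : (σ + 5) * (D.active I.m D.n + D.idx I.m D.n + 1) ≤
        4 * ((σ + 5) * D.active I.m D.n) := by
      have := Nat.mul_le_mul_left (σ + 5) (show D.active I.m D.n + D.idx I.m D.n + 1 ≤
        4 * D.active I.m D.n by omega)
      linarith
    have hmul' := Nat.mul_le_mul_left (σ + 5) hpos
    simp only [cost_eq, cost_reg, cost_ofNat] at ht2
    linarith
  · refine .inr ⟨by rw [holds_eq_iff, val_reg, val_one hbd']; exact ha, ?_⟩
    refine (runs_finish hX V H ha).mono ?_
    rintro R2 A2 t2 ⟨h2, h3, ht2⟩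
    refine ⟨h2, h3, ?_⟩
    have hsum := Nat.mul_le_mul_left (σ + 5) (V.sum_active_le I.m)
    simp only [cost_eq, cost_reg, cost_ofNat] at ht2
    linarith

end Gap

/-! ### Back to strings, and the constants -/

namespace Gap

open Merge

variable {σ : ℕ}

lemma irrelevant_iff (u₀ u₁ : List (Fin σ)) (h i : ℕ) :
    Irrelevant (text 0 u₀) (text 1 u₁) h i ↔ (merged u₀ u₁).Mono h i := by
  have hn : (text 0 u₀).length + (text 1 u₁).length = (merged u₀ u₁).n := by
    rw [← cat_length, List.length_append]
  have hcol : ∀ j, FromFirst (text 0 u₀) (text 1 u₁) j ↔ (merged u₀ u₁).col j = false := by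
    intro j
    change sa (cat u₀ u₁) j < _ ↔ decide (u₀.length + 1 ≤ sa (cat u₀ u₁) j) = false
    rw [text_length, decide_eq_false_iff_not, not_le]
  unfold Irrelevant Merge.Mono
  rw [hn]
  simp only [hcol]
  rfl

/-- Depth `h` belongs to iteration `h + 1`, hence the shift. -/
lemma numIrrelevant_eq (u₀ u₁ : List (Fin σ)) (h : ℕ) :
    numIrrelevant (text 0 u₀) (text 1 u₁) h = (merged u₀ u₁).idx (h + 1) (merged u₀ u₁).n := by
  classical
  have hn : (text 0 u₀).length + (text 1 u₁).length = (merged u₀ u₁).n := by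
    rw [← cat_length, List.length_append]
  unfold numIrrelevant idx
  rw [Nat.count_eq_card_filter_range, hn]
  congr 1
  ext i
  simp only [Finset.mem_filter, irrelevant_iff]
  rfl

lemma idx_le_maxIrrelevant (u₀ u₁ : List (Fin σ)) {m : ℕ} (hm : m ≤ (merged u₀ u₁).n) :
    (merged u₀ u₁).idx (m + 1) (merged u₀ u₁).n ≤ maxIrrelevant (text 0 u₀) (text 1 u₁) := by
  rw [← numIrrelevant_eq]
  have hn : (text 0 u₀).length + (text 1 u₁).length = (merged u₀ u₁).n := by
    rw [← cat_length, List.length_append]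
  unfold maxIrrelevant
  rw [hn]
  exact Finset.le_sup (f := numIrrelevant _ _) (Finset.mem_range.2 (Nat.lt_succ_of_le hm))

lemma bwt₂_eq (u₀ u₁ : List (Fin σ)) :
    bwt₂ (text 0 u₀) (text 1 u₁) = (List.range (merged u₀ u₁).n).map (merged u₀ u₁).sym := by
  unfold bwt₂
  refine List.ext_getElem (by simp [← cat_length]) fun i h1 h2 => ?_
  have hi : i < (merged u₀ u₁).n := by simpa using h2
  have hi' : i < (cat u₀ u₁).length := by rwa [cat_length]
  have hsa := sa_lt hi'
  rw [cat_length] at hsa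
  rw [List.getElem_map, List.getElem_map, List.getElem_range, ← sa_eq hi']
  change _ = (cat u₀ u₁).getD (prev u₀ u₁ (sa (cat u₀ u₁) i)) 0
  obtain ⟨p, hp, hq⟩ := exists_pos hsa
  generalize sa (cat u₀ u₁) i = q at hq hp ⊢
  generalize decide (u₀.length + 1 ≤ q) = b at hq hp
  subst hq
  rw [prev_pos hp, getD_pos (by split_ifs <;> omega)]
  cases b
  · rw [show pos u₀ false p = p from rfl, show part u₀ u₁ false = text 0 u₀ from rfl] at *
    by_cases h : p = 0
    · simp [h]
    · rw [if_neg h, if_pos hp, if_neg h]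
  · have h1 : pos u₀ true p = u₀.length + 1 + p := rfl
    rw [show part u₀ u₁ true = text 1 u₁ from rfl, text_length, if_neg (by omega),
      if_neg (by omega)]
    by_cases h : p = 0
    · rw [if_pos (by omega), if_pos h]
    · rw [if_neg (by omega), if_neg h, h1, Nat.add_sub_cancel_left]

lemma word_eq_self {w : ℕ} {z : ℤ} (h : -2 ^ w ≤ z) (h' : z < 2 ^ w) : word (w + 1) z = z := by
  unfold word
  have h2 : ((2 ^ (w + 1) : ℕ) : ℤ) = 2 * 2 ^ w := by push_cast; ring
  refine Int.bmod_eq_of_le ?_ ?_ <;> rw [h2] <;> omega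

/-- The word size is large enough. -/
lemma bound_lt_two_pow {n : ℕ} (hn : 2 ≤ n) :
    2 * ((σ + 5) * n) + 2 * n + 2 * σ + 20 < 2 ^ (Nat.log 2 n + 1 + (3 * σ + 22)) := by
  have h1 : n < 2 ^ (Nat.log 2 n + 1) := Nat.lt_pow_succ_log_self (by omega) n
  have h2 : 3 * σ + 22 < 2 ^ (3 * σ + 22) := Nat.lt_two_pow_self
  have h3 := Nat.mul_le_mul h1.le h2.le
  -- As `n ≥ 2`, the constant `2 * σ + 20` is at most `(σ + 10) * n`.
  have h4 : 2 * ((σ + 5) * n) + 2 * n + 2 * σ + 20 ≤ n * (3 * σ + 22) := by nlinarith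
  have h5 := Nat.mul_lt_mul_of_lt_of_le h1 h2.le (by omega)
  rw [pow_add]
  omega

/-- The machine that runs the Gap algorithm on two strings. -/
noncomputable def machine (u₀ u₁ : List (Fin σ)) : Machine where
  -- One bit more than in `bound_lt_two_pow`, for the sign.
  w := Nat.log 2 (merged u₀ u₁).n + (3 * σ + 24)
  inp := inputs (text 0 u₀) (text 1 u₁)
  cap
    | .Z => 2 * (merged u₀ u₁).n
    | .bwt01 => (merged u₀ u₁).n
    | .lcp01 => (merged u₀ u₁).n + 1
    | .irr => 2 * ((σ + 5) * maxIrrelevant (text 0 u₀) (text 1 u₁))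
    | _ => σ + 2
  bd := 2 * ((σ + 5) * (merged u₀ u₁).n) + 2 * (merged u₀ u₁).n + 2 * σ + 20
  word_eq z h h' := by
    have hb := bound_lt_two_pow (σ := σ) (merged_valid u₀ u₁).n_ge
    rw [show Nat.log 2 (merged u₀ u₁).n + (3 * σ + 24) =
      Nat.log 2 (merged u₀ u₁).n + 1 + (3 * σ + 22) + 1 by omega]
    have hb' : (((2 * ((σ + 5) * (merged u₀ u₁).n) + 2 * (merged u₀ u₁).n + 2 * σ + 20 : ℕ)) : ℤ) <
      2 ^ (Nat.log 2 (merged u₀ u₁).n + 1 + (3 * σ + 22)) := by exact_mod_cast hb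
    exact word_eq_self (by omega) (by omega)

lemma machine_fits (u₀ u₁ : List (Fin σ)) : (machine u₀ u₁).Fits (merged u₀ u₁) σ where
  bwt0 _ := rfl
  bwt1 _ := rfl
  lcp0 _ := rfl
  lcp1 _ := rfl
  bd := le_rfl
  capZ := rfl
  capC := rfl
  capF := rfl
  capBlockId := rfl
  capOcc := rfl
  capBwt := rfl
  capLcp := rfl
  capIrr _ hm := Nat.mul_le_mul_left _ (Nat.mul_le_mul_left _ (idx_le_maxIrrelevant u₀ u₁ hm))

lemma mul_aveLcp (u₀ u₁ : List (Fin σ)) :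
    ((merged u₀ u₁).n : ℝ) * aveLcp (cat u₀ u₁) = ((merged u₀ u₁).lcpSum : ℝ) := by
  have V := merged_valid u₀ u₁
  have hn : ((merged u₀ u₁).n : ℝ) ≠ 0 := by
    have := V.n_ge
    positivity
  unfold aveLcp lcpSum
  rw [cat_length, mul_div_cancel₀ _ hn, Nat.cast_sum]
  refine Finset.sum_congr rfl fun i hi => ?_
  rw [Finset.mem_Ico] at hi
  have h : ((((merged u₀ u₁).lcp i).toNat : ℕ) : ℤ) = (merged u₀ u₁).lcp i :=
    Int.toNat_of_nonneg (V.lcp_nonneg i (by omega) hi.2)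
  change (((merged u₀ u₁).lcp i : ℤ) : ℝ) = _
  rw [← h]
  rfl

/-- Replacing `n` by `S + σ + 3` leaves `S + 2σ + 4` and `5S + 3σ + 9`, and the maximum with `1`
absorbs the constants. -/
lemma time_le {n S T : ℕ} (hn : n ≤ S + σ + 3)
    (hT : T ≤ 500 * (n + σ + 1) + 2000 * ((σ + 5) * (3 * n + 2 * S))) :
    T ≤ (500 * (2 * σ + 5) + 2000 * ((σ + 5) * (3 * σ + 14))) * max 1 S := by
  have h1 : 1 ≤ max 1 S := le_max_left _ _
  have h2 : S ≤ max 1 S := le_max_right _ _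
  generalize max 1 S = M at *
  have h3 : σ ≤ σ * M := Nat.le_mul_of_pos_right _ h1
  have h4 : n + σ + 1 ≤ (2 * σ + 5) * M := by nlinarith
  have h5 : 3 * n + 2 * S ≤ (3 * σ + 14) * M := by nlinarith
  have h6 := Nat.mul_le_mul_left (σ + 5) h5
  rw [← mul_assoc] at h6
  rw [Nat.add_mul, mul_assoc, mul_assoc 2000]
  omega

end Gap

theorem theorem1 (σ : ℕ) :
    ∃ c K : ℕ, ∀ (u₀ u₁ : List (Fin σ)) (t₀ t₁ : List ℕ) (n w : ℕ),
      t₀ = Gap.text 0 u₀ → t₁ = Gap.text 1 u₁ →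
      n = (Gap.bwt t₀).length + (Gap.bwt t₁).length → w = Nat.log 2 n + c →
      ∃ (s : Gap.State) (T : ℕ),
        Gap.Exec w (Gap.inputs t₀ t₁) (Gap.gap σ)
          (Gap.initial (Gap.bwt t₀).length (Gap.bwt t₁).length) s T ∧
        ((List.range n).map (s.arr .bwt01) = (Gap.bwt₂ t₀ t₁).map Int.ofNat) ∧
        (∀ i ≤ n, s.arr .lcp01 i = Gap.lcpArray (t₀ ++ t₁) i) ∧
        (T : ℝ) ≤ K * max 1 (n * Gap.aveLcp (t₀ ++ t₁)) ∧
        s.used .bwt01 ≤ n ∧ s.used .lcp01 ≤ n + 1 ∧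
        Gap.workBits w s ≤ 2 * n + K * Nat.log 2 n ∧
        Gap.irrBits w s ≤ K * w * Gap.maxIrrelevant t₀ t₁ := by
  obtain ⟨K₁, hK₁⟩ : ∃ k, k = 500 * (2 * σ + 5) + 2000 * ((σ + 5) * (3 * σ + 14)) := ⟨_, rfl⟩
  -- There are 24 registers and four arrays of `σ + 2` words. As `n ≥ 2`, a word has at most `(3 * σ
  -- + 25) * log n` bits.
  obtain ⟨K₂, hK₂⟩ : ∃ k, k = (3 * σ + 25) * (24 + 4 * (σ + 2)) := ⟨_, rfl⟩
  -- Two lists of records of `σ + 5` words.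
  obtain ⟨K₃, hK₃⟩ : ∃ k, k = 2 * (σ + 5) := ⟨_, rfl⟩
  refine ⟨3 * σ + 24, K₁ + K₂ + K₃, ?_⟩
  rintro u₀ u₁ _ _ n w rfl rfl hn hw
  have V := Gap.merged_valid u₀ u₁
  have hl : ∀ t, (Gap.bwt t).length = t.length := fun t => by simp [Gap.bwt]
  have hn' : n = (Gap.merged u₀ u₁).n := by
    rw [hn, hl, hl, ← Gap.cat_length, List.length_append]
  subst hn'
  have h0 : ((Gap.bwt (Gap.text 0 u₀)).length : ℤ) = ((Gap.merged u₀ u₁).n0 : ℤ) := by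
    rw [hl, Gap.text_length]; rfl
  have h1 : ((Gap.bwt (Gap.text 1 u₁)).length : ℤ) = ((Gap.merged u₀ u₁).n1 : ℤ) := by
    rw [hl, Gap.text_length]; rfl
  obtain ⟨R, A, u, T, hex, hu, g1, g2, g3⟩ := Gap.runs_gap (Gap.machine_fits u₀ u₁) V
    (R := (Gap.initial (Gap.bwt (Gap.text 0 u₀)).length (Gap.bwt (Gap.text 1 u₁)).length).reg)
    (A := fun _ _ => 0) (t := 0) h0 h1 (fun _ => 0) (fun _ => Nat.zero_le _)
  refine ⟨⟨R, A, u⟩, T, ?_, ?_, ?_, ?_, hu .bwt01, hu .lcp01, ?_, ?_⟩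
  · rw [hw]; exact hex
  · rw [Gap.bwt₂_eq, List.map_map]
    refine List.map_congr_left fun i hi => ?_
    exact g1 i (List.mem_range.1 hi)
  · exact fun i hi => g2 i hi
  · rw [Gap.mul_aveLcp]
    have h2 := Gap.time_le V.n_le (T := T) (by simpa using g3)
    rw [← hK₁] at h2
    have h3 : T ≤ (K₁ + K₂ + K₃) * max 1 (Gap.merged u₀ u₁).lcpSum :=
      h2.trans (Nat.mul_le_mul_right _ (by omega))
    exact_mod_cast h3
  · have hlog : 1 ≤ Nat.log 2 (Gap.merged u₀ u₁).n := Nat.log_pos (by omega) V.n_ge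
    have hZ : u .Z ≤ 2 * (Gap.merged u₀ u₁).n := hu .Z
    have hC : u .C ≤ σ + 2 := hu .C
    have hF : u .F ≤ σ + 2 := hu .F
    have hI : u .blockId ≤ σ + 2 := hu .blockId
    have hO : u .occ ≤ σ + 2 := hu .occ
    have hcard : Fintype.card Gap.Reg = 24 := rfl
    have hsum : Gap.workBits w ⟨R, A, u⟩ =
        w * 24 + (u .Z + (w * u .C + (w * u .F + (w * u .blockId + w * u .occ)))) := by
      unfold Gap.workBits
      rw [hcard]
      simp [Gap.cellBits]
    have hw' : w ≤ Nat.log 2 (Gap.merged u₀ u₁).n * (3 * σ + 25) := by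
      rw [hw]; nlinarith
    have h2 := Nat.mul_le_mul_left w hC
    have h3 := Nat.mul_le_mul_left w hF
    have h4 := Nat.mul_le_mul_left w hI
    have h5 := Nat.mul_le_mul_left w hO
    have h6 := Nat.mul_le_mul_right (24 + 4 * (σ + 2)) hw'
    rw [mul_assoc, ← hK₂, mul_comm] at h6
    rw [hsum]
    nlinarith
  · have h2 : u .irr ≤ K₃ * Gap.maxIrrelevant (Gap.text 0 u₀) (Gap.text 1 u₁) := by
      rw [hK₃, mul_assoc]; exact hu .irr
    calc Gap.irrBits w ⟨R, A, u⟩ = w * u .irr := rfl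
      _ ≤ w * (K₃ * Gap.maxIrrelevant (Gap.text 0 u₀) (Gap.text 1 u₁)) :=
        Nat.mul_le_mul_left _ h2
      _ = K₃ * w * Gap.maxIrrelevant (Gap.text 0 u₀) (Gap.text 1 u₁) := by ring
      _ ≤ _ := Nat.mul_le_mul_right _ (Nat.mul_le_mul_right _ (by omega))
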